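/- Let $\mathbb H^n=\mathbb R^{2n+1}$ with points $(z,t)=(x_1,\dots,x_n,y_1,\dots,y_n,t)$ and left-invariant frame $X_j=\partial_{x_j}+y_j\partial_t$, $Y_j=\partial_{y_j}-x_j\partial_t$, $T=\partial_t$; write $Z_j=X_j$, $Z_{n+j}=Y_j$ for $1\le j\le n$. Let $\langle\cdot,\cdot\rangle$ be the Riemannian metric making this frame orthonormal, $\mathcal H=\mathrm{span}\{X_j,Y_j\}$, $J$ the complex structure $J(X_j)=Y_j$, $J(Y_j)=-X_j$, $J(T)=0$, and $\nabla$ the pseudohermitian connection, for which the frame is parallel. Let $S\subset\mathbb H^n$ be a smooth immersed hypersurface without boundary that is non-characteristic ($T_pS\neq\mathcal H_p$ for all $p\in S$), with (local, smooth) Riemannian unit normal $N$; none of the statements below depends on the choice of $\pm N$. Let $N^{\mathbb H}=N-\langle N,T\rangle T$, $\nu=N^{\mathbb H}/|N^{\mathbb H}|$, $\alpha=\langle N,T\rangle/|N^{\mathbb H}|$, $\mathcal HTS=\mathcal H\cap TS$ (of rank $2n-1$), and $\pi(X)=X-\langle X,\nu\rangle\nu$ for horizontal $X$. For $X,Y\in\mathcal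 HTS$ put $$h(X,Y)=\langle\nabla_X\nu,Y\rangle,\qquad \tilde h(X,Y)=\langle\nabla_X\nu+\alpha J'(X),Y\rangle,\qquad \tilde h_J(X,Y)=\tilde h(\pi(J(X)),\pi(J(Y))),$$ where $J'(J(\nu))=0$ and $J'=J$ on the orthogonal complement of $J(\nu)$ in $\mathcal HTS$. Scalar products and norms of horizontal tensors are taken with respect to orthonormal frames of $\mathcal HTS$. Let $\ell=h(J(\nu),J(\nu))$, $H=\operatorname{trace}h$ (on $\mathcal HTS$) and $$q=|\tilde h|^2+4J(\nu)\alpha+2(n+1)\alpha^2 .$$ $S$ is minimal if $H\equiv0$. Let $\nabla^{\mathcal H,S}$ be the horizontal tangential gradient on functions and, on horizontal tensors, the covariant derivative along $\mathcal HTS$ induced by the connection $\nabla^S_XY=\nabla_XY-\langle\nabla_XY,\nu\rangle\nu$. For $g\in C^\infty(S)$ let $$\hat\Delta^{\mathcal H,S}g=\sum_{i=1}^{2n}\nabla_i\nabla_i g+2\alpha\,J(\nu)g,$$ where $\nabla_i$ is the derivative along $\pi(Z_i)$. Consider the conditions on $S$ $$(\mathrm P1)\ \ \nabla_{J(\nu)}\nu=\ell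 J(\nu),\qquad(\mathrm P2)\ \ \nabla^{\mathcal H,S}\alpha=(J(\nu)\alpha)\,J(\nu),\qquad(\mathrm P3)\ \ J(\nu)\alpha+\alpha^2\ge0 .$$ **Theorem.** Let $S\subset\mathbb H^2$ be a smooth, immersed, non-characteristic, minimal hypersurface without boundary. 1. $\langle\tilde h,\tilde h_J\rangle=2|\nabla_{J(\nu)}\nu|^2-|\tilde h|^2$ on $S$. 2. If (P2) holds, then on $S$ $$\begin{aligned}\tfrac12\hat\Delta^{\mathcal H,S}|\tilde h|^2={}&|\nabla^{\mathcal H,S}\tilde h|^2-q|\tilde h|^2+4\alpha^2|\tilde h|^2-8\alpha^2|\nabla_{J(\nu)}\nu|^2+2\alpha^2\ell^2\\&+4\left(J(\nu)\alpha+\alpha^2\right)\left(2|\tilde h|^2-4|\nabla_{J(\nu)}\nu|^2+\ell^2\right)\\&+\left(8J(\nu)\alpha+6\alpha^2\right)\left(|\nabla_{J(\nu)}\nu|^2-\ell^2\right).\end{aligned}$$ 3. If (P1), (P2) and (P3) hold, then on $S$ $$\tfrac12\hat\Delta^{\mathcal H,S}|\tilde h|^2\ \ge\ |\nabla^{\mathcal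 H,S}\tilde h|^2-q|\tilde h|^2+\alpha^2\left(4|\tilde h|^2-6\ell^2\right).$$ 4. The inequality in 3 is sharp: for every $E>0$ the catenoidal hypersurface $$S_E=\Big\{(z,t)\in\mathbb H^2:\ |z|\ge E^{1/3},\ |t|=\int_{E^{1/3}}^{|z|}\frac{E\tau}{\sqrt{\tau^{6}-E^2}}\,d\tau\Big\}$$ is a non-empty smooth embedded non-characteristic minimal hypersurface with a global smooth unit normal, it satisfies (P1), (P2) and (P3), and equality holds in 3 at every point of $S_E$. -/

import Mathlib

open scoped Manifold ContDiff

namespace HeisSimons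

noncomputable section

/-- Coefficient vectors `(a₁,…,aₙ,b₁,…,bₙ)` of horizontal vectors `∑ aⱼ Xⱼ + bⱼ Yⱼ`, with the
Euclidean inner product (the `Xⱼ, Yⱼ` are orthonormal). `Sum.inl j` is the index of `Xⱼ` (and of
the coordinate `xⱼ`), `Sum.inr j` the index of `Yⱼ` (and of `yⱼ`). -/
abbrev Hor (n : ℕ) : Type := EuclideanSpace ℝ (Fin n ⊕ Fin n)

/-- The Heisenberg group `ℍⁿ` as the smooth manifold `ℝ²ⁿ⁺¹`, with points `(z, t)`,
`z = (x₁,…,xₙ,y₁,…,yₙ)`. -/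
abbrev Heis (n : ℕ) : Type := Hor n × ℝ

/-- The vector `∑ aⱼ Xⱼ + bⱼ Yⱼ + c T` at the point `p = (x, y, t)`, for coefficients
`V = ((a, b), c)`, where `Xⱼ = ∂/∂xⱼ + yⱼ ∂/∂t`, `Yⱼ = ∂/∂yⱼ - xⱼ ∂/∂t`, `T = ∂/∂t`.
All vector fields below are given by their coefficients in this left-invariant frame, which is
orthonormal for the metric and parallel for the pseudohermitian connection `∇`. -/
def ofFrame {n : ℕ} (p : Heis n) : (Hor n × ℝ) →ₗ[ℝ] Heis n where
  toFun V := (V.1, V.2 + ∑ j : Fin n, (V.1 (Sum.inl j) * p.1 (Sum.inr j)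
    - V.1 (Sum.inr j) * p.1 (Sum.inl j)))
  map_add' V W := by
    refine Prod.ext rfl ?_
    simp only [Prod.fst_add, Prod.snd_add, PiLp.add_apply]
    have h : ∀ j : Fin n, (V.1 (Sum.inl j) + W.1 (Sum.inl j)) * p.1 (Sum.inr j)
        - (V.1 (Sum.inr j) + W.1 (Sum.inr j)) * p.1 (Sum.inl j)
        = (V.1 (Sum.inl j) * p.1 (Sum.inr j) - V.1 (Sum.inr j) * p.1 (Sum.inl j))
        + (W.1 (Sum.inl j) * p.1 (Sum.inr j) - W.1 (Sum.inr j) * p.1 (Sum.inl j)) :=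
      fun j => by ring
    simp only [h, Finset.sum_add_distrib]
    ring
  map_smul' c V := by
    refine Prod.ext rfl ?_
    simp only [Prod.smul_fst, Prod.smul_snd, PiLp.smul_apply, smul_eq_mul, RingHom.id_apply,
      mul_add, Finset.mul_sum]
    congr 1
    exact Finset.sum_congr rfl fun j _ => by ring

/-- The Riemannian metric making `X₁,…,Xₙ,Y₁,…,Yₙ,T` orthonormal, in frame coefficients. -/
def metric {n : ℕ} (V W : Hor n × ℝ) : ℝ := inner ℝ V.1 W.1 + V.2 * W.2

/-- The horizontal vector at `p` with coefficients `w`. -/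
def horVec {n : ℕ} (p : Heis n) : Hor n →ₗ[ℝ] Heis n :=
  (ofFrame p).comp (LinearMap.inl ℝ (Hor n) ℝ)

/-- The horizontal distribution at `p`. -/
def horizontal {n : ℕ} (p : Heis n) : Submodule ℝ (Heis n) := LinearMap.range (horVec p)

/-- The complex structure on horizontal vectors: `J Xⱼ = Yⱼ`, `J Yⱼ = -Xⱼ`. -/
def J {n : ℕ} (w : Hor n) : Hor n :=
  WithLp.toLp 2 (Sum.elim (fun j => -w (Sum.inr j)) (fun j => w (Sum.inl j)))

section Hypersurface

variable {n : ℕ} {M : Type*} [TopologicalSpace M] [ChartedSpace (EuclideanSpace ℝ (Fin (2 * n))) M]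
variable {F : Type*} [NormedAddCommGroup F] [NormedSpace ℝ F]

variable (n) in
/-- The differential at `p` of a map from the `2n`-dimensional manifold to a normed space. -/
def diff (g : M → F) (p : M) : EuclideanSpace ℝ (Fin (2 * n)) →L[ℝ] F :=
  mfderiv (𝓡 (2 * n)) 𝓘(ℝ, F) g p

/-- Smooth immersions (of a `2n`-dimensional manifold) into `ℍⁿ`. -/
def IsImmersion (f : M → Heis n) : Prop :=
  ContMDiff (𝓡 (2 * n)) 𝓘(ℝ, Heis n) ∞ f ∧ ∀ p, Function.Injective (diff n f p)

/-- The tangent space `T_p S` of the immersed submanifold, as a subspace of `T_{f p} ℍⁿ`. -/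
def tangent (f : M → Heis n) (p : M) : Submodule ℝ (Heis n) :=
  LinearMap.range (diff n f p).toLinearMap

/-- `p` is characteristic if the tangent space is the horizontal distribution. -/
def IsCharacteristicAt (f : M → Heis n) (p : M) : Prop := tangent f p = horizontal (f p)

/-- The horizontal tangent space (horizontal vectors that are tangent), in frame coefficients. -/
def horTangent (f : M → Heis n) (p : M) : Submodule ℝ (Hor n) := (tangent f p).comap (horVec (f p))

/-- An orthonormal basis of the horizontal tangent space at `p`; it is only used in expressions
that do not depend on the choice. -/
def onb (f : M → Heis n) (p : M) (i : Fin (Module.finrank ℝ (horTangent f p))) : Hor n :=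
  (stdOrthonormalBasis ℝ (horTangent f p) i : Hor n)

/-- The tangent vector of the manifold at `p` which `df` maps to the horizontal vector `w`
(it exists, and is unique for an immersion, when `w` is in the horizontal tangent space). -/
def lift (f : M → Heis n) (p : M) (w : Hor n) : EuclideanSpace ℝ (Fin (2 * n)) :=
  Function.invFun (diff n f p) (horVec (f p) w)

/-- Derivative of `g` at `p` in the horizontal tangent direction `w`. For scalar `g` this is `w g`.
For `g : M → Hor n`, the coefficients of a horizontal field along the hypersurface, it is the
pseudohermitian covariant derivative `∇_w g`, as the frame is `∇`-parallel. -/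
def D (f : M → Heis n) (g : M → F) (p : M) (w : Hor n) : F := diff n g p (lift f p w)

/-- The horizontal tangential gradient `∇^{H,S} g`. -/
def grad (f : M → Heis n) (g : M → ℝ) (p : M) : Hor n :=
  ∑ i, D f g p (onb f p i) • onb f p i

/-- `N` (in frame coefficients) is a smooth Riemannian unit normal field on `U`. -/
structure IsUnitNormalOn (f : M → Heis n) (N : M → Hor n × ℝ) (U : Set M) : Prop where
  smooth : ContMDiffOn (𝓡 (2 * n)) 𝓘(ℝ, Hor n × ℝ) ∞ N U
  unit : ∀ p ∈ U, metric (N p) (N p) = 1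
  normal : ∀ p ∈ U, ∀ V : Hor n × ℝ, ofFrame (f p) V ∈ tangent f p → metric (N p) V = 0

/-- The horizontal unit normal `ν = N^H / |N^H|`. -/
def nu (N : M → Hor n × ℝ) (p : M) : Hor n := ‖(N p).1‖⁻¹ • (N p).1

/-- The fundamental function `α = ⟨N, T⟩ / |N^H|`. -/
def alpha (N : M → Hor n × ℝ) (p : M) : ℝ := (N p).2 / ‖(N p).1‖

/-- The tangent field `J ν`. -/
def Jnu (N : M → Hor n × ℝ) (p : M) : Hor n := J (nu N p)

/-- The projection `π(w) = w - ⟨w, ν⟩ ν`. -/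
def proj (N : M → Hor n × ℝ) (p : M) (w : Hor n) : Hor n := w - inner ℝ w (nu N p) • nu N p

/-- The map `J'`, equal to `J` on the orthogonal complement `H'TS` of `J ν` in the horizontal
tangent space and to `0` on `J ν`. -/
def J' (N : M → Hor n × ℝ) (p : M) (w : Hor n) : Hor n :=
  J (w - inner ℝ w (Jnu N p) • Jnu N p)

/-- The horizontal second fundamental form `h(X, Y) = ⟨∇_X ν, Y⟩`. -/
def h (f : M → Heis n) (N : M → Hor n × ℝ) (p : M) (X Y : Hor n) : ℝ :=
  inner ℝ (D f (nu N) p X) Y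

/-- The symmetric horizontal second fundamental form `h̃(X, Y) = ⟨∇_X ν + α J'(X), Y⟩`. -/
def hs (f : M → Heis n) (N : M → Hor n × ℝ) (p : M) (X Y : Hor n) : ℝ :=
  inner ℝ (D f (nu N) p X + alpha N p • J' N p X) Y

/-- `h̃_J(X, Y) = h̃(π(J X), π(J Y))`. -/
def hsJ (f : M → Heis n) (N : M → Hor n × ℝ) (p : M) (X Y : Hor n) : ℝ :=
  hs f N p (proj N p (J X)) (proj N p (J Y))

/-- Scalar product of two horizontal `(2,0)`-tensors at `p`. -/
def inner2 (f : M → Heis n) (p : M) (A B : Hor n → Hor n → ℝ) : ℝ :=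
  ∑ i, ∑ j, A (onb f p i) (onb f p j) * B (onb f p i) (onb f p j)

/-- The function `|h̃|²`. -/
def normSqHs (f : M → Heis n) (N : M → Hor n × ℝ) (p : M) : ℝ :=
  inner2 f p (hs f N p) (hs f N p)

/-- The horizontal mean curvature `H = trace h`. -/
def meanCurvature (f : M → Heis n) (N : M → Hor n × ℝ) (p : M) : ℝ :=
  ∑ i, h f N p (onb f p i) (onb f p i)

/-- `ℓ = h(J ν, J ν)`. -/
def ell (f : M → Heis n) (N : M → Hor n × ℝ) (p : M) : ℝ := h f N p (Jnu N p) (Jnu N p)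

/-- The vector `∇_{J ν} ν`. -/
def nablaJnuNu (f : M → Heis n) (N : M → Hor n × ℝ) (p : M) : Hor n := D f (nu N) p (Jnu N p)

/-- The function `J(ν) α = ⟨∇ α, J ν⟩`. -/
def JnuAlpha (f : M → Heis n) (N : M → Hor n × ℝ) (p : M) : ℝ := D f (alpha N) p (Jnu N p)

/-- The stability function `q = |h̃|² + 4 ⟨∇ α, J ν⟩ + 2 (n + 1) α²`. -/
def q (f : M → Heis n) (N : M → Hor n × ℝ) (p : M) : ℝ :=
  normSqHs f N p + 4 * JnuAlpha f N p + 2 * ((n : ℝ) + 1) * alpha N p ^ 2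

/-- The tangent connection `∇^S_w V = ∇_w V - ⟨∇_w V, ν⟩ ν`. -/
def nablaS (f : M → Heis n) (N : M → Hor n × ℝ) (V : M → Hor n) (p : M) (w : Hor n) : Hor n :=
  proj N p (D f V p w)

/-- `(∇^S_w A)(V, W) = w (A(V, W)) - A(∇^S_w V, W) - A(V, ∇^S_w W)` for horizontal tangent
fields `V`, `W` and a horizontal `(2,0)`-tensor field `A`. -/
def covDeriv (f : M → Heis n) (N : M → Hor n × ℝ) (A : M → Hor n → Hor n → ℝ) (p : M) (w : Hor n)
    (V W : M → Hor n) : ℝ :=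
  D f (fun x => A x (V x) (W x)) p w - A p (nablaS f N V p w) (W p)
    - A p (V p) (nablaS f N W p w)

/-- The tensor `∇^{H,S} A` on horizontal tangent vectors `X, Y, Z` at `p`; the vectors `Y` and `Z`
are extended to horizontal tangent fields by projecting constant coefficient vectors. -/
def nablaTensor (f : M → Heis n) (N : M → Hor n × ℝ) (A : M → Hor n → Hor n → ℝ) (p : M)
    (X Y Z : Hor n) : ℝ :=
  covDeriv f N A p X (fun x => proj N x Y) (fun x => proj N x Z)

/-- The function `|∇^{H,S} h̃|²`. -/
def normSqNablaHs (f : M → Heis n) (N : M → Hor n × ℝ) (p : M) : ℝ :=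
  ∑ i, ∑ j, ∑ k, nablaTensor f N (hs f N) p (onb f p i) (onb f p j) (onb f p k) ^ 2

/-- The horizontal tangential derivatives `∇^{H,S}_i g = Z_i g - ⟨∇^H g, ν⟩ ν_i`, that is, the
derivative of `g` along `π(Z_i)`, for `i = 1, …, 2n`. -/
def Di (f : M → Heis n) (N : M → Hor n × ℝ) (i : Fin n ⊕ Fin n) (g : M → ℝ) (p : M) : ℝ :=
  D f g p (proj N p (EuclideanSpace.single i 1))

/-- The modified horizontal tangential Laplacian
`∑ᵢ ∇^{H,S}_i ∇^{H,S}_i g + 2 α ⟨∇^H g, J ν⟩`. -/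
def modLaplacian (f : M → Heis n) (N : M → Hor n × ℝ) (g : M → ℝ) (p : M) : ℝ :=
  ∑ i, Di f N i (Di f N i g) p + 2 * alpha N p * D f g p (Jnu N p)

/-- Minimality: the horizontal mean curvature vanishes. -/
def IsMinimalOn (f : M → Heis n) (N : M → Hor n × ℝ) (U : Set M) : Prop :=
  ∀ p ∈ U, meanCurvature f N p = 0

/-- Property (P1): `∇_{J ν} ν - ℓ J ν = 0`. -/
def P1 (f : M → Heis n) (N : M → Hor n × ℝ) (U : Set M) : Prop :=
  ∀ p ∈ U, nablaJnuNu f N p - ell f N p • Jnu N p = 0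

/-- Property (P2): `∇^{H,S} α = ⟨∇ α, J ν⟩ J ν`. -/
def P2 (f : M → Heis n) (N : M → Hor n × ℝ) (U : Set M) : Prop :=
  ∀ p ∈ U, grad f (alpha N) p = JnuAlpha f N p • Jnu N p

/-- Property (P3): `J(ν) α + α² ≥ 0`. -/
def P3 (f : M → Heis n) (N : M → Hor n × ℝ) (U : Set M) : Prop :=
  ∀ p ∈ U, 0 ≤ JnuAlpha f N p + alpha N p ^ 2

/-- The lower bound `|∇^{H,S} h̃|² - q |h̃|² + α² (4 |h̃|² - 6 ℓ²)`. -/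
def lowerBound (f : M → Heis n) (N : M → Hor n × ℝ) (p : M) : ℝ :=
  normSqNablaHs f N p - q f N p * normSqHs f N p
    + alpha N p ^ 2 * (4 * normSqHs f N p - 6 * ell f N p ^ 2)

end Hypersurface

/-- The profile `t_E(s) = ∫ E τ / √(τ^(4n-2) - E²) dτ` over `[E^(1/(2n-1)), s]`. -/
def catenoidProfile (n : ℕ) (E s : ℝ) : ℝ :=
  ∫ τ in (E ^ (1 / (2 * (n : ℝ) - 1)))..s, E * τ / Real.sqrt (τ ^ (4 * n - 2) - E ^ 2)

/-- The catenoidal hypersurface `S_E`: the hypersurface of revolution around the vertical axis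
whose profile is the vertical symmetrization of the curve `(s, t_E(s))`, `s ≥ E^(1/(2n-1))`. -/
def catenoid (n : ℕ) (E : ℝ) : Set (Heis n) :=
  {p | E ^ (1 / (2 * (n : ℝ) - 1)) ≤ ‖p.1‖ ∧ |p.2| = catenoidProfile n E ‖p.1‖}

end

end HeisSimons

open HeisSimons

/-! In `ℍ²` the horizontal space is `ℝ⁴`, so `J` belongs to a triple of anticommuting complex
structures `quat 0`, `quat 1`, `quat 2`, all constant in the parallel frame. Applied to `ν` they
give an orthonormal frame `e₀ = Jν, e₁, e₂` of the horizontal tangent bundle wherever `ν` is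
defined, and `S = T - αν` completes it to a frame of the tangent bundle. Because the triple is
parallel, the connection coefficients of this frame are, up to sign, the entries of `h`.

The geometry is then contained in three facts. Tangency of `[eᵢ, eⱼ]` says that `h̃` is symmetric
(`b_symm`). Tangency of `[S, eᵢ]` expresses `∇_S ν` through the derivatives of `α` (`s_eq`).
Applying the brackets to the components of `ν`, with `∇` flat, gives Codazzi equations (`codazzi`,
`codazzi_S`). The structure `AdaptedFrame` records exactly these data for derivations of a
commutative ring, and `adaptedFrame` produces them from a hypersurface, with smooth functions on `U`
as the ring; the input from analysis is `Dv_commutator`.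

The formula for the Laplacian is Simons' argument in this ring. By the product rule, half the
Laplacian of `|h̃|²` is `⟨h̃, Δh̃⟩` plus squares of first derivatives. Codazzi and `H = 0` rewrite
the second derivatives in `Δh̃` so that they cancel after commuting derivatives
(`laplacian_components`); what remains is polynomial in `h̃`, `α`, `J(ν)α` and seven free first
derivatives, and `laplacian_normSq` compares polynomials. The first statement of the theorem is
pointwise linear algebra.

Under (P1) the formula is the lower bound plus `4(J(ν)α + α²)(2|h̃|² - 3ℓ²)`. The first bracket is
nonnegative by (P3), the second because `h̃` has trace zero and first diagonal entry `ℓ`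
(`three_mul_ell_sq_le`). The second bracket vanishes when `h̃` is a multiple of `diag(-2, 1, 1)`,
and this is the case on the catenoidal hypersurface: the substitution `|z|³ = E cosh u` makes it a
smooth surface with parameter `u` and all its curvature quantities explicit. -/

open scoped Manifold ContDiff

set_option linter.unusedSectionVars false

namespace HeisSimons

section

/-! ### The complex structure and the frame -/

section Frame

variable {n : ℕ}

/-- The complex structure as a continuous linear map. -/
noncomputable def JL (n : ℕ) : Hor n →L[ℝ] Hor n :=
  LinearMap.toContinuousLinearMap
    { toFun := J
      map_add' := fun v w => by
        ext i; rcases i with i | i <;> (simp [J]; try ring)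
      map_smul' := fun c v => by
        ext i; rcases i with i | i <;> simp [J] }

@[simp] theorem JL_apply (w : Hor n) : JL n w = J w := rfl

theorem inner_sum_eq (v w : Hor n) : inner ℝ v w
    = ∑ j : Fin n, (v (Sum.inl j) * w (Sum.inl j) + v (Sum.inr j) * w (Sum.inr j)) := by
  simp only [PiLp.inner_apply, Fintype.sum_sum_type, Finset.sum_add_distrib]
  simp [mul_comm]

theorem inner_J_left (v w : Hor n) : inner ℝ (J v) w = -inner ℝ v (J w) := by
  simp only [inner_sum_eq, J, Sum.elim_inl, Sum.elim_inr, ← Finset.sum_neg_distrib]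
  exact Finset.sum_congr rfl fun j _ => by ring

theorem J_J (v : Hor n) : J (J v) = -v := by
  ext i; rcases i with i | i <;> simp [J]

theorem inner_J_J (v w : Hor n) : inner ℝ (J v) (J w) = inner ℝ v w := by
  rw [inner_J_left, J_J, inner_neg_right, neg_neg]

theorem inner_J_self (v : Hor n) : inner ℝ (J v) v = 0 := by
  have h1 := inner_J_left v v
  rw [real_inner_comm (J v) v] at h1
  linarith

theorem ofFrame_eq (p : Heis n) (V : Hor n × ℝ) :
    ofFrame p V = (V.1, V.2 + inner ℝ (J V.1) p.1) := by
  simp only [ofFrame, LinearMap.coe_mk, AddHom.coe_mk, inner_sum_eq, J, Sum.elim_inl, Sum.elim_inr]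
  refine Prod.ext rfl ?_
  simp only [add_right_inj]
  exact Finset.sum_congr rfl fun j _ => by ring

theorem contDiff_ofFrame : ContDiff ℝ ∞ fun q : Heis n × (Hor n × ℝ) => ofFrame q.1 q.2 := by
  simp only [ofFrame_eq, ← JL_apply]
  refine ContDiff.prodMk (by fun_prop) (ContDiff.add (by fun_prop) (ContDiff.inner ℝ ?_ ?_)) <;>
    fun_prop

theorem ofFrame_injective (p : Heis n) : Function.Injective (ofFrame p) := by
  intro V W h
  simp only [ofFrame_eq, Prod.mk.injEq] at h
  obtain ⟨h1, h2⟩ := h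
  rw [h1] at h2
  exact Prod.ext h1 (by linarith)

theorem ofFrame_surjective (p : Heis n) : Function.Surjective (ofFrame p) := fun q =>
  ⟨(q.1, q.2 - inner ℝ (J q.1) p.1), by simp [ofFrame_eq]⟩

end Frame

/-! ### Calculus in a chart -/

section Model

variable {n : ℕ} {E : Type*} [NormedAddCommGroup E] [NormedSpace ℝ E]
variable {F : Type*} [NormedAddCommGroup F] [NormedSpace ℝ F]

/-- The normal completes `fderiv ℝ f x` to an isomorphism `E × ℝ → Heis n`. Preimages of tangent
fields are read off from its inverse, and inversion of operators is smooth; choosing preimages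
pointwise would give no regularity. -/
theorem exists_contDiffOn_lift [CompleteSpace E] {Ω : Set E} (hΩ : IsOpen Ω) {f : E → Heis n}
    (hf : ContDiffOn ℝ ∞ f Ω) {N V : E → Hor n × ℝ} (hN : ContDiffOn ℝ ∞ N Ω)
    (hV : ContDiffOn ℝ ∞ V Ω)
    (hbij : ∀ x ∈ Ω, Function.Bijective
      fun q : E × ℝ => fderiv ℝ f x q.1 + q.2 • ofFrame (f x) (N x))
    (hVt : ∀ x ∈ Ω, ∃ v, fderiv ℝ f x v = ofFrame (f x) (V x)) :
    ∃ v : E → E, ContDiffOn ℝ ∞ v Ω ∧ ∀ x ∈ Ω, fderiv ℝ f x (v x) = ofFrame (f x) (V x) := by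
  let L : E → (E × ℝ →L[ℝ] Heis n) := fun x =>
    (fderiv ℝ f x).comp (ContinuousLinearMap.fst ℝ E ℝ)
      + (ContinuousLinearMap.snd ℝ E ℝ).smulRight (ofFrame (f x) (N x))
  have hL : ContDiffOn ℝ ∞ L Ω := by
    have h1 : ContDiffOn ℝ ∞ (fun x => fderiv ℝ f x) Ω := hf.fderiv_of_isOpen hΩ (by simp)
    have h2 : ContDiffOn ℝ ∞ (fun x => ofFrame (f x) (N x)) Ω :=
      contDiff_ofFrame.comp_contDiffOn (hf.prodMk hN)
    refine ContDiffOn.add (h1.clm_comp contDiffOn_const) ?_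
    exact (((ContinuousLinearMap.smulRightL ℝ (E × ℝ) (Heis n))
      (ContinuousLinearMap.snd ℝ E ℝ)).contDiff).comp_contDiffOn h2
  let e : ∀ x ∈ Ω, (E × ℝ) ≃L[ℝ] Heis n := fun x hx =>
    ContinuousLinearEquiv.ofBijective (L x)
      (LinearMap.ker_eq_bot.2 (hbij x hx).1) (LinearMap.range_eq_top.2 (hbij x hx).2)
  have he : ∀ x (hx : x ∈ Ω), L x = (e x hx : E × ℝ →L[ℝ] Heis n) := fun x hx => by
    ext q <;> rfl
  refine ⟨fun x => ((L x).inverse (ofFrame (f x) (V x))).1, ?_, ?_⟩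
  · refine contDiff_fst.comp_contDiffOn (ContDiffOn.clm_apply (fun x hx => ?_)
      (contDiff_ofFrame.comp_contDiffOn (hf.prodMk hV)))
    have h := contDiffAt_map_inverse (n := ∞) (e x hx)
    rw [← he x hx] at h
    exact h.comp_contDiffWithinAt x (hL x hx)
  · intro x hx
    -- The field is tangent, so it has a preimage with zero normal component, and by injectivity the
    -- inverse returns this one.
    obtain ⟨v, hv⟩ := hVt x hx
    have h1 : L x (v, 0) = ofFrame (f x) (V x) := by simp [L, hv]
    have h2 : (L x).inverse (ofFrame (f x) (V x)) = (v, 0) := by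
      rw [← h1, he x hx, ContinuousLinearMap.inverse_equiv]
      simp
    simp only [h2, hv]

/-- The second derivative of `g` is symmetric and drops out; the derivative along the Lie bracket of
`v` and `w` is left. -/
theorem fderiv_fderiv_apply_sub {g : E → F} {v w : E → E} {x : E} (hg : ContDiffAt ℝ ∞ g x)
    (hv : DifferentiableAt ℝ v x) (hw : DifferentiableAt ℝ w x) :
    fderiv ℝ (fun y => fderiv ℝ g y (w y)) x (v x) - fderiv ℝ (fun y => fderiv ℝ g y (v y)) x (w x)
      = fderiv ℝ g x (fderiv ℝ w x (v x) - fderiv ℝ v x (w x)) := by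
  have hd : DifferentiableAt ℝ (fderiv ℝ g) x :=
    (hg.fderiv_right (m := 1) (by norm_cast)).differentiableAt one_ne_zero
  have hs := hg.isSymmSndFDerivAt (by simp; norm_cast)
  rw [fderiv_clm_apply hd hw, fderiv_clm_apply hd hv]
  simp only [add_apply, ContinuousLinearMap.comp_apply,
    ContinuousLinearMap.flip_apply, map_sub]
  rw [hs.eq (v x) (w x)]
  abel

/-- The fields `Xⱼ`, `Yⱼ` are not constant in coordinates: the vertical correction comes from
differentiating their `∂/∂t` coefficients. -/
theorem fderiv_ofFrame {f : E → Heis n} {V : E → Hor n × ℝ} {x : E} (hf : DifferentiableAt ℝ f x)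
    (hV : DifferentiableAt ℝ V x) (v : E) :
    fderiv ℝ (fun y => ofFrame (f y) (V y)) x v
      = ofFrame (f x) (fderiv ℝ V x v) + (0, inner ℝ (J (V x).1) (fderiv ℝ f x v).1) := by
  have e1 : (fun y => ofFrame (f y) (V y))
      = fun y => ((V y).1, (V y).2 + inner ℝ (JL n (V y).1) (f y).1) := by
    funext y; simp [ofFrame_eq]
  have h1 :
      HasFDerivAt (fun y => (V y).1) ((ContinuousLinearMap.fst ℝ _ _).comp (fderiv ℝ V x)) x :=
    hV.hasFDerivAt.fst
  have h2 :
      HasFDerivAt (fun y => (V y).2) ((ContinuousLinearMap.snd ℝ _ _).comp (fderiv ℝ V x)) x :=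
    hV.hasFDerivAt.snd
  have h3 :
      HasFDerivAt (fun y => (f y).1) ((ContinuousLinearMap.fst ℝ _ _).comp (fderiv ℝ f x)) x :=
    hf.hasFDerivAt.fst
  have h4 := (h1.prodMk (h2.add (((JL n).hasFDerivAt.comp x h1).inner ℝ h3)))
  have h5 := h4.fderiv
  rw [e1]
  erw [h5]
  simp only [ofFrame_eq]
  refine Prod.ext ?_ ?_
  · simp
  · simp
    ring

/-- Commuting derivatives of `f` itself pushes the bracket forward. The two vertical corrections are
opposite under exchange of `V` and `W`, so they add up to the torsion `2⟨JV, W⟩T` of the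
pseudohermitian connection. -/
theorem fderiv_lieBracket_eq_ofFrame {f : E → Heis n} {V W : E → Hor n × ℝ} {v w : E → E} {x : E}
    (hf : ContDiffAt ℝ ∞ f x) (hv : DifferentiableAt ℝ v x) (hw : DifferentiableAt ℝ w x)
    (hV : DifferentiableAt ℝ V x) (hW : DifferentiableAt ℝ W x)
    (hfv : ∀ᶠ y in nhds x, fderiv ℝ f y (v y) = ofFrame (f y) (V y))
    (hfw : ∀ᶠ y in nhds x, fderiv ℝ f y (w y) = ofFrame (f y) (W y)) :
    fderiv ℝ f x (fderiv ℝ w x (v x) - fderiv ℝ v x (w x))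
      = ofFrame (f x) (fderiv ℝ W x (v x) - fderiv ℝ V x (w x)
        - (0, 2 * inner ℝ (J (V x).1) (W x).1)) := by
  have hfd : DifferentiableAt ℝ f x := hf.differentiableAt (by simp)
  rw [← fderiv_fderiv_apply_sub hf hv hw, Filter.EventuallyEq.fderiv_eq hfv,
    Filter.EventuallyEq.fderiv_eq hfw, fderiv_ofFrame hfd hV, fderiv_ofFrame hfd hW,
    hfv.self_of_nhds, hfw.self_of_nhds, map_sub, map_sub]
  have e1 : (ofFrame (f x) (V x)).1 = (V x).1 := rfl
  have e2 : (ofFrame (f x) (W x)).1 = (W x).1 := rfl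
  have e3 : ofFrame (f x) (0, 2 * inner ℝ (J (V x).1) (W x).1)
      = (0, 2 * inner ℝ (J (V x).1) (W x).1) := by
    have : J (0 : Hor n) = 0 := (JL n).map_zero
    simp [ofFrame_eq, this]
  rw [e1, e2, e3, inner_J_left (W x).1 (V x).1, real_inner_comm (W x).1]
  refine Prod.ext ?_ ?_ <;> simp
  rw [real_inner_comm]
  ring

end Model

end

section

/-! ### Derivatives along tangent vectors given by frame coefficients, and their smoothness in
charts -/

section Derivative

variable {n : ℕ} {M : Type*} [TopologicalSpace M] [ChartedSpace (EuclideanSpace ℝ (Fin (2 * n))) M]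
variable {F : Type*} [NormedAddCommGroup F] [NormedSpace ℝ F]

/-- The derivative of `g` at `p` in the tangent direction with frame coefficients `V`. -/
noncomputable def Dv (f : M → Heis n) (g : M → F) (p : M) (V : Hor n × ℝ) : F :=
  diff n g p (Function.invFun (diff n f p) (ofFrame (f p) V))

theorem D_eq_Dv (f : M → Heis n) (g : M → F) (p : M) (w : Hor n) : D f g p w = Dv f g p (w, 0) :=
  rfl

/-- The tangent space in frame coefficients. -/
noncomputable def frameTangent (f : M → Heis n) (p : M) : Submodule ℝ (Hor n × ℝ) :=
  (tangent f p).comap (ofFrame (f p))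

theorem mem_frameTangent {f : M → Heis n} {p : M} {V : Hor n × ℝ} :
    V ∈ frameTangent f p ↔ ∃ v, diff n f p v = ofFrame (f p) V := Iff.rfl

theorem mem_horTangent_iff {f : M → Heis n} {p : M} {w : Hor n} :
    w ∈ horTangent f p ↔ (w, (0 : ℝ)) ∈ frameTangent f p := Iff.rfl

/-- `Function.invFun` returns a true preimage only on the tangent space. For this reason the
linearity rules for `Dv` below assume membership in `frameTangent`. -/
theorem Dv_eq_of_diff_eq {f : M → Heis n} {p : M} (hf : Function.Injective (diff n f p))
    {V : Hor n × ℝ} {v} (h : diff n f p v = ofFrame (f p) V) (g : M → F) :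
    Dv f g p V = diff n g p v := by
  rw [Dv, ← h, Function.leftInverse_invFun hf v]

theorem Dv_self {f : M → Heis n} {p : M} {V : Hor n × ℝ} (h : V ∈ frameTangent f p) :
    Dv f f p V = ofFrame (f p) V := Function.invFun_eq (mem_frameTangent.1 h)

theorem Dv_add {f : M → Heis n} {p : M} (hf : Function.Injective (diff n f p)) (g : M → F)
    {V W : Hor n × ℝ} (hV : V ∈ frameTangent f p) (hW : W ∈ frameTangent f p) :
    Dv f g p (V + W) = Dv f g p V + Dv f g p W := by
  obtain ⟨v, hv⟩ := mem_frameTangent.1 hV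
  obtain ⟨w, hw⟩ := mem_frameTangent.1 hW
  rw [Dv_eq_of_diff_eq hf hv, Dv_eq_of_diff_eq hf hw,
    Dv_eq_of_diff_eq hf (v := v + w) (by rw [map_add, map_add, hv, hw]), map_add]

theorem Dv_smul {f : M → Heis n} {p : M} (hf : Function.Injective (diff n f p)) (g : M → F)
    (c : ℝ) {V : Hor n × ℝ} (hV : V ∈ frameTangent f p) :
    Dv f g p (c • V) = c • Dv f g p V := by
  obtain ⟨v, hv⟩ := mem_frameTangent.1 hV
  rw [Dv_eq_of_diff_eq hf hv,
    Dv_eq_of_diff_eq hf (v := c • v) (by rw [map_smul, map_smul, hv]), map_smul]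

theorem Dv_sum {ι : Type*} {f : M → Heis n} {p : M} (hf : Function.Injective (diff n f p))
    (g : M → F) (s : Finset ι) (V : ι → Hor n × ℝ) (hV : ∀ i, V i ∈ frameTangent f p) :
    Dv f g p (∑ i ∈ s, V i) = ∑ i ∈ s, Dv f g p (V i) := by
  classical
  induction s using Finset.induction_on with
  | empty =>
    have h := Dv_smul hf g 0 (zero_mem (frameTangent f p))
    simpa using h
  | insert a s ha ih =>
    rw [Finset.sum_insert ha, Finset.sum_insert ha,
      Dv_add hf g (hV a) (Submodule.sum_mem _ fun i _ => hV i), ih]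

theorem Dv_congr (f : M → Heis n) {g g' : M → F} {p : M} (h : g =ᶠ[nhds p] g') (V : Hor n × ℝ) :
    Dv f g p V = Dv f g' p V := by
  unfold Dv diff
  rw [h.mfderiv_eq]

theorem Dv_comp {G : Type*} [NormedAddCommGroup G] [NormedSpace ℝ G] (f : M → Heis n) {g : M → F}
    {φ : F → G} {p : M} (hφ : DifferentiableAt ℝ φ (g p))
    (hg : MDifferentiableAt (𝓡 (2 * n)) 𝓘(ℝ, F) g p) (V : Hor n × ℝ) :
    Dv f (fun x => φ (g x)) p V = fderiv ℝ φ (g p) (Dv f g p V) := by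
  unfold Dv diff
  have h := mfderiv_comp p hφ.mdifferentiableAt hg
  rw [mfderiv_eq_fderiv] at h
  exact DFunLike.congr_fun h _

theorem Dv_clm {G : Type*} [NormedAddCommGroup G] [NormedSpace ℝ G] (f : M → Heis n) {g : M → F}
    (φ : F →L[ℝ] G) {p : M} (hg : MDifferentiableAt (𝓡 (2 * n)) 𝓘(ℝ, F) g p) (V : Hor n × ℝ) :
    Dv f (fun x => φ (g x)) p V = φ (Dv f g p V) := by
  rw [Dv_comp f φ.differentiableAt hg, φ.fderiv]

theorem Dv_prodMk {G : Type*} [NormedAddCommGroup G] [NormedSpace ℝ G] (f : M → Heis n)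
    {g : M → F} {g' : M → G} {p : M} (hg : MDifferentiableAt (𝓡 (2 * n)) 𝓘(ℝ, F) g p)
    (hg' : MDifferentiableAt (𝓡 (2 * n)) 𝓘(ℝ, G) g' p) (V : Hor n × ℝ) :
    Dv f (fun x => (g x, g' x)) p V = (Dv f g p V, Dv f g' p V) := by
  have h : MDifferentiableAt (𝓡 (2 * n)) 𝓘(ℝ, F × G) (fun x => (g x, g' x)) p :=
    hg.prodMk_space hg'
  refine Prod.ext ?_ ?_
  · exact (Dv_clm f (ContinuousLinearMap.fst ℝ F G) h V).symm
  · exact (Dv_clm f (ContinuousLinearMap.snd ℝ F G) h V).symm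

theorem Dv_const (f : M → Heis n) (c : F) (p : M) (V : Hor n × ℝ) :
    Dv f (fun _ => c) p V = 0 := by
  unfold Dv diff
  rw [mfderiv_const]
  rfl

theorem Dv_fun_add (f : M → Heis n) {g g' : M → F} {p : M}
    (hg : MDifferentiableAt (𝓡 (2 * n)) 𝓘(ℝ, F) g p)
    (hg' : MDifferentiableAt (𝓡 (2 * n)) 𝓘(ℝ, F) g' p) (V : Hor n × ℝ) :
    Dv f (fun x => g x + g' x) p V = Dv f g p V + Dv f g' p V := by
  have h := Dv_clm f (ContinuousLinearMap.fst ℝ F F + ContinuousLinearMap.snd ℝ F F)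
    (hg.prodMk_space hg') V
  rw [Dv_prodMk f hg hg'] at h
  exact h

theorem Dv_fun_smul (f : M → Heis n) {g : M → ℝ} {g' : M → F} {p : M}
    (hg : MDifferentiableAt (𝓡 (2 * n)) 𝓘(ℝ, ℝ) g p)
    (hg' : MDifferentiableAt (𝓡 (2 * n)) 𝓘(ℝ, F) g' p) (V : Hor n × ℝ) :
    Dv f (fun x => g x • g' x) p V = g p • Dv f g' p V + Dv f g p V • g' p := by
  have hd : HasFDerivAt (fun q : ℝ × F => q.1 • q.2) _ (g p, g' p) :=
    (hasFDerivAt_fst (𝕜 := ℝ)).smul hasFDerivAt_snd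
  have h := Dv_comp f hd.differentiableAt (hg.prodMk_space hg') V
  rw [Dv_prodMk f hg hg', hd.fderiv] at h
  simpa using h

end Derivative

section Chart

variable {n : ℕ} {M : Type*} [TopologicalSpace M] [ChartedSpace (EuclideanSpace ℝ (Fin (2 * n))) M]
variable {F : Type*} [NormedAddCommGroup F] [NormedSpace ℝ F]

/-- The part of the chart domain at `p₀` that corresponds to `U`. -/
def chartDomain (n : ℕ) {M : Type*} [TopologicalSpace M]
    [ChartedSpace (EuclideanSpace ℝ (Fin (2 * n))) M] (p₀ : M) (U : Set M) :
    Set (EuclideanSpace ℝ (Fin (2 * n))) :=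
  (extChartAt (𝓡 (2 * n)) p₀).target ∩ (extChartAt (𝓡 (2 * n)) p₀).symm ⁻¹' U

theorem isOpen_chartDomain {U : Set M} (hU : IsOpen U) (p₀ : M) : IsOpen (chartDomain n p₀ U) :=
  (continuousOn_extChartAt_symm p₀).isOpen_inter_preimage (isOpen_extChartAt_target p₀) hU

theorem mem_chartDomain {U : Set M} {p₀ : M} (h : p₀ ∈ U) :
    extChartAt (𝓡 (2 * n)) p₀ p₀ ∈ chartDomain n p₀ U :=
  ⟨mem_extChartAt_target p₀, by simpa using h⟩

variable [IsManifold (𝓡 (2 * n)) ∞ M]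

theorem contDiffOn_chartDomain {U : Set M} {g : M → F}
    (hg : ContMDiffOn (𝓡 (2 * n)) 𝓘(ℝ, F) ∞ g U) (p₀ : M) :
    ContDiffOn ℝ ∞ (g ∘ (extChartAt (𝓡 (2 * n)) p₀).symm) (chartDomain n p₀ U) := by
  rw [← contMDiffOn_iff_contDiffOn]
  exact hg.comp ((contMDiffOn_extChartAt_symm p₀).mono Set.inter_subset_left) fun x hx => hx.2

/-- The chart is centred at `p₀` but used at every `p` of its domain, so that derivatives at varying
points become maps on one vector space and can be differentiated again. -/
theorem diff_eq_fderiv {g : M → F} {p₀ p : M} (hp : p ∈ (extChartAt (𝓡 (2 * n)) p₀).source)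
    (hg : MDifferentiableAt (𝓡 (2 * n)) 𝓘(ℝ, F) g p) (v : EuclideanSpace ℝ (Fin (2 * n))) :
    diff n g p v = fderiv ℝ (g ∘ (extChartAt (𝓡 (2 * n)) p₀).symm)
      (extChartAt (𝓡 (2 * n)) p₀ p)
      (diff n (extChartAt (𝓡 (2 * n)) p₀) p v) := by
  set φ := extChartAt (𝓡 (2 * n)) p₀ with hφ
  have : IsManifold (𝓡 (2 * n)) 1 M := IsManifold.of_le (n := ∞) (by norm_cast)
  have hφd : MDifferentiableAt (𝓡 (2 * n)) 𝓘(ℝ, EuclideanSpace ℝ (Fin (2 * n))) φ p :=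
    mdifferentiableAt_extChartAt (by simpa [hφ] using hp)
  have hsd : MDifferentiableAt 𝓘(ℝ, EuclideanSpace ℝ (Fin (2 * n))) (𝓡 (2 * n)) φ.symm (φ p) :=
    (((contMDiffOn_extChartAt_symm (n := 1) p₀).contMDiffAt
      ((isOpen_extChartAt_target p₀).mem_nhds (φ.map_source hp))).mdifferentiableAt one_ne_zero)
  have hgs : MDifferentiableAt 𝓘(ℝ, EuclideanSpace ℝ (Fin (2 * n))) 𝓘(ℝ, F) (g ∘ φ.symm) (φ p) := by
    refine MDifferentiableAt.comp (φ p) ?_ hsd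
    rwa [φ.left_inv hp]
  have h1 : mfderiv (𝓡 (2 * n)) 𝓘(ℝ, F) g p
      = mfderiv (𝓡 (2 * n)) 𝓘(ℝ, F) ((g ∘ φ.symm) ∘ φ) p := by
    refine Filter.EventuallyEq.mfderiv_eq ?_
    filter_upwards [(isOpen_extChartAt_source (I := 𝓡 (2 * n)) p₀).mem_nhds hp] with y hy
    simp [φ.left_inv hy]
  have h2 := mfderiv_comp p hgs hφd
  rw [mfderiv_eq_fderiv] at h2
  unfold diff
  rw [h1, h2]
  rfl

theorem diff_extChartAt_surjective {p₀ p : M} (hp : p ∈ (extChartAt (𝓡 (2 * n)) p₀).source) :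
    Function.Surjective (diff n (extChartAt (𝓡 (2 * n)) p₀) p) := by
  have : IsManifold (𝓡 (2 * n)) 1 M := IsManifold.of_le (n := ∞) (by norm_cast)
  obtain ⟨e, he⟩ := isInvertible_mfderiv_extChartAt hp
  unfold diff
  rw [← he]
  exact e.surjective

/-- A single vector field `v` in the chart represents differentiation along `V` for all functions
and all target spaces. The bracket needs this, since the same lift acts on `f`, on the coefficient
fields and on test functions. -/
theorem exists_chart_lift {f : M → Heis n} {N : M → Hor n × ℝ} {U : Set M} (hf : IsImmersion f)
    (hU : IsOpen U) (hN : IsUnitNormalOn f N U) {V : M → Hor n × ℝ}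
    (hV : ContMDiffOn (𝓡 (2 * n)) 𝓘(ℝ, Hor n × ℝ) ∞ V U) (hVt : ∀ p ∈ U, V p ∈ frameTangent f p)
    (p₀ : M) :
    ∃ v : EuclideanSpace ℝ (Fin (2 * n)) → EuclideanSpace ℝ (Fin (2 * n)),
      ContDiffOn ℝ ∞ v (chartDomain n p₀ U) ∧
      (∀ x ∈ chartDomain n p₀ U, fderiv ℝ (f ∘ (extChartAt (𝓡 (2 * n)) p₀).symm) x (v x)
        = ofFrame (f ((extChartAt (𝓡 (2 * n)) p₀).symm x))
          (V ((extChartAt (𝓡 (2 * n)) p₀).symm x))) ∧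
      ∀ (F : Type) [NormedAddCommGroup F] [NormedSpace ℝ F] (g : M → F),
        MDifferentiableOn (𝓡 (2 * n)) 𝓘(ℝ, F) g U → ∀ x ∈ chartDomain n p₀ U,
        Dv f g ((extChartAt (𝓡 (2 * n)) p₀).symm x) (V ((extChartAt (𝓡 (2 * n)) p₀).symm x))
          = fderiv ℝ (g ∘ (extChartAt (𝓡 (2 * n)) p₀).symm) x (v x) := by
  set φ := extChartAt (𝓡 (2 * n)) p₀ with hφ
  have : IsManifold (𝓡 (2 * n)) 1 M := IsManifold.of_le (n := ∞) (by norm_cast)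
  have hsrc : ∀ x ∈ chartDomain n p₀ U, φ.symm x ∈ φ.source := fun x hx => φ.map_target hx.1
  have hdf : ∀ p, MDifferentiableAt (𝓡 (2 * n)) 𝓘(ℝ, Heis n) f p := fun p =>
    (hf.1 p).mdifferentiableAt (by simp)
  have hkey : ∀ x ∈ chartDomain n p₀ U, ∀ u, ∃ v, fderiv ℝ (f ∘ φ.symm) x u
      = diff n f (φ.symm x) v ∧ diff n φ (φ.symm x) v = u := by
    intro x hx u
    obtain ⟨v, hv⟩ := diff_extChartAt_surjective (hsrc x hx) u
    refine ⟨v, ?_, hv⟩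
    rw [diff_eq_fderiv (hsrc x hx) (hdf _), ← hφ, φ.right_inv hx.1, hv]
  have hf' : ContDiffOn ℝ ∞ (f ∘ φ.symm) (chartDomain n p₀ U) :=
    contDiffOn_chartDomain hf.1.contMDiffOn p₀
  obtain ⟨v, hv1, hv2⟩ := exists_contDiffOn_lift (isOpen_chartDomain hU p₀) hf'
    (contDiffOn_chartDomain hN.smooth p₀) (contDiffOn_chartDomain hV p₀) (fun x hx => by
      let L : (EuclideanSpace ℝ (Fin (2 * n)) × ℝ) →ₗ[ℝ] Heis n :=
        (fderiv ℝ (f ∘ φ.symm) x).toLinearMap.comp (LinearMap.fst ℝ _ ℝ)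
          + (LinearMap.snd ℝ _ ℝ).smulRight (ofFrame (f (φ.symm x)) (N (φ.symm x)))
      -- Pairing a kernel element with the unit normal kills its normal component, and the immersion
      -- property kills the tangent one. Both spaces have dimension `2n + 1`, so injectivity
      -- suffices.
      have hinj : Function.Injective L := by
        rw [← LinearMap.ker_eq_bot, LinearMap.ker_eq_bot']
        rintro ⟨u, c⟩ h
        have h0 : fderiv ℝ (f ∘ φ.symm) x u + c • ofFrame (f (φ.symm x)) (N (φ.symm x)) = 0 := h
        obtain ⟨w, hw, hw'⟩ := hkey x hx u
        have ht : ofFrame (f (φ.symm x)) (c • N (φ.symm x)) ∈ tangent f (φ.symm x) := by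
          refine ⟨-w, ?_⟩
          rw [map_smul, ContinuousLinearMap.coe_coe, map_neg, ← hw]
          exact (eq_neg_of_add_eq_zero_right h0).symm
        have hc : c = 0 := by
          have h1 := hN.normal _ hx.2 _ ht
          have h2 := hN.unit _ hx.2
          simp only [metric, Prod.smul_fst, Prod.smul_snd, inner_smul_right, smul_eq_mul] at h1 h2
          linear_combination h1 - c * h2
        subst hc
        have hw0 : w = 0 := hf.2 (φ.symm x) (by rw [map_zero, ← hw]; simpa using h0)
        rw [hw0, map_zero] at hw'
        exact Prod.ext hw'.symm rfl
      refine ⟨hinj, (LinearMap.injective_iff_surjective_of_finrank_eq_finrank ?_).1 hinj⟩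
      simp
      omega) (fun x hx => by
      obtain ⟨w, hw⟩ := mem_frameTangent.1 (hVt _ hx.2)
      refine ⟨diff n φ (φ.symm x) w, ?_⟩
      rw [diff_eq_fderiv (hsrc x hx) (hdf _), ← hφ, φ.right_inv hx.1] at hw
      exact hw)
  refine ⟨v, hv1, hv2, fun F _ _ g hg x hx => ?_⟩
  obtain ⟨w, hw, hw'⟩ := hkey x hx (v x)
  have h1 : diff n f (φ.symm x) w = ofFrame (f (φ.symm x)) (V (φ.symm x)) := by
    rw [← hw]; exact hv2 x hx
  rw [Dv_eq_of_diff_eq (hf.2 _) h1, diff_eq_fderiv (hsrc x hx)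
    ((hg _ hx.2).mdifferentiableAt (hU.mem_nhds hx.2)), ← hφ, hw', φ.right_inv hx.1]

end Chart

end

section

/-! ### Brackets of tangent fields -/

section Commutator

variable {n : ℕ} {M : Type*} [TopologicalSpace M] [ChartedSpace (EuclideanSpace ℝ (Fin (2 * n))) M]
  [IsManifold (𝓡 (2 * n)) ∞ M]
variable {F : Type} [NormedAddCommGroup F] [NormedSpace ℝ F]
variable {f : M → Heis n} {N : M → Hor n × ℝ} {U : Set M}

theorem contMDiffOn_Dv (hf : IsImmersion f) (hU : IsOpen U) (hN : IsUnitNormalOn f N U)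
    {V : M → Hor n × ℝ} (hV : ContMDiffOn (𝓡 (2 * n)) 𝓘(ℝ, Hor n × ℝ) ∞ V U)
    (hVt : ∀ p ∈ U, V p ∈ frameTangent f p) {g : M → F}
    (hg : ContMDiffOn (𝓡 (2 * n)) 𝓘(ℝ, F) ∞ g U) :
    ContMDiffOn (𝓡 (2 * n)) 𝓘(ℝ, F) ∞ (fun p => Dv f g p (V p)) U := by
  intro p₀ hp₀
  obtain ⟨v, hv, -, hv'⟩ := exists_chart_lift hf hU hN hV hVt p₀
  set φ := extChartAt (𝓡 (2 * n)) p₀ with hφ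
  have hΩ := isOpen_chartDomain (n := n) hU p₀
  have h1 : ContDiffOn ℝ ∞ (fun x => fderiv ℝ (g ∘ φ.symm) x (v x)) (chartDomain n p₀ U) :=
    ((contDiffOn_chartDomain hg p₀).fderiv_of_isOpen hΩ (by simp)).clm_apply hv
  have h2 : ContMDiffAt (𝓡 (2 * n)) 𝓘(ℝ, F) ∞
      ((fun x => fderiv ℝ (g ∘ φ.symm) x (v x)) ∘ φ) p₀ :=
    ContMDiffAt.comp p₀ ((h1.contDiffAt (hΩ.mem_nhds (mem_chartDomain hp₀))).contMDiffAt)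
      contMDiffAt_extChartAt
  refine ContMDiffAt.contMDiffWithinAt (h2.congr_of_eventuallyEq ?_)
  filter_upwards [(isOpen_extChartAt_source (I := 𝓡 (2 * n)) p₀).mem_nhds
    (mem_extChartAt_source p₀), hU.mem_nhds hp₀] with y hy hyU
  have hyΩ : φ y ∈ chartDomain n p₀ U := ⟨φ.map_source hy, by
    rw [Set.mem_preimage, ← hφ, φ.left_inv hy]; exact hyU⟩
  have h3 := hv' F g (hg.mdifferentiableOn (by simp)) (φ y) hyΩ
  rw [φ.left_inv hy] at h3
  exact h3

/-- Both halves are used: tangency of the bracket yields the symmetry relations for `∇ν`, and its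
action on functions yields the commutators from which the Codazzi equations follow. -/
theorem Dv_commutator (hf : IsImmersion f) (hU : IsOpen U) (hN : IsUnitNormalOn f N U)
    {V W : M → Hor n × ℝ} (hV : ContMDiffOn (𝓡 (2 * n)) 𝓘(ℝ, Hor n × ℝ) ∞ V U)
    (hVt : ∀ p ∈ U, V p ∈ frameTangent f p)
    (hW : ContMDiffOn (𝓡 (2 * n)) 𝓘(ℝ, Hor n × ℝ) ∞ W U)
    (hWt : ∀ p ∈ U, W p ∈ frameTangent f p) {p : M} (hp : p ∈ U) :
    Dv f W p (V p) - Dv f V p (W p) - (0, 2 * inner ℝ (J (V p).1) (W p).1) ∈ frameTangent f p ∧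
    ∀ {g : M → F}, ContMDiffOn (𝓡 (2 * n)) 𝓘(ℝ, F) ∞ g U →
      Dv f (fun x => Dv f g x (W x)) p (V p) - Dv f (fun x => Dv f g x (V x)) p (W p)
        = Dv f g p (Dv f W p (V p) - Dv f V p (W p) - (0, 2 * inner ℝ (J (V p).1) (W p).1)) := by
  obtain ⟨v, hv, hvf, hvg⟩ := exists_chart_lift hf hU hN hV hVt p
  obtain ⟨w, hw, hwf, hwg⟩ := exists_chart_lift hf hU hN hW hWt p
  set φ := extChartAt (𝓡 (2 * n)) p with hφ
  have hΩ := isOpen_chartDomain (n := n) hU p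
  have hx : φ p ∈ chartDomain n p U := mem_chartDomain hp
  have hnhds := hΩ.mem_nhds hx
  have hφp : φ.symm (φ p) = p := φ.left_inv (mem_extChartAt_source p)
  have hdiff : ∀ {G : Type} [NormedAddCommGroup G] [NormedSpace ℝ G] {g : M → G},
      ContMDiffOn (𝓡 (2 * n)) 𝓘(ℝ, G) ∞ g U → ContDiffAt ℝ ∞ (g ∘ φ.symm) (φ p) :=
    fun hg => (contDiffOn_chartDomain hg p).contDiffAt hnhds
  have hvd : DifferentiableAt ℝ v (φ p) := (hv.contDiffAt hnhds).differentiableAt (by simp)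
  have hwd : DifferentiableAt ℝ w (φ p) := (hw.contDiffAt hnhds).differentiableAt (by simp)
  have hvp : ∀ {G : Type} [NormedAddCommGroup G] [NormedSpace ℝ G] {g : M → G},
      ContMDiffOn (𝓡 (2 * n)) 𝓘(ℝ, G) ∞ g U →
      Dv f g p (V p) = fderiv ℝ (g ∘ φ.symm) (φ p) (v (φ p)) := by
    intro G _ _ g hg
    have h := hvg G g (hg.mdifferentiableOn (by simp)) (φ p) hx
    rwa [hφp] at h
  have hwp : ∀ {G : Type} [NormedAddCommGroup G] [NormedSpace ℝ G] {g : M → G},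
      ContMDiffOn (𝓡 (2 * n)) 𝓘(ℝ, G) ∞ g U →
      Dv f g p (W p) = fderiv ℝ (g ∘ φ.symm) (φ p) (w (φ p)) := by
    intro G _ _ g hg
    have h := hwg G g (hg.mdifferentiableOn (by simp)) (φ p) hx
    rwa [hφp] at h
  have hbr := fderiv_lieBracket_eq_ofFrame (hdiff hf.1.contMDiffOn) hvd hwd
    ((hdiff hV).differentiableAt (by simp)) ((hdiff hW).differentiableAt (by simp))
    (by filter_upwards [hnhds] with y hy using hvf y hy)
    (by filter_upwards [hnhds] with y hy using hwf y hy)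
  rw [← hvp hW, ← hwp hV] at hbr
  simp only [Function.comp_apply, hφp] at hbr
  have hdf : MDifferentiableAt (𝓡 (2 * n)) 𝓘(ℝ, Heis n) f p :=
    (hf.1 p).mdifferentiableAt (by simp)
  obtain ⟨u, hu⟩ := diff_extChartAt_surjective (mem_extChartAt_source p)
    (fderiv ℝ w (φ p) (v (φ p)) - fderiv ℝ v (φ p) (w (φ p)))
  have hfu : diff n f p u = ofFrame (f p)
      (Dv f W p (V p) - Dv f V p (W p) - (0, 2 * inner ℝ (J (V p).1) (W p).1)) := by
    rw [diff_eq_fderiv (mem_extChartAt_source p) hdf, hu, ← hbr]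
  refine ⟨mem_frameTangent.2 ⟨u, hfu⟩, fun {g} hg => ?_⟩
  have hgd : MDifferentiableAt (𝓡 (2 * n)) 𝓘(ℝ, F) g p :=
    (hg.mdifferentiableOn (by simp) p hp).mdifferentiableAt (hU.mem_nhds hp)
  rw [Dv_eq_of_diff_eq (hf.2 p) hfu, diff_eq_fderiv (mem_extChartAt_source p) hgd, hu,
    ← hφ, ← fderiv_fderiv_apply_sub (hdiff hg) hvd hwd,
    hvp (contMDiffOn_Dv hf hU hN hW hWt hg), hwp (contMDiffOn_Dv hf hU hN hV hVt hg)]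
  congr 1
  · refine DFunLike.congr_fun (Filter.EventuallyEq.fderiv_eq ?_) _
    filter_upwards [hnhds] with y hy using hwg F g (hg.mdifferentiableOn (by simp)) y hy
  · refine DFunLike.congr_fun (Filter.EventuallyEq.fderiv_eq ?_) _
    filter_upwards [hnhds] with y hy using hvg F g (hg.mdifferentiableOn (by simp)) y hy

end Commutator

end

section

/-! ### The horizontal normal and the equation of the tangent space -/

section Normal

theorem norm_nu {n : ℕ} {M : Type*} {N : M → Hor n × ℝ} {p : M} (h : (N p).1 ≠ 0) :
    ‖nu N p‖ = 1 := by
  rw [nu, norm_smul, norm_inv, norm_norm, inv_mul_cancel₀ (norm_ne_zero_iff.2 h)]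

variable {n : ℕ} {M : Type*} [TopologicalSpace M] [ChartedSpace (EuclideanSpace ℝ (Fin (2 * n))) M]
variable {f : M → Heis n} {N : M → Hor n × ℝ} {U : Set M}

/-- The linear functional `⟨N p, ·⟩` on frame coefficients. -/
noncomputable def metricFunctional (V : Hor n × ℝ) : (Hor n × ℝ) →ₗ[ℝ] ℝ :=
  ((innerSL ℝ V.1).toLinearMap.comp (LinearMap.fst ℝ (Hor n) ℝ))
    + V.2 • LinearMap.snd ℝ (Hor n) ℝ

theorem metricFunctional_apply (V W : Hor n × ℝ) : metricFunctional V W = metric V W := by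
  simp [metricFunctional, metric]

theorem finrank_frameTangent {p : M} (hf : Function.Injective (diff n f p)) :
    Module.finrank ℝ (frameTangent f p) = 2 * n := by
  let e : (Hor n × ℝ) ≃ₗ[ℝ] Heis n :=
    LinearEquiv.ofBijective (ofFrame (f p)) ⟨ofFrame_injective _, ofFrame_surjective _⟩
  have h1 : frameTangent f p = (tangent f p).comap e.toLinearMap := rfl
  have h2 : frameTangent f p = (tangent f p).map e.symm.toLinearMap := by
    rw [h1, Submodule.comap_equiv_eq_map_symm]
  rw [h2, LinearEquiv.finrank_map_eq, tangent, LinearMap.finrank_range_of_inj hf]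
  simp

/-- A unit normal gives one inclusion by definition; the other holds because the tangent space and
the kernel of the pairing with `N` both have dimension `2n`. -/
theorem mem_frameTangent_iff_metric {p : M} (hf : Function.Injective (diff n f p))
    (hN : IsUnitNormalOn f N U) (hp : p ∈ U) {V : Hor n × ℝ} :
    V ∈ frameTangent f p ↔ metric (N p) V = 0 := by
  have hle : frameTangent f p ≤ LinearMap.ker (metricFunctional (N p)) := fun V hV => by
    rw [LinearMap.mem_ker, metricFunctional_apply]
    exact hN.normal p hp V hV
  have hsurj : LinearMap.range (metricFunctional (N p)) = ⊤ := by
    rw [LinearMap.range_eq_top]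
    intro c
    refine ⟨c • N p, ?_⟩
    rw [map_smul, metricFunctional_apply, hN.unit p hp, smul_eq_mul, mul_one]
  have hrank := LinearMap.finrank_range_add_finrank_ker (metricFunctional (N p))
  rw [hsurj] at hrank
  have heq : frameTangent f p = LinearMap.ker (metricFunctional (N p)) := by
    refine Submodule.eq_of_le_of_finrank_eq hle ?_
    rw [finrank_frameTangent hf]
    simp at hrank
    omega
  rw [heq, LinearMap.mem_ker, metricFunctional_apply]

/-- A vertical unit normal would make the tangent space equal to the vectors without `T`-component,
hence the point characteristic. -/
theorem horizontalPart_ne_zero {p : M} (hf : Function.Injective (diff n f p))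
    (hN : IsUnitNormalOn f N U) (hp : p ∈ U) (hc : ¬ IsCharacteristicAt f p) : (N p).1 ≠ 0 := by
  intro h0
  refine hc ?_
  have h1 := hN.unit p hp
  simp only [metric, h0, inner_zero_left, zero_add] at h1
  have hmem : ∀ V : Hor n × ℝ, ofFrame (f p) V ∈ tangent f p ↔ V.2 = 0 := fun V => by
    have h2 : ofFrame (f p) V ∈ tangent f p ↔ metric (N p) V = 0 :=
      mem_frameTangent_iff_metric hf hN hp
    have h3 : (N p).2 ≠ 0 := fun h => by simp [h] at h1
    rw [h2]
    simp [metric, h0, h3]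
  unfold IsCharacteristicAt
  ext X
  obtain ⟨V, rfl⟩ := ofFrame_surjective (f p) X
  rw [hmem]
  constructor
  · intro h
    exact ⟨V.1, by rw [horVec, LinearMap.comp_apply, LinearMap.inl_apply, ← h]⟩
  · rintro ⟨w, hw⟩
    have := ofFrame_injective _ (show ofFrame (f p) (w, 0) = ofFrame (f p) V from hw)
    rw [← this]

theorem mem_frameTangent_iff {p : M} (hf : Function.Injective (diff n f p))
    (hN : IsUnitNormalOn f N U) (hp : p ∈ U) (h : (N p).1 ≠ 0) {V : Hor n × ℝ} :
    V ∈ frameTangent f p ↔ inner ℝ (nu N p) V.1 + alpha N p * V.2 = 0 := by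
  rw [mem_frameTangent_iff_metric hf hN hp, metric, nu, alpha, real_inner_smul_left]
  have h' := norm_ne_zero_iff.2 h
  have e : ‖(N p).1‖⁻¹ * inner ℝ (N p).1 V.1 + (N p).2 / ‖(N p).1‖ * V.2
      = ‖(N p).1‖⁻¹ * (inner ℝ (N p).1 V.1 + (N p).2 * V.2) := by
    field_simp
  rw [e, mul_eq_zero, inv_eq_zero, or_iff_right h']

theorem mem_horTangent_iff_inner {p : M} (hf : Function.Injective (diff n f p))
    (hN : IsUnitNormalOn f N U) (hp : p ∈ U) (h : (N p).1 ≠ 0) {w : Hor n} :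
    w ∈ horTangent f p ↔ inner ℝ (nu N p) w = 0 := by
  rw [mem_horTangent_iff, mem_frameTangent_iff hf hN hp h]
  simp

theorem contMDiffOn_norm_horizontalPart (hN : IsUnitNormalOn f N U) (h : ∀ p ∈ U, (N p).1 ≠ 0) :
    ContMDiffOn (𝓡 (2 * n)) 𝓘(ℝ, ℝ) ∞ (fun p => ‖(N p).1‖⁻¹) U := by
  intro p hp
  have h1 : ContDiffAt ℝ ∞ (fun V : Hor n × ℝ => ‖V.1‖⁻¹) (N p) :=
    (contDiffAt_fst.norm ℝ (h p hp)).inv (norm_ne_zero_iff.2 (h p hp))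
  exact h1.contMDiffAt.comp_contMDiffWithinAt p (hN.smooth p hp)

theorem contMDiffOn_nu (hN : IsUnitNormalOn f N U) (h : ∀ p ∈ U, (N p).1 ≠ 0) :
    ContMDiffOn (𝓡 (2 * n)) 𝓘(ℝ, Hor n) ∞ (nu N) U :=
  (contMDiffOn_norm_horizontalPart hN h).smul
    (contDiff_fst.contMDiff.comp_contMDiffOn hN.smooth)

theorem contMDiffOn_alpha (hN : IsUnitNormalOn f N U) (h : ∀ p ∈ U, (N p).1 ≠ 0) :
    ContMDiffOn (𝓡 (2 * n)) 𝓘(ℝ, ℝ) ∞ (alpha N) U := by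
  have h1 := (contDiff_snd.contMDiff.comp_contMDiffOn hN.smooth).mul
    (contMDiffOn_norm_horizontalPart hN h)
  exact h1.congr fun p _ => div_eq_mul_inv _ _

end Normal

end

section

/-! ### Moving frames, algebraically -/

section Quaternions

variable {R : Type*} [CommRing R]

/-- Three anticommuting complex structures on `R⁴`, the first of which is `J`. -/
def quat : Fin 3 → (Fin 2 ⊕ Fin 2 → R) → Fin 2 ⊕ Fin 2 → R
  | 0, v => Sum.elim ![-v (.inr 0), -v (.inr 1)] ![v (.inl 0), v (.inl 1)]
  | 1, v => Sum.elim ![-v (.inl 1), v (.inl 0)] ![v (.inr 1), -v (.inr 0)]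
  | 2, v => Sum.elim ![-v (.inr 1), v (.inr 0)] ![-v (.inl 1), v (.inl 0)]

/-- The scalar product of `R⁴`. -/
def dot (v w : Fin 2 ⊕ Fin 2 → R) : R := ∑ c, v c * w c

theorem dot_eq (v w : Fin 2 ⊕ Fin 2 → R) : dot v w = v (.inl 0) * w (.inl 0)
    + v (.inl 1) * w (.inl 1) + v (.inr 0) * w (.inr 0) + v (.inr 1) * w (.inr 1) := by
  simp only [dot, Fintype.sum_sum_type, Fin.sum_univ_two]
  ring

theorem dot_comm (v w : Fin 2 ⊕ Fin 2 → R) : dot v w = dot w v :=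
  Finset.sum_congr rfl fun _ _ => mul_comm _ _

/-- The structure constants of the quaternions. -/
def eps : Fin 3 → Fin 3 → Fin 3 → ℤ
  | 0, 1, 2 => 1
  | 1, 2, 0 => 1
  | 2, 0, 1 => 1
  | 0, 2, 1 => -1
  | 2, 1, 0 => -1
  | 1, 0, 2 => -1
  | _, _, _ => 0

/-- This is the multiplication table of the quaternions. Moving `quat i` to the other side costs a
sign because it is skew, which is absorbed in the order of the indices `i k j`. -/
theorem dot_quat_quat (v w : Fin 2 ⊕ Fin 2 → R) (i j : Fin 3) :
    dot (quat i v) (quat j w) = (if i = j then dot v w else 0)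
      + ∑ k, (eps i k j : R) * dot v (quat k w) := by
  fin_cases i <;> fin_cases j <;>
    simp [dot_eq, quat, eps, Fin.sum_univ_three] <;> ring

theorem dot_quat_left (v w : Fin 2 ⊕ Fin 2 → R) (i : Fin 3) :
    dot (quat i v) w = -dot v (quat i w) := by
  fin_cases i <;> simp [dot_eq, quat] <;> ring

theorem dot_quat_self (v : Fin 2 ⊕ Fin 2 → R) (i : Fin 3) : dot (quat i v) v = 0 := by
  fin_cases i <;> simp [dot_eq, quat] <;> ring

/-- The vectors `n` and `quat k n` are pairwise orthogonal of the same length. The expansion in them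
is stated without division, so that it is valid over any commutative ring. -/
theorem dot_self_smul_eq (n v : Fin 2 ⊕ Fin 2 → R) (c : Fin 2 ⊕ Fin 2) :
    dot n n * v c = dot v n * n c + ∑ k, dot v (quat k n) * quat k n c := by
  rcases c with c | c <;> fin_cases c <;>
    simp [dot_eq, quat, Fin.sum_univ_three] <;> ring

/-- Expand both vectors in the basis formed by `n` and the `quat k n`. When they are derivatives of
a unit `n`, hence orthogonal to it, only the double sum with `eps` survives. -/
theorem dot_self_mul_dot_quat (n v w : Fin 2 ⊕ Fin 2 → R) (i : Fin 3) :
    dot n n * dot v (quat i w) = dot v (quat i n) * dot w n - dot w (quat i n) * dot v n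
      + ∑ k, ∑ l, (eps i l k : R) * (dot v (quat k n) * dot w (quat l n)) := by
  fin_cases i <;>
    simp [dot_eq, quat, eps, Fin.sum_univ_three] <;> ring

end Quaternions

end

section

/-! ### Structure equations of an abstract adapted frame -/

section Dot

variable {R : Type*} [CommRing R]

theorem dot_add_left (u v w : Fin 2 ⊕ Fin 2 → R) :
    dot (fun c => u c + v c) w = dot u w + dot v w := by
  simp only [dot_eq]; ring

theorem dot_sub_left (u v w : Fin 2 ⊕ Fin 2 → R) :
    dot (fun c => u c - v c) w = dot u w - dot v w := by
  simp only [dot_eq]; ring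

theorem dot_mul_left (a : R) (v w : Fin 2 ⊕ Fin 2 → R) :
    dot (fun c => a * v c) w = a * dot v w := by
  simp only [dot_eq]; ring

theorem dot_quat_zero_quat (n : Fin 2 ⊕ Fin 2 → R) (i j : Fin 3) :
    dot (quat 0 (quat i n)) (quat j n) = eps 0 i j * dot n n := by
  fin_cases i <;> fin_cases j <;> simp [dot_eq, quat, eps] <;> ring

theorem dot_quat_quat_self (n : Fin 2 ⊕ Fin 2 → R) (i j : Fin 3) :
    dot (quat i n) (quat j n) = if i = j then dot n n else 0 := by
  fin_cases i <;> fin_cases j <;> simp [dot_eq, quat] <;> ring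

theorem derivation_quat [Algebra ℝ R] (d : Derivation ℝ R R) (j : Fin 3)
    (v : Fin 2 ⊕ Fin 2 → R) (c : Fin 2 ⊕ Fin 2) :
    d (quat j v c) = quat j (fun c => d (v c)) c := by
  rcases c with c | c <;> fin_cases j <;> fin_cases c <;> simp [quat]

theorem derivation_dot [Algebra ℝ R] (d : Derivation ℝ R R) (v w : Fin 2 ⊕ Fin 2 → R) :
    d (dot v w) = dot (fun c => d (v c)) w + dot v (fun c => d (w c)) := by
  simp only [dot_eq, map_add, Derivation.leibniz, smul_eq_mul]
  ring

theorem eq_zero_of_two_mul_eq_zero [Algebra ℝ R] {x : R} (h : 2 * x = 0) : x = 0 := by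
  have h1 : x = (1 / 2 : ℝ) • (2 * x) := by
    rw [two_mul, ← two_smul ℝ x, smul_smul]
    norm_num
  rw [h1, h, smul_zero]

end Dot

/-- The moving frame `e₀ = Jν, e₁, e₂` of the horizontal tangent bundle and the field `S = T - αν`
of a hypersurface in `ℍ²`, seen as derivations of a ring of functions, with their commutators. -/
structure AdaptedFrame (R : Type*) [CommRing R] [Algebra ℝ R] where
  n : Fin 2 ⊕ Fin 2 → R
  α : R
  D : Fin 3 → Derivation ℝ R R
  S : Derivation ℝ R R
  unit : dot n n = 1
  -- The bracket of `eᵢ` and `eⱼ` has `T`-component `-2⟨J eᵢ, eⱼ⟩`. Tangency therefore fixes its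
  -- `ν`-component, and as `S = T - αν` is the only member of the tangent frame with a
  -- `T`-component, the same number is the coefficient of `S` in `bracket`. The two fields about
  -- `[S, eᵢ]` have the same origin.
  tangent_bracket : ∀ i j, dot (fun c => D i (quat j n c) - D j (quat i n c)) n
    = 2 * α * dot (quat 0 (quat i n)) (quat j n)
  bracket : ∀ i j g, D i (D j g) - D j (D i g)
    = ∑ k, dot (fun c => D i (quat j n c) - D j (quat i n c)) (quat k n) * D k g
      - 2 * dot (quat 0 (quat i n)) (quat j n) * S g
  tangent_bracket_S : ∀ i, dot (fun c => S (quat i n c) + D i (α * n c)) n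
    = -2 * α ^ 2 * dot (quat 0 n) (quat i n)
  bracket_S : ∀ i g, S (D i g) - D i (S g)
    = ∑ k, dot (fun c => S (quat i n c) + D i (α * n c)) (quat k n) * D k g
      + 2 * α * dot (quat 0 n) (quat i n) * S g

namespace AdaptedFrame

variable {R : Type*} [CommRing R] [Algebra ℝ R] (A : AdaptedFrame R)

/-- The coefficients `h(eᵢ, eⱼ)`. -/
def a (i j : Fin 3) : R := dot (fun c => A.D i (A.n c)) (quat j A.n)

/-- The coefficients `h̃(eᵢ, eⱼ)`. -/
def b (i j : Fin 3) : R := A.a i j + A.α * eps 0 i j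

/-- The coefficients of `∇_S ν`. -/
def s (i : Fin 3) : R := dot (fun c => A.S (A.n c)) (quat i A.n)

/-- The connection coefficients `⟨∇_{eᵢ} eⱼ, eₖ⟩`. -/
def Γ (i j k : Fin 3) : R := dot (fun c => A.D i (quat j A.n c)) (quat k A.n)

theorem dot_derivation_n (d : Derivation ℝ R R) : dot (fun c => d (A.n c)) A.n = 0 := by
  have h := congrArg d A.unit
  rw [derivation_dot, Derivation.map_one_eq_zero, dot_comm A.n] at h
  exact eq_zero_of_two_mul_eq_zero (by linear_combination h)

/-- A derivation commutes with the constant map `quat j`, so the derivative of `eⱼ` is `quat j`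
applied to that of `ν`. The whole connection of the frame is thus governed by `∇ν`. -/
theorem dot_derivation_quat (d : Derivation ℝ R R) (j k : Fin 3) :
    dot (fun c => d (quat j A.n c)) (quat k A.n)
      = ∑ m, (eps j m k : R) * dot (fun c => d (A.n c)) (quat m A.n) := by
  simp only [derivation_quat]
  rw [show (fun c => quat j (fun c => d (A.n c)) c) = quat j (fun c => d (A.n c)) from rfl,
    dot_quat_quat, A.dot_derivation_n, ite_self, zero_add]

theorem dot_derivation_quat_n (d : Derivation ℝ R R) (j : Fin 3) :
    dot (fun c => d (quat j A.n c)) A.n = -dot (fun c => d (A.n c)) (quat j A.n) := by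
  simp only [derivation_quat]
  exact dot_quat_left _ _ _

theorem Γ_eq (i j k : Fin 3) : A.Γ i j k = ∑ m, (eps j m k : R) * A.a i m :=
  A.dot_derivation_quat (A.D i) j k

/-- Tangency of `[eᵢ, eⱼ]`: the torsion is the only obstruction to the symmetry of `h`, and the term
`αJ'` in `h̃` removes it. -/
theorem a_sub_a (i j : Fin 3) : A.a i j - A.a j i = -2 * A.α * eps 0 i j := by
  have h := A.tangent_bracket i j
  rw [dot_sub_left, dot_derivation_quat_n, dot_derivation_quat_n, dot_quat_zero_quat, A.unit] at h
  simp only [a]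
  linear_combination -h

theorem b_symm (i j : Fin 3) : A.b i j = A.b j i := by
  have h := A.a_sub_a i j
  have h1 : eps 0 j i = -eps 0 i j := by fin_cases i <;> fin_cases j <;> rfl
  simp only [b, h1]
  push_cast
  linear_combination h

/-- Tangency of `[S, eᵢ]` determines `∇_S ν` from the horizontal gradient of `α`. -/
theorem s_eq (i : Fin 3) : A.s i = A.D i A.α + if i = 0 then 2 * (A.α * A.α) else 0 := by
  have h := A.tangent_bracket_S i
  rw [dot_add_left, dot_derivation_quat_n, dot_quat_quat_self, A.unit] at h
  have h1 : dot (fun c => A.D i (A.α * A.n c)) A.n = A.D i A.α := by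
    simp only [Derivation.leibniz, smul_eq_mul]
    rw [dot_add_left, dot_mul_left, A.dot_derivation_n]
    have h2 : dot (fun c => A.n c * A.D i A.α) A.n = A.D i A.α * dot A.n A.n := by
      simp only [dot_eq]; ring
    rw [h2, A.unit]
    ring
  rw [h1] at h
  simp only [s]
  by_cases hi : i = 0
  · subst hi
    simp at h ⊢
    linear_combination -h
  · simp [hi, Ne.symm hi] at h ⊢
    linear_combination -h

theorem commutator (i j : Fin 3) (g : R) : A.D i (A.D j g) - A.D j (A.D i g)
    = ∑ k, (A.Γ i j k - A.Γ j i k) * A.D k g - 2 * eps 0 i j * A.S g := by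
  rw [A.bracket, dot_quat_zero_quat, A.unit, mul_one]
  simp only [dot_sub_left, Γ]

theorem commutator_S (i : Fin 3) (g : R) : A.S (A.D i g) - A.D i (A.S g)
    = ∑ k, (∑ m, (eps i m k : R) * A.s m + A.α * A.a i k) * A.D k g
      + (if i = 0 then 2 * A.α else 0) * A.S g := by
  rw [A.bracket_S, dot_quat_quat_self, A.unit]
  congr 1
  · refine Finset.sum_congr rfl fun k _ => ?_
    rw [dot_add_left, A.dot_derivation_quat]
    congr 2
    simp only [Derivation.leibniz, smul_eq_mul]
    rw [dot_add_left, dot_mul_left]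
    have h2 : dot (fun c => A.n c * A.D i A.α) (quat k A.n)
        = A.D i A.α * dot (quat k A.n) A.n := by
      simp only [dot_eq]; ring
    rw [h2, dot_quat_self]
    simp [a]
  · by_cases hi : i = 0
    · simp [hi]
    · simp [hi, Ne.symm hi]

theorem dot_derivation_quat_derivation (d d' : Derivation ℝ R R) (m : Fin 3) :
    dot (fun c => d (A.n c)) (fun c => d' (quat m A.n c))
      = ∑ k, ∑ l, (eps m l k : R) * (dot (fun c => d (A.n c)) (quat k A.n)
        * dot (fun c => d' (A.n c)) (quat l A.n)) := by
  simp only [derivation_quat]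
  have h := dot_self_mul_dot_quat A.n (fun c => d (A.n c)) (fun c => d' (A.n c)) m
  rw [A.unit, A.dot_derivation_n, A.dot_derivation_n] at h
  simpa using h

theorem sum_dot_mul_derivation (x : Fin 3 → R) (d : Fin 3 → Derivation ℝ R R) (m : Fin 3) :
    dot (fun c => ∑ k, x k * d k (A.n c)) (quat m A.n)
      = ∑ k, x k * dot (fun c => d k (A.n c)) (quat m A.n) := by
  simp only [dot_eq, Fin.sum_univ_three]
  ring

/-- Apply the commutator of `eᵢ` and `eⱼ` to the components of `ν` and pair with `eₘ`. There is no
curvature term as `∇` is flat; the last sum comes from differentiating `eₘ` inside `h(eⱼ, eₘ)` and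
`h(eᵢ, eₘ)`. -/
theorem codazzi (i j m : Fin 3) : A.D i (A.a j m) - A.D j (A.a i m)
    = ∑ k, (A.Γ i j k - A.Γ j i k) * A.a k m - 2 * eps 0 i j * A.s m
      + ∑ k, ∑ l, (eps m l k : R) * (A.a j k * A.a i l - A.a i k * A.a j l) := by
  have h1 : dot (fun c => A.D i (A.D j (A.n c)) - A.D j (A.D i (A.n c))) (quat m A.n)
      = ∑ k, (A.Γ i j k - A.Γ j i k) * A.a k m - 2 * eps 0 i j * A.s m := by
    simp only [A.commutator]
    rw [dot_sub_left, sum_dot_mul_derivation, dot_mul_left]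
    rfl
  have h2 := A.dot_derivation_quat_derivation (A.D j) (A.D i) m
  have h3 := A.dot_derivation_quat_derivation (A.D i) (A.D j) m
  rw [dot_sub_left] at h1
  simp only [a, derivation_dot] at h1 ⊢
  rw [h2, h3]
  simp only [mul_sub, Finset.sum_sub_distrib]
  linear_combination h1

/-- The same computation with `S` in place of a horizontal field. It supplies the derivatives of
`h̃` along `S` that the commutator of `e₁` and `e₂` brings in, and its trace controls the second
derivative of `α` along `Jν`. -/
theorem codazzi_S (i m : Fin 3) : A.S (A.a i m) - A.D i (A.s m)
    = ∑ k, (∑ r, (eps i r k : R) * A.s r + A.α * A.a i k) * A.a k m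
      + (if i = 0 then 2 * A.α else 0) * A.s m
      + ∑ k, ∑ l, (eps m l k : R) * (A.a i k * A.s l - A.s k * A.a i l) := by
  have h1 : dot (fun c => A.S (A.D i (A.n c)) - A.D i (A.S (A.n c))) (quat m A.n)
      = ∑ k, (∑ r, (eps i r k : R) * A.s r + A.α * A.a i k) * A.a k m
        + (if i = 0 then 2 * A.α else 0) * A.s m := by
    simp only [A.commutator_S]
    rw [dot_add_left, sum_dot_mul_derivation, dot_mul_left]
    rfl
  have h2 := A.dot_derivation_quat_derivation (A.D i) A.S m
  have h3 := A.dot_derivation_quat_derivation A.S (A.D i) m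
  rw [dot_sub_left] at h1
  simp only [a, s, derivation_dot] at h1 ⊢
  rw [h2, h3]
  simp only [mul_sub, Finset.sum_sub_distrib]
  linear_combination h1

end AdaptedFrame

end

/-! ### The Simons identity in a ring with derivations -/

section

-- The core of Simons' argument. The hypotheses list what Codazzi, `codazzi_S`, minimality and (P2)
-- leave of the first derivatives: `u1`, …, `u7` are free and the rest is expressed by them. In each
-- Laplacian the second derivatives cancel after commuting, and the commutators leave terms of first
-- order.
set_option maxHeartbeats 1000000 in
theorem laplacian_components {R : Type*} [CommRing R] [Algebra ℝ R] (D0 D1 D2 S : Derivation ℝ R R)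
    {α A b01 b02 b11 b22 b12 u1 u2 u3 u4 u5 u6 u7 : R}
    (h0α : D0 α = A)
    (h1α : D1 α = 0)
    (h2α : D2 α = 0)
    (h0A : D0 A = - 8 * A * α - 6 * α * α * α - 2 * α * b01 * b01 - 2 * α * b02 * b02 - 2 * α *
      b11 * b11 - 2 * α * b11 * b22 - 2 * α * b12 * b12 - 2 * α * b22 * b22)
    (h1A : D1 A = - A * b02)
    (h2A : D2 A = A * b01)
    (h0b01 : D0 b01 = - u3 - u4 - 3 * α * b01 + 3 * b01 * b12 - 3 * b02 * b11)
    (h1b01 : D1 b01 = u1)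
    (h2b01 : D2 b01 = 2 * A + u2 + 2 * α * α - b01 * b01 - b02 * b02 - b11 * b11 - 4 * b11 * b22
      + 2 * b12 * b12 - b22 * b22)
    (hSb01 : S b01 = - 2 * A * b02 - 3 * α * α * b02 - α * b01 * b22 + α * b02 * b12)
    (h0b02 : D0 b02 = - u6 - u7 - 3 * α * b02 + 3 * b01 * b22 - 3 * b02 * b12)
    (h1b02 : D1 b02 = u2)
    (h2b02 : D2 b02 = u5)
    (hSb02 : S b02 = 2 * A * b01 + 3 * α * α * b01 + α * b01 * b12 - α * b02 * b11)
    (h0b11 : D0 b11 = u1 - 3 * α * b11 - α * b22 + 3 * b01 * b02 + 3 * b11 * b12 + 3 * b12 * b22)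
    (h1b11 : D1 b11 = u3)
    (h2b11 : D2 b11 = u6)
    (hSb11 : S b11 = A * α - 3 * A * b12 + α * α * α - 6 * α * α * b12 + α * b01 * b01 + α * b11
      * b11 + α * b12 * b12)
    (h0b22 : D0 b22 = u5 - α * b11 - 3 * α * b22 - 3 * b01 * b02 - 3 * b11 * b12 - 3 * b12 * b22)
    (h1b22 : D1 b22 = u4)
    (h2b22 : D2 b22 = u7)
    (h0b12 : D0 b12 = A + u2 + α * α - 2 * α * b12 - 2 * b01 * b01 + b02 * b02 - 2 * b11 * b11 -
      2 * b11 * b22 + b12 * b12 + b22 * b22)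
    (h1b12 : D1 b12 = u6 - α * b02 - 3 * b01 * b22 + 3 * b02 * b12)
    (h2b12 : D2 b12 = u4 - α * b01 - 3 * b01 * b12 + 3 * b02 * b11)
    (hSb12 : 2 * S b12 = 3 * A * b11 - 3 * A * b22 + 6 * α * α * b11 - 6 * α * α * b22 + 2 * α *
      b01 * b02 + 2 * α * b11 * b12 + 2 * α * b12 * b22)
    (c01 : ∀ g, D0 (D1 g) - D1 (D0 g) = (b02) * D0 g + (- α + b12) * D1 g + (b22) * D2 g)
    (c02 : ∀ g, D0 (D2 g) - D2 (D0 g) = (- b01) * D0 g + (- b11) * D1 g + (- α - b12) * D2 g)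
    (c12 : ∀ g, D1 (D2 g) - D2 (D1 g) = (- b11 - b22) * D0 g + (b01) * D1 g + (b02) * D2 g - 2 *
      S g) :
    D0 (D0 b01) + D1 (D1 b01) + D2 (D2 b01) = 2 * A * b01 - 4 * u1 * b02 + 8 * u3 * α - 4 * u3 *
      b12 + 8 * u4 * α - 4 * u5 * b02 - 6 * u6 * b22 - 2 * u7 * b11 - 4 * u7 * b22 + 14 * α * α *
      b01 - 26 * α * b01 * b12 + 26 * α * b02 * b11 + 4 * α * b02 * b22 - 4 * b01 * b01 * b01 - 4
      * b01 * b02 * b02 - 4 * b01 * b11 * b11 - 4 * b01 * b11 * b22 - 4 * b01 * b12 * b12 + 8 *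
      b01 * b22 * b22 - 12 * b02 * b12 * b22 ∧
    D0 (D0 b02) + D1 (D1 b02) + D2 (D2 b02) = 2 * A * b02 + 4 * u1 * b01 + 4 * u3 * b11 + 2 * u3
      * b22 + 6 * u4 * b11 + 4 * u5 * b01 + 8 * u6 * α + 8 * u7 * α + 4 * u7 * b12 + 14 * α * α *
      b02 - 4 * α * b01 * b11 - 26 * α * b01 * b22 + 26 * α * b02 * b12 - 4 * b01 * b01 * b02 -
      12 * b01 * b11 * b12 - 4 * b02 * b02 * b02 + 8 * b02 * b11 * b11 - 4 * b02 * b11 * b22 - 4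
      * b02 * b12 * b12 - 4 * b02 * b22 * b22 ∧
    D0 (D0 b11) + D1 (D1 b11) + D2 (D2 b11) = 4 * A * b11 + 8 * A * b22 - 8 * u1 * α + 4 * u1 *
      b12 + 4 * u2 * b11 + 8 * u2 * b22 - 4 * u3 * b02 - 8 * u4 * b02 - 4 * u6 * b01 + 20 * α * α
      * b11 + 12 * α * α * b22 - 20 * α * b01 * b02 - 24 * α * b11 * b12 - 24 * α * b12 * b22 - 8
      * b01 * b01 * b11 + 12 * b01 * b02 * b12 - 20 * b02 * b02 * b11 - 8 * b11 * b11 * b11 - 20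
      * b11 * b11 * b22 + 4 * b11 * b12 * b12 - 20 * b11 * b22 * b22 + 12 * b12 * b12 * b22 ∧
    D0 (D0 b22) + D1 (D1 b22) + D2 (D2 b22) = - 8 * A * b11 - 4 * A * b22 - 8 * u2 * b11 - 4 * u2
      * b22 + 4 * u4 * b02 - 8 * u5 * α - 4 * u5 * b12 + 8 * u6 * b01 + 4 * u7 * b01 - 4 * α * α
      * b11 + 12 * α * α * b22 + 20 * α * b01 * b02 + 24 * α * b11 * b12 + 24 * α * b12 * b22 + 8
      * b01 * b01 * b11 - 16 * b01 * b01 * b22 + 12 * b01 * b02 * b12 + 8 * b02 * b02 * b11 - 4 *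
      b02 * b02 * b22 + 8 * b11 * b11 * b11 + 16 * b11 * b11 * b22 - 4 * b11 * b12 * b12 + 4 *
      b11 * b22 * b22 - 4 * b12 * b12 * b22 - 4 * b22 * b22 * b22 ∧
    D0 (D0 b12) + D1 (D1 b12) + D2 (D2 b12) = - 8 * A * α - 4 * u1 * b11 - 2 * u1 * b22 - 8 * u2
      * α + 4 * u3 * b01 + 2 * u5 * b11 + 4 * u5 * b22 - 4 * u7 * b02 - 8 * α * α * α + 12 * α *
      α * b12 + 18 * α * b01 * b01 - 10 * α * b02 * b02 + 16 * α * b11 * b11 + 16 * α * b11 * b22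
      - 8 * α * b12 * b12 - 8 * α * b22 * b22 - 4 * b01 * b01 * b12 - 6 * b01 * b02 * b11 - 6 *
      b01 * b02 * b22 - 4 * b02 * b02 * b12 - 10 * b11 * b11 * b12 - 16 * b11 * b12 * b22 - 4 *
      b12 * b12 * b12 - 10 * b12 * b22 * b22 := by
  -- Derivations kill numerals; this has to be available to `simp` after the product rule is applied
  -- to the coefficients.
  have hn0 : ∀ k : ℕ, [k.AtLeastTwo] → D0 (OfNat.ofNat k : R) = 0 := fun k _ => D0.map_natCast k
  have hn1 : ∀ k : ℕ, [k.AtLeastTwo] → D1 (OfNat.ofNat k : R) = 0 := fun k _ => D1.map_natCast k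
  have hn2 : ∀ k : ℕ, [k.AtLeastTwo] → D2 (OfNat.ofNat k : R) = 0 := fun k _ => D2.map_natCast k
  refine ⟨?_, ?_, ?_, ?_, ?_⟩
  -- To leading order `D0 (D0 b01)` is `-D0 u3 - D0 u4`. Commuting `D0` and `D1` on `b11` and `b22`
  -- turns it into `-D1 u1 - D1 u5`, and commuting `D1` and `D2` on `b02` matches `D1 u5` with `D2
  -- u2`; these cancel against `D1 (D1 b01)` and `D2 (D2 b01)`. The other components follow the same
  -- pattern.
  · have k01b11 := c01 b11
    have k01b22 := c01 b22
    have k12b02 := c12 b02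
    simp only [
      h0α, h1α, h2α, h2A, h0b01, h1b01, h2b01, h0b02, h1b02, h2b02, hSb02, h0b11,
        h1b11, h2b11, h0b22, h1b22, h2b22, h0b12, h1b12, h2b12, hn0, hn1, hn2,
        map_add, map_sub, map_neg, Derivation.leibniz, smul_eq_mul] at k01b11 k01b22 k12b02 ⊢
    linear_combination (-1) * k01b11 + (-1) * k01b22 + (-1) * k12b02
  · have k02b11 := c02 b11
    have k12b01 := c12 b01
    have k02b22 := c02 b22
    simp only [
      h0α, h1α, h2α, h1A, h0b01, h1b01, h2b01, hSb01, h0b02, h1b02, h2b02, h0b11,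
        h1b11, h2b11, h0b22, h1b22, h2b22, h0b12, h1b12, h2b12, hn0, hn1, hn2,
        map_add, map_sub, map_neg, Derivation.leibniz, smul_eq_mul] at k02b11 k12b01 k02b22 ⊢
    linear_combination (-1) * k02b11 + (1) * k12b01 + (-1) * k02b22
  · have k01b01 := c01 b01
    have k12b12 := c12 b12
    simp only [
      h0α, h1α, h2α, h0b01, h1b01, h2b01, h0b02, h1b02, h2b02, h0b11,
        h1b11, h2b11, h0b22, h2b22, h0b12, h1b12, h2b12, hSb12, hn0, hn1, hn2,
        map_add, map_sub, map_neg, Derivation.leibniz, smul_eq_mul] at k01b01 k12b12 ⊢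
    linear_combination (1) * k01b01 + (-1) * k12b12
  · have k02b02 := c02 b02
    have k12b12 := c12 b12
    simp only [
      h0α, h1α, h2α, h0b01, h1b01, h2b01, h0b02, h1b02, h2b02, h0b11,
        h1b11, h0b22, h1b22, h2b22, h0b12, h1b12, h2b12, hSb12, hn0, hn1, hn2,
        map_add, map_sub, map_neg, Derivation.leibniz, smul_eq_mul] at k02b02 k12b12 ⊢
    linear_combination (1) * k02b02 + (1) * k12b12
  · have k02b01 := c02 b01
    have k12b11 := c12 b11
    simp only [
      h0α, h1α, h2α, h0A, h0b01, h1b01, h2b01, h0b02, h1b02, h2b02, h0b11,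
        h1b11, h2b11, hSb11, h0b22, h1b22, h0b12, h1b12, h2b12, hn0, hn1, hn2,
        map_add, map_sub, map_neg, Derivation.leibniz, smul_eq_mul] at k02b01 k12b11 ⊢
    linear_combination (1) * k02b01 + (1) * k12b11

namespace AdaptedFrame

variable {R : Type*} [CommRing R] [Algebra ℝ R] (A : AdaptedFrame R)

/-- The coefficients of `∇h̃`. -/
def nablaB (k i j : Fin 3) : R :=
  A.D k (A.b i j) - ∑ l, A.Γ k i l * A.b l j - ∑ l, A.Γ k j l * A.b i l

/-- The function `|h̃|²`. -/
def normSq : R := ∑ i, ∑ j, A.b i j * A.b i j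

/-- The quadratic form is `|h̃|²` once the trace condition has been used to eliminate `b00 = -b11 -
b22`. -/
theorem derivation_quadratic (d : Derivation ℝ R R) (b01 b02 b11 b22 b12 : R) :
    d (2 * (b11 * b11 + b22 * b22 + b11 * b22 + b01 * b01 + b02 * b02 + b12 * b12))
      = 2 * ((2 * b11 + b22) * d b11 + (2 * b22 + b11) * d b22 + 2 * b01 * d b01 + 2 * b02 * d b02
        + 2 * b12 * d b12) := by
  have h2 : d (2 : R) = 0 := d.map_natCast 2
  simp only [map_add, Derivation.leibniz, smul_eq_mul, h2]
  ring

theorem derivation_derivation_quadratic (d : Derivation ℝ R R) (b01 b02 b11 b22 b12 : R) :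
    d (d (2 * (b11 * b11 + b22 * b22 + b11 * b22 + b01 * b01 + b02 * b02 + b12 * b12)))
      = 2 * ((2 * b11 + b22) * d (d b11) + (2 * b22 + b11) * d (d b22) + 2 * b01 * d (d b01)
        + 2 * b02 * d (d b02) + 2 * b12 * d (d b12)) + 4 * (d b11 * d b11 + d b22 * d b22
        + d b11 * d b22 + d b01 * d b01 + d b02 * d b02 + d b12 * d b12) := by
  have h2 : d (2 : R) = 0 := d.map_natCast 2
  rw [derivation_quadratic]
  simp only [map_add, Derivation.leibniz, smul_eq_mul, h2]
  ring

-- The left side is the modified Laplacian written in the frame. Since `Γ` is expressed by `∇ν`,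
-- both sides become polynomials in the components of `h̃`, `α`, their first derivatives and the
-- Laplacians of the components, which `laplacian_components` evaluates.
set_option maxHeartbeats 2000000 in
theorem laplacian_normSq (hH : A.a 0 0 + A.a 1 1 + A.a 2 2 = 0) (h1α : A.D 1 A.α = 0)
    (h2α : A.D 2 A.α = 0) :
    ∑ i, A.D i (A.D i A.normSq) + ∑ i, ∑ j, A.Γ i j i * A.D j A.normSq
        + 2 * A.α * A.D 0 A.normSq
      = 2 * (∑ k, ∑ i, ∑ j, A.nablaB k i j ^ 2
        - (A.normSq + 4 * A.D 0 A.α + 6 * A.α ^ 2) * A.normSq + 4 * A.α ^ 2 * A.normSq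
        - 8 * A.α ^ 2 * ∑ j, A.a 0 j ^ 2 + 2 * A.α ^ 2 * A.a 0 0 ^ 2
        + 4 * (A.D 0 A.α + A.α ^ 2)
          * (2 * A.normSq - 4 * ∑ j, A.a 0 j ^ 2 + A.a 0 0 ^ 2)
        + (8 * A.D 0 A.α + 6 * A.α ^ 2) * (∑ j, A.a 0 j ^ 2 - A.a 0 0 ^ 2)) := by
  have hb01 := A.a_sub_a 0 1
  have hb02 := A.a_sub_a 0 2
  have hb12 := A.a_sub_a 1 2
  have hs0 := A.s_eq 0
  have hs1 := A.s_eq 1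
  have hs2 := A.s_eq 2
  have k010 := A.codazzi 0 1 0
  have k011 := A.codazzi 0 1 1
  have k012 := A.codazzi 0 1 2
  have k020 := A.codazzi 0 2 0
  have k021 := A.codazzi 0 2 1
  have k022 := A.codazzi 0 2 2
  have k120 := A.codazzi 1 2 0
  have k121 := A.codazzi 1 2 1
  have k122 := A.codazzi 1 2 2
  have m00 := A.codazzi_S 0 0
  have m01 := A.codazzi_S 0 1
  have m02 := A.codazzi_S 0 2
  have m11 := A.codazzi_S 1 1
  have m12 := A.codazzi_S 1 2
  have m21 := A.codazzi_S 2 1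
  have m22 := A.codazzi_S 2 2
  have c01 := A.commutator 0 1
  have c02 := A.commutator 0 2
  have c12 := A.commutator 1 2
  -- Only the right side of this copy is unfolded, so that it undergoes the same eliminations as the
  -- goal and can then be substituted for `A.normSq`.
  have hφ : A.normSq = A.normSq := rfl
  conv_rhs at hφ => simp only [normSq]
  simp only [nablaB, b, Γ_eq, Fin.sum_univ_three, eps, Int.cast_zero, Int.cast_one,
    Int.cast_neg, zero_mul, mul_zero, add_zero, zero_add, one_mul, mul_one, neg_mul, mul_neg,
    reduceIte, one_ne_zero,
    Fin.reduceEq, h1α, h2α, sub_zero] 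
    at hφ hs0 hs1 hs2 hb01 hb02 hb12 k010 k011 k012 k020 k021 k022 k120 k121 k122 m00 m01 m02 m11
      m12 m21 m22
      c01 c02 c12 ⊢
  have e00 : A.a 0 0 = -A.a 1 1 - A.a 2 2 := by linear_combination hH
  have e10 : A.a 1 0 = A.a 0 1 := by linear_combination -hb01
  have e20 : A.a 2 0 = A.a 0 2 := by linear_combination -hb02
  -- `β` is the symmetric coefficient `h̃(e₁, e₂)`; the two entries of `h` lie at distance `α` on
  -- either side of it.
  obtain ⟨β, hβ⟩ : ∃ β, β = A.a 1 2 + A.α := ⟨_, rfl⟩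
  have e12 : A.a 1 2 = β - A.α := by linear_combination -hβ
  have e21 : A.a 2 1 = β + A.α := by linear_combination -hβ - hb12
  simp only [hs0, hs1, hs2]
    at k010 k011 k012 k020 k021 k022 k120 k121 k122 m00 m01 m02 m11 m12 m21 m22
  simp only [e00, e10, e20, e12, e21]
    at hφ k010 k011 k012 k020 k021 k022 k120 k121 k122 m00 m01 m02 m11 m12 m21 m22 c01 c02 c12 ⊢
  have hφ' : A.normSq = 2 * (A.a 1 1 * A.a 1 1 + A.a 2 2 * A.a 2 2 + A.a 1 1 * A.a 2 2
      + A.a 0 1 * A.a 0 1 + A.a 0 2 * A.a 0 2 + β * β) := by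
    rw [hφ]; ring
  simp only [hφ', derivation_derivation_quadratic]
  simp only [derivation_quadratic]
  clear hφ hφ' hs0 hs1 hs2 hb01 hb02 hb12 e00 e10 e20 e12 e21 hβ hH
  generalize A.a 0 1 = b01 at *
  generalize A.a 0 2 = b02 at *
  generalize A.a 1 1 = b11 at *
  generalize A.a 2 2 = b22 at *
  generalize A.α = α at *
  generalize A.D 0 = D0 at *
  generalize A.D 1 = D1 at *
  generalize A.D 2 = D2 at *
  generalize A.S = S at *
  obtain ⟨A, h0α⟩ : ∃ x, D0 α = x := ⟨_, rfl⟩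
  -- Of the fifteen first derivatives of the five independent components, the Codazzi equations
  -- determine eight; the seven named here parametrize them all.
  obtain ⟨u1, h1b01⟩ : ∃ x, D1 b01 = x := ⟨_, rfl⟩
  obtain ⟨u2, h1b02⟩ : ∃ x, D1 b02 = x := ⟨_, rfl⟩
  obtain ⟨u3, h1b11⟩ : ∃ x, D1 b11 = x := ⟨_, rfl⟩
  obtain ⟨u4, h1b22⟩ : ∃ x, D1 b22 = x := ⟨_, rfl⟩
  obtain ⟨u5, h2b02⟩ : ∃ x, D2 b02 = x := ⟨_, rfl⟩
  obtain ⟨u6, h2b11⟩ : ∃ x, D2 b11 = x := ⟨_, rfl⟩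
  obtain ⟨u7, h2b22⟩ : ∃ x, D2 b22 = x := ⟨_, rfl⟩
  have hn : ∀ (d : Derivation ℝ R R) (k : ℕ), [k.AtLeastTwo] → d (OfNat.ofNat k : R) = 0 :=
    fun d k _ => d.map_natCast k
  -- Since `α` varies only along `e₀`, commuting derivatives on `α` determines the derivatives of
  -- `J(ν)α` along `e₁` and `e₂`.
  have c01α := c01 α
  have c02α := c02 α
  simp only [map_add, map_sub, map_neg, map_zero, Derivation.leibniz,
    smul_eq_mul, hn, h0α, h1α, h2α, h1b01, h1b02, h1b11, h1b22, h2b02, h2b11, h2b22]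
    at k010 k011 k012 k020 k021 k022 k120 k121 k122 m00 m01 m02 m11 m12 m21 m22
      c01α c02α ⊢
  -- This is the trace of `codazzi_S`: as `S H = 0`, an equation for the second derivative of `α`
  -- along `e₀` remains.
  have h0A : D0 A = - 8 * A * α - 6 * α * α * α - 2 * α * b01 * b01 - 2 * α * b02 * b02 - 2 * α *
    b11 * b11 - 2 * α * b11 * b22 - 2 * α * β * β - 2 * α * b22 * b22 := by
    linear_combination (-1) * m00 - m11 - m22
  have h1A : D1 A = - A * b02 := by linear_combination -c01α
  have h2A : D2 A = A * b01 := by linear_combination -c02α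
  have h0b01 : D0 b01 = - u3 - u4 - 3 * α * b01 + 3 * b01 * β - 3 * b02 * b11 := by
    linear_combination k010
  have h2b01 : D2 b01 = 2 * A + u2 + 2 * α * α - b01 * b01 - b02 * b02 - b11 * b11 - 4 * b11 *
    b22 + 2 * β * β - b22 * b22 := by linear_combination -k120
  have hSb01 : S b01 = - 2 * A * b02 - 3 * α * α * b02 - α * b01 * b22 + α * b02 * β := by
    linear_combination m01
  have h0b02 : D0 b02 = - u6 - u7 - 3 * α * b02 + 3 * b01 * b22 - 3 * b02 * β := by
    linear_combination k020
  have hSb02 : S b02 = 2 * A * b01 + 3 * α * α * b01 + α * b01 * β - α * b02 * b11 := by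
    linear_combination m02
  have h0b11 : D0 b11 = u1 - 3 * α * b11 - α * b22 + 3 * b01 * b02 + 3 * b11 * β + 3 * β * b22 :=
    by linear_combination k011
  have hSb11 : S b11 = A * α - 3 * A * β + α * α * α - 6 * α * α * β + α * b01 * b01 + α * b11 *
    b11 + α * β * β := by linear_combination m11
  have h0b22 : D0 b22 = u5 - α * b11 - 3 * α * b22 - 3 * b01 * b02 - 3 * b11 * β - 3 * β * b22 :=
    by linear_combination k022
  have h0b12 : D0 β = A + u2 + α * α - 2 * α * β - 2 * b01 * b01 + b02 * b02 - 2 * b11 * b11 - 2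
    * b11 * b22 + β * β + b22 * b22 := by linear_combination k012
  have h1b12 : D1 β = u6 - α * b02 - 3 * b01 * b22 + 3 * b02 * β := by linear_combination k121
  have h2b12 : D2 β = u4 - α * b01 - 3 * b01 * β + 3 * b02 * b11 := by linear_combination -k122
  -- Adding the equations for `h(e₁, e₂)` and `h(e₂, e₁)` removes the derivative of `α` along `S`,
  -- which is not otherwise needed.
  have hSb12 : 2 * S β = 3 * A * b11 - 3 * A * b22 + 6 * α * α * b11 - 6 * α * α * b22 + 2 * α *
    b01 * b02 + 2 * α * b11 * β + 2 * α * β * b22 := by linear_combination m12 + m21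
  obtain ⟨L01, L02, L11, L22, L12⟩ := laplacian_components D0 D1 D2 S
    h0α h1α h2α h0A h1A h2A h0b01 h1b01 h2b01 hSb01 h0b02 h1b02 h2b02 hSb02 h0b11 h1b11 h2b11
      hSb11 h0b22 h1b22 h2b22 h0b12 h1b12 h2b12 hSb12
    (fun g => (by linear_combination c01 g)) (fun g => by linear_combination c02 g)
    (fun g => (by linear_combination c12 g))
  simp only [h1b01, h1b02, h1b11, h1b22, h2b02, h2b11, h2b22] at L01 L02 L11 L22 L12
  generalize D0 (D0 b01) = w1 at L01 ⊢
  generalize D1 u1 = w2 at L01 ⊢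
  generalize D2 (D2 b01) = w3 at L01 ⊢
  generalize D0 (D0 b02) = w4 at L02 ⊢
  generalize D1 u2 = w5 at L02 ⊢
  generalize D2 u5 = w6 at L02 ⊢
  generalize D0 (D0 b11) = w7 at L11 ⊢
  generalize D1 u3 = w8 at L11 ⊢
  generalize D2 u6 = w9 at L11 ⊢
  generalize D0 (D0 b22) = w10 at L22 ⊢
  generalize D1 u4 = w11 at L22 ⊢
  generalize D2 u7 = w12 at L22 ⊢
  generalize D0 (D0 β) = w13 at L12 ⊢
  generalize D1 (D1 β) = w14 at L12 ⊢
  generalize D2 (D2 β) = w15 at L12 ⊢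
  simp only [h0b01, h2b01, h0b02, h0b11, h0b22, h0b12, h1b12, h2b12]
  -- The multipliers are the partial derivatives of `|h̃|²` with respect to the five independent
  -- components.
  linear_combination 2 * (2 * b11 + b22) * L11 + 2 * (2 * b22 + b11) * L22 + 4 * b01 * L01
    + 4 * b02 * L02 + 4 * β * L12
end AdaptedFrame

end

section

/-! ### The ring of smooth functions on an open set -/

section SmoothFunctions

variable {n : ℕ} {M : Type*} [TopologicalSpace M] [ChartedSpace (EuclideanSpace ℝ (Fin (2 * n))) M]

variable (n) in
/-- The algebra of functions on `U` with a smooth extension. -/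
def smoothFunctions (U : Set M) : Subalgebra ℝ (U → ℝ) where
  carrier := {g | ∃ G : M → ℝ, ContMDiffOn (𝓡 (2 * n)) 𝓘(ℝ, ℝ) ∞ G U ∧ ∀ p : U, G p = g p}
  mul_mem' := by
    rintro a b ⟨A, hA, hA'⟩ ⟨B, hB, hB'⟩
    exact ⟨fun p => A p * B p, hA.mul hB, fun p => by simp [hA', hB']⟩
  add_mem' := by
    rintro a b ⟨A, hA, hA'⟩ ⟨B, hB, hB'⟩
    exact ⟨fun p => A p + B p, hA.add hB, fun p => by simp [hA', hB']⟩
  algebraMap_mem' := fun r => ⟨fun _ => r, contMDiffOn_const, fun p => rfl⟩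

namespace smoothFunctions

variable {U : Set M}

/-- A smooth extension. -/
noncomputable def extension (g : smoothFunctions n U) : M → ℝ := g.2.choose

theorem contMDiffOn_extension (g : smoothFunctions n U) :
    ContMDiffOn (𝓡 (2 * n)) 𝓘(ℝ, ℝ) ∞ (extension g) U := g.2.choose_spec.1

theorem extension_apply (g : smoothFunctions n U) (p : U) : extension g p = g.1 p :=
  g.2.choose_spec.2 p

/-- The restriction of a smooth function to `U`. -/
def mk (G : M → ℝ) (hG : ContMDiffOn (𝓡 (2 * n)) 𝓘(ℝ, ℝ) ∞ G U) : smoothFunctions n U :=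
  ⟨fun p => G p, G, hG, fun _ => rfl⟩

@[simp] theorem mk_apply (G : M → ℝ) (hG : ContMDiffOn (𝓡 (2 * n)) 𝓘(ℝ, ℝ) ∞ G U) (p : U) :
    (mk G hG).1 p = G p := rfl

/-- As `U` is open, derivatives at its points do not depend on the extension beyond `U`; this makes
the derivation below independent of the choice in `extension`. -/
theorem Dv_eq_Dv {f : M → Heis n} (hU : IsOpen U) {G G' : M → ℝ} (h : ∀ p : U, G p = G' p)
    {p : M} (hp : p ∈ U) (V : Hor n × ℝ) : Dv f G p V = Dv f G' p V := by
  refine Dv_congr f ?_ V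
  filter_upwards [hU.mem_nhds hp] with x hx using h ⟨x, hx⟩

variable [IsManifold (𝓡 (2 * n)) ∞ M] {f : M → Heis n} {N : M → Hor n × ℝ}

/-- The derivation of the algebra of smooth functions given by a smooth tangent field. -/
noncomputable def derivation (hf : IsImmersion f) (hU : IsOpen U) (hN : IsUnitNormalOn f N U)
    {V : M → Hor n × ℝ} (hV : ContMDiffOn (𝓡 (2 * n)) 𝓘(ℝ, Hor n × ℝ) ∞ V U)
    (hVt : ∀ p ∈ U, V p ∈ frameTangent f p) :
    Derivation ℝ (smoothFunctions n U) (smoothFunctions n U) :=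
  have hd : ∀ (g : smoothFunctions n U) (p : U),
      MDifferentiableAt (𝓡 (2 * n)) 𝓘(ℝ, ℝ) (extension g) p := fun g p =>
    ((contMDiffOn_extension g).mdifferentiableOn (by simp) p p.2).mdifferentiableAt
      (hU.mem_nhds p.2)
  Derivation.mk'
    { toFun := fun g => mk (fun p => Dv f (extension g) p (V p))
        (contMDiffOn_Dv hf hU hN hV hVt (contMDiffOn_extension g))
      map_add' := fun g g' => by
        refine Subtype.ext (funext fun p => ?_)
        have h := Dv_fun_add f (hd g p) (hd g' p) (V p)
        rw [Dv_eq_Dv hU (G' := extension (g + g')) (fun q => by simp [extension_apply]) p.2] at h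
        exact h
      map_smul' := fun c g => by
        refine Subtype.ext (funext fun p => ?_)
        have h := Dv_fun_smul f (g := fun _ => c) mdifferentiableAt_const (hd g p) (V p)
        rw [Dv_eq_Dv hU (G' := extension (c • g)) (fun q => by simp [extension_apply]) p.2,
          Dv_const, zero_smul, add_zero] at h
        exact h }
    (fun g g' => by
      refine Subtype.ext (funext fun p => ?_)
      have h := Dv_fun_smul f (hd g p) (hd g' p) (V p)
      rw [Dv_eq_Dv hU (G' := extension (g * g')) (fun q => by simp [extension_apply]) p.2] at h
      simp only [smul_eq_mul] at h
      refine h.trans ?_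
      rw [extension_apply, extension_apply, mul_comm (Dv f (extension g) p (V p))]
      rfl)

theorem derivation_apply (hf : IsImmersion f) (hU : IsOpen U) (hN : IsUnitNormalOn f N U)
    {V : M → Hor n × ℝ} (hV : ContMDiffOn (𝓡 (2 * n)) 𝓘(ℝ, Hor n × ℝ) ∞ V U)
    (hVt : ∀ p ∈ U, V p ∈ frameTangent f p) (g : smoothFunctions n U) {G : M → ℝ}
    (hG : ∀ p : U, G p = g.1 p) (p : U) :
    (derivation hf hU hN hV hVt g).1 p = Dv f G p (V p) :=
  Dv_eq_Dv hU (fun q => by rw [extension_apply, hG]) p.2 (V p)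

end smoothFunctions

end SmoothFunctions

/-! ### The frame of a hypersurface in `ℍ²` -/

section Frame

/-- The complex structures as continuous linear maps. -/
noncomputable def quatL (k : Fin 3) : Hor 2 →L[ℝ] Hor 2 :=
  LinearMap.toContinuousLinearMap
    { toFun := fun v => WithLp.toLp 2 (quat k v.ofLp)
      map_add' := fun v w => by
        ext c
        rcases c with c | c <;> fin_cases k <;> fin_cases c <;> simp [quat] <;> ring
      map_smul' := fun r v => by
        ext c
        rcases c with c | c <;> fin_cases k <;> fin_cases c <;> simp [quat] }

theorem quatL_apply (k : Fin 3) (v : Hor 2) (c : Fin 2 ⊕ Fin 2) :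
    quatL k v c = quat k v.ofLp c := rfl

theorem ofLp_quatL (k : Fin 3) (v : Hor 2) : (quatL k v).ofLp = quat k v.ofLp := rfl

theorem J_eq_quatL (v : Hor 2) : J v = quatL 0 v := by
  ext c
  rcases c with c | c <;> fin_cases c <;> simp [quatL_apply, quat, J]

theorem inner_eq_dot (v w : Hor 2) : inner ℝ v w = dot v.ofLp w.ofLp := by
  simp only [PiLp.inner_apply, dot]
  exact Finset.sum_congr rfl fun c _ => by simp [mul_comm]

variable {M : Type*}

/-- The frame `Jν, e₁, e₂` of the horizontal tangent bundle. -/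
noncomputable def frameE (N : M → Hor 2 × ℝ) (k : Fin 3) (p : M) : Hor 2 := quatL k (nu N p)

/-- The field `S = T - αν`. -/
noncomputable def fieldS (N : M → Hor 2 × ℝ) (p : M) : Hor 2 × ℝ := (-(alpha N p • nu N p), 1)

theorem frameE_zero (N : M → Hor 2 × ℝ) (p : M) : frameE N 0 p = Jnu N p :=
  (J_eq_quatL _).symm

theorem dot_nu_self {N : M → Hor 2 × ℝ} {p : M} (h : (N p).1 ≠ 0) :
    dot (nu N p).ofLp (nu N p).ofLp = 1 := by
  rw [← inner_eq_dot, real_inner_self_eq_norm_sq, norm_nu h, one_pow]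

theorem inner_frameE {N : M → Hor 2 × ℝ} {p : M} (h : (N p).1 ≠ 0) (i j : Fin 3) :
    inner ℝ (frameE N i p) (frameE N j p) = if i = j then (1 : ℝ) else 0 := by
  rw [inner_eq_dot, frameE, frameE, ofLp_quatL, ofLp_quatL, dot_quat_quat_self, dot_nu_self h]

theorem inner_nu_frameE (N : M → Hor 2 × ℝ) (p : M) (i : Fin 3) :
    inner ℝ (nu N p) (frameE N i p) = (0 : ℝ) := by
  rw [inner_eq_dot, frameE, ofLp_quatL, dot_comm, dot_quat_self]

theorem eq_sum_frameE {N : M → Hor 2 × ℝ} {p : M} (h : (N p).1 ≠ 0) (w : Hor 2) :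
    w = (inner ℝ (nu N p) w : ℝ) • nu N p
      + ∑ k, (inner ℝ w (frameE N k p) : ℝ) • frameE N k p := by
  ext c
  have h1 := dot_self_smul_eq (nu N p).ofLp w.ofLp c
  rw [dot_nu_self h, one_mul] at h1
  rw [real_inner_comm]
  simp only [inner_eq_dot, frameE, ofLp_quatL, PiLp.add_apply, PiLp.smul_apply, smul_eq_mul,
    WithLp.ofLp_sum, Finset.sum_apply, WithLp.ofLp_smul, Pi.smul_apply]
  exact h1

end Frame

end

section

/-! ### The adapted frame of a hypersurface -/

section AdaptedFrame

variable {M : Type*} [TopologicalSpace M] [ChartedSpace (EuclideanSpace ℝ (Fin (2 * 2))) M]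
variable {f : M → Heis 2} {N : M → Hor 2 × ℝ} {U : Set M}

theorem frameE_mem {p : M} (hf : Function.Injective (diff 2 f p)) (hN : IsUnitNormalOn f N U)
    (hp : p ∈ U) (h : (N p).1 ≠ 0) (k : Fin 3) : (frameE N k p, (0 : ℝ)) ∈ frameTangent f p := by
  rw [mem_frameTangent_iff hf hN hp h]
  simp [inner_nu_frameE]

theorem fieldS_mem {p : M} (hf : Function.Injective (diff 2 f p)) (hN : IsUnitNormalOn f N U)
    (hp : p ∈ U) (h : (N p).1 ≠ 0) : fieldS N p ∈ frameTangent f p := by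
  rw [mem_frameTangent_iff hf hN hp h]
  simp [fieldS, inner_smul_right, norm_nu h]

/-- The coefficient of `S` is the `T`-component of `B`; the tangency equation then makes the
`ν`-components agree. -/
theorem Dv_eq_sum {F : Type*} [NormedAddCommGroup F] [NormedSpace ℝ F] {p : M}
    (hf : Function.Injective (diff 2 f p)) (hN : IsUnitNormalOn f N U)
    (hp : p ∈ U) (h : (N p).1 ≠ 0) (G : M → F) {B : Hor 2 × ℝ} (hB : B ∈ frameTangent f p) :
    Dv f G p B = ∑ k, (inner ℝ B.1 (frameE N k p) : ℝ) • Dv f G p (frameE N k p, 0)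
      + B.2 • Dv f G p (fieldS N p) := by
  have hdec : B = ∑ k, (inner ℝ B.1 (frameE N k p) : ℝ) • ((frameE N k p, (0 : ℝ)) : Hor 2 × ℝ)
      + B.2 • fieldS N p := by
    have h1 := (mem_frameTangent_iff hf hN hp h).1 hB
    have h2 := eq_sum_frameE h B.1
    have h3 : (inner ℝ (nu N p) B.1 : ℝ) = -(alpha N p * B.2) := by linarith
    refine Prod.ext ?_ ?_
    · rw [h3] at h2
      conv_lhs => rw [h2]
      simp only [Prod.fst_add, Prod.fst_sum, Prod.smul_fst, fieldS, smul_neg, smul_smul]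
      rw [add_comm, neg_smul, mul_comm]
    · simp [fieldS, Prod.snd_sum]
  have hmem : ∀ k, (inner ℝ B.1 (frameE N k p) : ℝ) • ((frameE N k p, (0 : ℝ)) : Hor 2 × ℝ)
      ∈ frameTangent f p := fun k => Submodule.smul_mem _ _ (frameE_mem hf hN hp h k)
  conv_lhs => rw [hdec]
  rw [Dv_add hf G (Submodule.sum_mem _ fun k _ => hmem k)
    (Submodule.smul_mem _ _ (fieldS_mem hf hN hp h)), Dv_sum hf G _ _ hmem,
    Dv_smul hf G _ (fieldS_mem hf hN hp h)]
  congr 1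
  exact Finset.sum_congr rfl fun k _ => Dv_smul hf G _ (frameE_mem hf hN hp h k)

variable [IsManifold (𝓡 (2 * 2)) ∞ M]

theorem contMDiffOn_frameE (hN : IsUnitNormalOn f N U) (h : ∀ p ∈ U, (N p).1 ≠ 0) (k : Fin 3) :
    ContMDiffOn (𝓡 (2 * 2)) 𝓘(ℝ, Hor 2) ∞ (frameE N k) U :=
  (quatL k).contDiff.contMDiff.comp_contMDiffOn (contMDiffOn_nu hN h)

theorem contMDiffOn_frameE_zero (hN : IsUnitNormalOn f N U) (h : ∀ p ∈ U, (N p).1 ≠ 0)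
    (k : Fin 3) :
    ContMDiffOn (𝓡 (2 * 2)) 𝓘(ℝ, Hor 2 × ℝ) ∞ (fun p => (frameE N k p, (0 : ℝ))) U :=
  (contMDiffOn_frameE hN h k).prodMk_space contMDiffOn_const

theorem contMDiffOn_fieldS (hN : IsUnitNormalOn f N U) (h : ∀ p ∈ U, (N p).1 ≠ 0) :
    ContMDiffOn (𝓡 (2 * 2)) 𝓘(ℝ, Hor 2 × ℝ) ∞ (fieldS N) U :=
  (((contMDiffOn_alpha hN h).smul (contMDiffOn_nu hN h)).neg).prodMk_space contMDiffOn_const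

theorem contMDiffOn_component {G : M → Hor 2} (hG : ContMDiffOn (𝓡 (2 * 2)) 𝓘(ℝ, Hor 2) ∞ G U)
    (c : Fin 2 ⊕ Fin 2) : ContMDiffOn (𝓡 (2 * 2)) 𝓘(ℝ, ℝ) ∞ (fun p => G p c) U :=
  (EuclideanSpace.proj c : Hor 2 →L[ℝ] ℝ).contDiff.contMDiff.comp_contMDiffOn hG

theorem Dv_component {G : M → Hor 2} {p : M}
    (hG : MDifferentiableAt (𝓡 (2 * 2)) 𝓘(ℝ, Hor 2) G p) (V : Hor 2 × ℝ) (c : Fin 2 ⊕ Fin 2) :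
    Dv f G p V c = Dv f (fun x => G x c) p V :=
  (Dv_clm f (EuclideanSpace.proj c : Hor 2 →L[ℝ] ℝ) hG V).symm

theorem coe_dot (v w : Fin 2 ⊕ Fin 2 → smoothFunctions 2 U) (p : U) :
    (dot v w).1 p = dot (fun c => (v c).1 p) (fun c => (w c).1 p) := by
  simp [dot_eq]

theorem coe_sum (v : Fin 3 → smoothFunctions 2 U) (p : U) :
    (∑ k, v k).1 p = ∑ k, (v k).1 p := by
  simp [Fin.sum_univ_three]

theorem coe_quat (k : Fin 3) (v : Fin 2 ⊕ Fin 2 → smoothFunctions 2 U) (c : Fin 2 ⊕ Fin 2)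
    (p : U) : (quat k v c).1 p = quat k (fun c => (v c).1 p) c := by
  rcases c with c | c <;> fin_cases k <;> fin_cases c <;> simp [quat]

/-- The adapted frame of a non-characteristic hypersurface in `ℍ²`. -/
noncomputable def adaptedFrame (hf : IsImmersion f) (hU : IsOpen U) (hN : IsUnitNormalOn f N U)
    (h : ∀ p ∈ U, (N p).1 ≠ 0) : AdaptedFrame (smoothFunctions 2 U) :=
  let n : Fin 2 ⊕ Fin 2 → smoothFunctions 2 U := fun c =>
    smoothFunctions.mk (fun p => nu N p c) (contMDiffOn_component (contMDiffOn_nu hN h) c)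
  let α : smoothFunctions 2 U := smoothFunctions.mk (alpha N) (contMDiffOn_alpha hN h)
  let D : Fin 3 → Derivation ℝ (smoothFunctions 2 U) (smoothFunctions 2 U) := fun k =>
    smoothFunctions.derivation hf hU hN (contMDiffOn_frameE_zero hN h k)
      (fun p hp => frameE_mem (hf.2 p) hN hp (h p hp) k)
  let S : Derivation ℝ (smoothFunctions 2 U) (smoothFunctions 2 U) :=
    smoothFunctions.derivation hf hU hN (contMDiffOn_fieldS hN h)
      (fun p hp => fieldS_mem (hf.2 p) hN hp (h p hp))
  have hD : ∀ k (g : smoothFunctions 2 U) (G : M → ℝ), (∀ p : U, G p = g.1 p) → ∀ p : U,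
      (D k g).1 p = Dv f G p (frameE N k p, 0) := fun k g G hG p =>
    smoothFunctions.derivation_apply hf hU hN (contMDiffOn_frameE_zero hN h k) _ g hG p
  have hS : ∀ (g : smoothFunctions 2 U) (G : M → ℝ), (∀ p : U, G p = g.1 p) → ∀ p : U,
      (S g).1 p = Dv f G p (fieldS N p) := fun g G hG p =>
    smoothFunctions.derivation_apply hf hU hN (contMDiffOn_fieldS hN h) _ g hG p
  have hq : ∀ k c (p : U), (quat k n c).1 p = frameE N k p c := fun k c p => by
    rw [coe_quat]; rfl
  have hEd : ∀ k (p : U), MDifferentiableAt (𝓡 (2 * 2)) 𝓘(ℝ, Hor 2) (frameE N k) p := fun k p =>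
    ((contMDiffOn_frameE hN h k).mdifferentiableOn (by simp) p p.2).mdifferentiableAt
      (hU.mem_nhds p.2)
  have hαν : ContMDiffOn (𝓡 (2 * 2)) 𝓘(ℝ, Hor 2) ∞ (fun p => -(alpha N p • nu N p)) U :=
    ((contMDiffOn_alpha hN h).smul (contMDiffOn_nu hN h)).neg
  have hανd : ∀ p : U, MDifferentiableAt (𝓡 (2 * 2)) 𝓘(ℝ, Hor 2)
      (fun p => -(alpha N p • nu N p)) p := fun p =>
    (hαν.mdifferentiableOn (by simp) p p.2).mdifferentiableAt (hU.mem_nhds p.2)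
  have hDE : ∀ i j c (p : U), Dv f (frameE N j) p (frameE N i p, 0) c = (D i (quat j n c)).1 p :=
    fun i j c p => by
      rw [Dv_component (hEd j p), hD i _ (fun q => frameE N j q c) (fun q => (hq j c q).symm)]
  have hSE : ∀ j c (p : U), Dv f (frameE N j) p (fieldS N p) c = (S (quat j n c)).1 p :=
    fun j c p => by
      rw [Dv_component (hEd j p), hS _ (fun q => frameE N j q c) (fun q => (hq j c q).symm)]
  have hDα : ∀ i c (p : U), Dv f (fun p => -(alpha N p • nu N p)) p (frameE N i p, 0) c
      = -(D i (α * n c)).1 p := fun i c p => by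
    rw [Dv_component (hανd p), ← hD i (-(α * n c)) _ (fun q => rfl), map_neg]
    rfl
  -- The frame fields are horizontal, so the `T`-component of their bracket is entirely torsion.
  have hbr : ∀ i j (p : U), Dv f (fun p => (frameE N j p, (0 : ℝ))) p (frameE N i p, 0)
      - Dv f (fun p => (frameE N i p, (0 : ℝ))) p (frameE N j p, 0)
      - (0, 2 * inner ℝ (J (frameE N i p)) (frameE N j p))
      = (Dv f (frameE N j) p (frameE N i p, 0) - Dv f (frameE N i) p (frameE N j p, 0),
        -(2 * inner ℝ (J (frameE N i p)) (frameE N j p))) := fun i j p => by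
    rw [Dv_prodMk f (hEd j p) mdifferentiableAt_const,
      Dv_prodMk f (hEd i p) mdifferentiableAt_const,
      Dv_const, Dv_const]
    simp
  -- The `T`-coefficient of `S` is the constant `1`, hence again only torsion contributes, now
  -- through `J(-αν) = -αe₀`.
  have hbrS : ∀ i (p : U), Dv f (fun p => (frameE N i p, (0 : ℝ))) p (fieldS N p)
      - Dv f (fieldS N) p (frameE N i p, 0)
      - (0, 2 * inner ℝ (J (fieldS N p).1) (frameE N i p))
      = (Dv f (frameE N i) p (fieldS N p)
          - Dv f (fun p => -(alpha N p • nu N p)) p (frameE N i p, 0),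
        2 * alpha N p * inner ℝ (frameE N 0 p) (frameE N i p)) := fun i p => by
    have e : J (-(alpha N p • nu N p)) = -(alpha N p • frameE N 0 p) := by
      rw [J_eq_quatL, map_neg, map_smul]; rfl
    rw [show Dv f (fieldS N) p (frameE N i p, 0)
      = (Dv f (fun p => -(alpha N p • nu N p)) p (frameE N i p, 0), 0) by
        exact (Dv_prodMk f (hανd p) mdifferentiableAt_const _).trans (by rw [Dv_const]),
      Dv_prodMk f (hEd i p) mdifferentiableAt_const, Dv_const]
    simp only [fieldS, e, inner_neg_left, real_inner_smul_left, Prod.mk_sub_mk, sub_zero, zero_sub]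
    refine Prod.ext rfl ?_
    simp only
    ring
  have hJ : ∀ i j (p : U), inner ℝ (J (frameE N i p)) (frameE N j p)
      = (dot (quat 0 (quat i n)) (quat j n)).1 p := fun i j p => by
    rw [J_eq_quatL, inner_eq_dot, coe_dot, ofLp_quatL]
    simp only [hq, coe_quat]
  have h0 : ∀ i (p : U), inner ℝ (frameE N 0 p) (frameE N i p)
      = (dot (quat 0 n) (quat i n)).1 p := fun i p => by
    rw [inner_eq_dot, coe_dot]
    simp only [hq]
  { n := n
    α := α
    D := D
    S := S
    unit := by
      refine Subtype.ext (funext fun p => ?_)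
      rw [coe_dot]
      exact dot_nu_self (h p p.2)
    tangent_bracket := fun i j => by
      refine Subtype.ext (funext fun p => ?_)
      have h1 := (Dv_commutator (F := ℝ) hf hU hN (contMDiffOn_frameE_zero hN h i)
        (fun p hp => frameE_mem (hf.2 p) hN hp (h p hp) i) (contMDiffOn_frameE_zero hN h j)
        (fun p hp => frameE_mem (hf.2 p) hN hp (h p hp) j) p.2).1
      rw [hbr, mem_frameTangent_iff (hf.2 p) hN p.2 (h p p.2), real_inner_comm, inner_eq_dot] at h1
      have h2 : (dot (fun c => D i (quat j n c) - D j (quat i n c)) n).1 p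
          = dot (Dv f (frameE N j) p (frameE N i p, 0)
            - Dv f (frameE N i) p (frameE N j p, 0)).ofLp (nu N p).ofLp := by
        rw [coe_dot]
        simp only [WithLp.ofLp_sub, dot, Pi.sub_apply, hDE]
        rfl
      rw [h2]
      change _ = 2 * alpha N p * (dot (quat 0 (quat i n)) (quat j n)).1 p
      rw [← hJ]
      linear_combination h1
    bracket := fun i j g => by
      refine Subtype.ext (funext fun p => ?_)
      obtain ⟨h1, h2⟩ := Dv_commutator (F := ℝ) hf hU hN (contMDiffOn_frameE_zero hN h i)
        (fun p hp => frameE_mem (hf.2 p) hN hp (h p hp) i) (contMDiffOn_frameE_zero hN h j)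
        (fun p hp => frameE_mem (hf.2 p) hN hp (h p hp) j) p.2
      have h3 := h2 (smoothFunctions.contMDiffOn_extension g)
      have hg := smoothFunctions.extension_apply g
      rw [Dv_eq_sum (hf.2 p) hN p.2 (h p p.2) _ h1, hbr,
        ← hD i (D j g) _ (fun q => (hD j g _ hg q).symm),
        ← hD j (D i g) _ (fun q => (hD i g _ hg q).symm), ← hS g _ hg] at h3
      refine h3.trans ?_
      rw [show ∀ a b : smoothFunctions 2 U, (a - b).1 p = a.1 p + -b.1 p from
        fun a b => sub_eq_add_neg _ _, coe_sum]
      simp only [Subalgebra.coe_mul, Pi.mul_apply, smul_eq_mul]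
      congr 1
      · refine Finset.sum_congr rfl fun k _ => ?_
        rw [← hD k g _ hg]
        congr 1
        rw [inner_eq_dot, coe_dot]
        simp only [WithLp.ofLp_sub, dot, Pi.sub_apply, hDE, hq]
        rfl
      · rw [hJ, neg_mul]
        rfl
    tangent_bracket_S := fun i => by
      refine Subtype.ext (funext fun p => ?_)
      have h1 := (Dv_commutator (F := ℝ) hf hU hN (contMDiffOn_fieldS hN h)
        (fun p hp => fieldS_mem (hf.2 p) hN hp (h p hp)) (contMDiffOn_frameE_zero hN h i)
        (fun p hp => frameE_mem (hf.2 p) hN hp (h p hp) i) p.2).1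
      rw [hbrS, mem_frameTangent_iff (hf.2 p) hN p.2 (h p p.2), real_inner_comm, inner_eq_dot] at h1
      have h2 : (dot (fun c => S (quat i n c) + D i (α * n c)) n).1 p
          = dot (Dv f (frameE N i) p (fieldS N p)
            - Dv f (fun p => -(alpha N p • nu N p)) p (frameE N i p, 0)).ofLp (nu N p).ofLp := by
        rw [coe_dot]
        simp only [WithLp.ofLp_sub, dot, Pi.sub_apply, hSE, hDα, sub_neg_eq_add]
        rfl
      rw [h2]
      change _ = -2 * alpha N p ^ 2 * (dot (quat 0 n) (quat i n)).1 p
      rw [← h0]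
      linear_combination h1
    bracket_S := fun i g => by
      refine Subtype.ext (funext fun p => ?_)
      obtain ⟨h1, h2⟩ := Dv_commutator (F := ℝ) hf hU hN (contMDiffOn_fieldS hN h)
        (fun p hp => fieldS_mem (hf.2 p) hN hp (h p hp)) (contMDiffOn_frameE_zero hN h i)
        (fun p hp => frameE_mem (hf.2 p) hN hp (h p hp) i) p.2
      have h3 := h2 (smoothFunctions.contMDiffOn_extension g)
      have hg := smoothFunctions.extension_apply g
      rw [Dv_eq_sum (hf.2 p) hN p.2 (h p p.2) _ h1, hbrS,
        ← hS (D i g) _ (fun q => (hD i g _ hg q).symm),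
        ← hD i (S g) _ (fun q => (hS g _ hg q).symm), ← hS g _ hg] at h3
      refine h3.trans ?_
      rw [show ∀ a b : smoothFunctions 2 U, (a + b).1 p = a.1 p + b.1 p from
        fun a b => rfl, coe_sum]
      simp only [Subalgebra.coe_mul, Pi.mul_apply, smul_eq_mul]
      congr 1
      · refine Finset.sum_congr rfl fun k _ => ?_
        rw [← hD k g _ hg]
        congr 1
        rw [inner_eq_dot, coe_dot]
        simp only [WithLp.ofLp_sub, dot, Pi.sub_apply, hSE, hDα, hq, sub_neg_eq_add]
        rfl
      · rw [h0]
        rfl }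

end AdaptedFrame

end

section

/-! ### Tensors and norms in the adapted frame -/

section Translation

variable {M : Type*} [TopologicalSpace M] [ChartedSpace (EuclideanSpace ℝ (Fin (2 * 2))) M]
  [IsManifold (𝓡 (2 * 2)) ∞ M]
variable {f : M → Heis 2} {N : M → Hor 2 × ℝ} {U : Set M}
variable (hf : IsImmersion f) (hU : IsOpen U) (hN : IsUnitNormalOn f N U)
  (h : ∀ p ∈ U, (N p).1 ≠ 0)

theorem frameE_mem_horTangent {p : M} (hf : IsImmersion f) (hN : IsUnitNormalOn f N U)
    (h : ∀ p ∈ U, (N p).1 ≠ 0) (hp : p ∈ U) (k : Fin 3) : frameE N k p ∈ horTangent f p :=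
  mem_horTangent_iff.2 (frameE_mem (hf.2 p) hN hp (h p hp) k)

theorem adaptedFrame_D_apply (k : Fin 3) (g : smoothFunctions 2 U) {G : M → ℝ}
    (hG : ∀ p : U, G p = g.1 p) (p : U) :
    ((adaptedFrame hf hU hN h).D k g).1 p = D f G p (frameE N k p) :=
  smoothFunctions.derivation_apply hf hU hN (contMDiffOn_frameE_zero hN h k)
    (fun p hp => frameE_mem (hf.2 p) hN hp (h p hp) k) g hG p

theorem adaptedFrame_n_apply (c : Fin 2 ⊕ Fin 2) (p : U) :
    ((adaptedFrame hf hU hN h).n c).1 p = nu N p c := rfl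

theorem adaptedFrame_quat_apply (k : Fin 3) (c : Fin 2 ⊕ Fin 2) (p : U) :
    (quat k (adaptedFrame hf hU hN h).n c).1 p = frameE N k p c := by
  rw [coe_quat]; rfl

theorem D_eq_sum {F : Type*} [NormedAddCommGroup F] [NormedSpace ℝ F] {p : M}
    (hf : IsImmersion f) (hN : IsUnitNormalOn f N U) (h : ∀ p ∈ U, (N p).1 ≠ 0) (hp : p ∈ U)
    (G : M → F) {w : Hor 2} (hw : w ∈ horTangent f p) :
    D f G p w = ∑ k, (inner ℝ w (frameE N k p) : ℝ) • D f G p (frameE N k p) := by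
  have h1 := Dv_eq_sum (hf.2 p) hN hp (h p hp) G (mem_horTangent_iff.1 hw)
  simpa [D_eq_Dv] using h1

theorem D_eq_sum_adaptedFrame (g : smoothFunctions 2 U) {G : M → ℝ}
    (hG : ∀ p : U, G p = g.1 p) (p : U) {w : Hor 2} (hw : w ∈ horTangent f p) :
    D f G p w = ∑ k, inner ℝ w (frameE N k p) * ((adaptedFrame hf hU hN h).D k g).1 p := by
  rw [D_eq_sum hf hN h p.2 G hw]
  exact Finset.sum_congr rfl fun k _ => by
    rw [adaptedFrame_D_apply hf hU hN h k g hG, smul_eq_mul]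

theorem inner_D_nu (i j : Fin 3) (p : U) :
    inner ℝ (D f (nu N) p (frameE N i p)) (frameE N j p)
      = ((adaptedFrame hf hU hN h).a i j).1 p := by
  have hd : MDifferentiableAt (𝓡 (2 * 2)) 𝓘(ℝ, Hor 2) (nu N) p :=
    ((contMDiffOn_nu hN h).mdifferentiableOn (by simp) p p.2).mdifferentiableAt (hU.mem_nhds p.2)
  rw [AdaptedFrame.a, coe_dot, inner_eq_dot]
  simp only [dot, adaptedFrame_quat_apply]
  refine Finset.sum_congr rfl fun c _ => ?_
  rw [D_eq_Dv, Dv_component hd, adaptedFrame_D_apply hf hU hN h i _ (G := fun x => nu N x c)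
    (fun q => rfl)]
  rfl

theorem inner_nu_D_nu (hf : IsImmersion f) (hU : IsOpen U) (hN : IsUnitNormalOn f N U)
    (h : ∀ p ∈ U, (N p).1 ≠ 0) (i : Fin 3) (p : U) :
    inner ℝ (nu N p) (D f (nu N) p (frameE N i p)) = (0 : ℝ) := by
  have hd : MDifferentiableAt (𝓡 (2 * 2)) 𝓘(ℝ, Hor 2) (nu N) p :=
    ((contMDiffOn_nu hN h).mdifferentiableOn (by simp) p p.2).mdifferentiableAt (hU.mem_nhds p.2)
  have h1 := congrArg (fun g : smoothFunctions 2 U => g.1 p)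
    ((adaptedFrame hf hU hN h).dot_derivation_n ((adaptedFrame hf hU hN h).D i))
  simp only [coe_dot, adaptedFrame_n_apply] at h1
  rw [real_inner_comm, inner_eq_dot]
  refine Eq.trans ?_ h1
  refine Finset.sum_congr rfl fun c _ => ?_
  beta_reduce
  rw [D_eq_Dv, Dv_component hd, adaptedFrame_D_apply hf hU hN h i _ (G := fun x => nu N x c)
    (fun q => rfl)]
  rfl

theorem D_nu_frameE (i : Fin 3) (p : U) : D f (nu N) p (frameE N i p)
    = ∑ j, ((adaptedFrame hf hU hN h).a i j).1 p • frameE N j p := by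
  have h1 := eq_sum_frameE (h p p.2) (D f (nu N) p (frameE N i p))
  rw [inner_nu_D_nu hf hU hN h, zero_smul, zero_add] at h1
  conv_lhs => rw [h1]
  simp only [inner_D_nu hf hU hN h]

theorem inner_nu_of_mem {p : M} (hf : IsImmersion f) (hN : IsUnitNormalOn f N U)
    (h : ∀ p ∈ U, (N p).1 ≠ 0) (hp : p ∈ U) {w : Hor 2} (hw : w ∈ horTangent f p) :
    inner ℝ (nu N p) w = (0 : ℝ) := (mem_horTangent_iff_inner (hf.2 p) hN hp (h p hp)).1 hw

theorem eq_sum_of_mem {p : M} (hf : IsImmersion f) (hN : IsUnitNormalOn f N U)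
    (h : ∀ p ∈ U, (N p).1 ≠ 0) (hp : p ∈ U) {w : Hor 2} (hw : w ∈ horTangent f p) :
    w = ∑ k, (inner ℝ w (frameE N k p) : ℝ) • frameE N k p := by
  have h1 := eq_sum_frameE (h p hp) w
  rwa [inner_nu_of_mem hf hN h hp hw, zero_smul, zero_add] at h1

theorem proj_mem {p : M} (hf : IsImmersion f) (hN : IsUnitNormalOn f N U)
    (h : ∀ p ∈ U, (N p).1 ≠ 0) (hp : p ∈ U) (w : Hor 2) : proj N p w ∈ horTangent f p := by
  rw [mem_horTangent_iff_inner (hf.2 p) hN hp (h p hp), proj, inner_sub_right, inner_smul_right,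
    real_inner_self_eq_norm_sq, norm_nu (h p hp), real_inner_comm]
  ring

theorem inner_proj_frameE (N : M → Hor 2 × ℝ) (p : M) (w : Hor 2) (k : Fin 3) :
    inner ℝ (proj N p w) (frameE N k p) = inner ℝ w (frameE N k p) := by
  rw [proj, inner_sub_left, real_inner_smul_left, inner_nu_frameE, mul_zero, sub_zero]

theorem inner_J_frameE {p : M} (hf : IsImmersion f) (hN : IsUnitNormalOn f N U)
    (h : ∀ p ∈ U, (N p).1 ≠ 0) (hp : p ∈ U) {w : Hor 2} (hw : w ∈ horTangent f p) (j : Fin 3) :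
    inner ℝ (J w) (frameE N j p) = ∑ i, inner ℝ w (frameE N i p) * (eps 0 i j : ℝ) := by
  have h1 := eq_sum_of_mem hf hN h hp hw
  conv_lhs => rw [h1]
  rw [J_eq_quatL, map_sum, sum_inner]
  refine Finset.sum_congr rfl fun i _ => ?_
  rw [map_smul, real_inner_smul_left]
  congr 1
  rw [inner_eq_dot, frameE, frameE, ofLp_quatL, ofLp_quatL,
    ofLp_quatL, dot_quat_zero_quat, dot_nu_self (h p hp), mul_one]

/-- `J` and `J'` differ by a multiple of `J(Jν) = -ν`, which is orthogonal to the frame. -/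
theorem inner_J'_frameE {p : M} (hf : IsImmersion f) (hN : IsUnitNormalOn f N U)
    (h : ∀ p ∈ U, (N p).1 ≠ 0) (hp : p ∈ U) {w : Hor 2} (hw : w ∈ horTangent f p) (j : Fin 3) :
    inner ℝ (J' N p w) (frameE N j p) = ∑ i, inner ℝ w (frameE N i p) * (eps 0 i j : ℝ) := by
  have hmem : w - (inner ℝ w (Jnu N p) : ℝ) • Jnu N p ∈ horTangent f p := by
    rw [← frameE_zero]
    exact Submodule.sub_mem _ hw (Submodule.smul_mem _ _ (frameE_mem_horTangent hf hN h hp 0))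
  rw [J', inner_J_frameE hf hN h hp hmem]
  refine Finset.sum_congr rfl fun i _ => ?_
  rw [← frameE_zero, inner_sub_left, real_inner_smul_left, inner_frameE (h p hp)]
  by_cases hi : i = 0
  · subst hi; fin_cases j <;> simp [eps]
  · simp [Ne.symm hi]

theorem hs_eq_sum (p : U) {X Y : Hor 2} (hX : X ∈ horTangent f p) (hY : Y ∈ horTangent f p) :
    hs f N p X Y = ∑ i, ∑ j, inner ℝ X (frameE N i p) * inner ℝ Y (frameE N j p)
      * ((adaptedFrame hf hU hN h).b i j).1 p := by
  have hY' := eq_sum_of_mem hf hN h p.2 hY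
  rw [hs, inner_add_left, real_inner_smul_left, D_eq_sum hf hN h p.2 (nu N) hX, hY', inner_sum,
    inner_sum]
  have hb : ∀ i j, ((adaptedFrame hf hU hN h).b i j).1 p
      = ((adaptedFrame hf hU hN h).a i j).1 p + alpha N p * (eps 0 i j : ℝ) := fun i j => by
    rw [AdaptedFrame.b, Subalgebra.coe_add, Subalgebra.coe_mul]
    rfl
  simp only [inner_smul_right, sum_inner, real_inner_smul_left, inner_D_nu hf hU hN h,
    inner_J'_frameE hf hN h p.2 hX, hb, inner_frameE (h p p.2)]
  simp only [Fin.sum_univ_three]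
  simp
  ring

/-- Parseval's identity: passing from `onb` to the adapted frame is an orthogonal change of basis.
Contractions of tensors are transferred by using this in one slot at a time. -/
theorem sum_onb_mul {p : M} (hf : IsImmersion f) (hN : IsUnitNormalOn f N U)
    (h : ∀ p ∈ U, (N p).1 ≠ 0) (hp : p ∈ U) (φ ψ : Fin 3 → ℝ) :
    ∑ a, (∑ i, inner ℝ (onb f p a) (frameE N i p) * φ i)
      * (∑ j, inner ℝ (onb f p a) (frameE N j p) * ψ j) = ∑ i, φ i * ψ i := by
  have h1 : ∀ i j, ∑ a, (inner ℝ (onb f p a) (frameE N i p) : ℝ)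
      * inner ℝ (onb f p a) (frameE N j p) = if i = j then 1 else 0 := fun i j => by
    have h2 := (stdOrthonormalBasis ℝ (horTangent f p)).sum_inner_mul_inner
      ⟨frameE N i p, frameE_mem_horTangent hf hN h hp i⟩
      ⟨frameE N j p, frameE_mem_horTangent hf hN h hp j⟩
    rw [Submodule.coe_inner, inner_frameE (h p hp)] at h2
    rw [← h2]
    refine Finset.sum_congr rfl fun a _ => ?_
    rw [Submodule.coe_inner, Submodule.coe_inner, real_inner_comm (frameE N i p)]
    rfl
  have h3 : ∀ a, (∑ i, inner ℝ (onb f p a) (frameE N i p) * φ i)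
      * (∑ j, inner ℝ (onb f p a) (frameE N j p) * ψ j)
      = ∑ i, ∑ j, φ i * ψ j * ((inner ℝ (onb f p a) (frameE N i p) : ℝ)
      * inner ℝ (onb f p a) (frameE N j p)) := fun a => by
    rw [Finset.sum_mul_sum]
    exact Finset.sum_congr rfl fun i _ => Finset.sum_congr rfl fun j _ => by ring
  simp only [h3]
  rw [Finset.sum_comm]
  refine Finset.sum_congr rfl fun i _ => ?_
  rw [Finset.sum_comm]
  simp only [← Finset.mul_sum, h1]
  simp

theorem onb_mem (f : M → Heis 2) (p : M) (a) : onb f p a ∈ horTangent f p := Subtype.prop _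

theorem inner2_eq_sum {p : M} (hf : IsImmersion f) (hN : IsUnitNormalOn f N U)
    (h : ∀ p ∈ U, (N p).1 ≠ 0) (hp : p ∈ U) {A B : Hor 2 → Hor 2 → ℝ} {a b : Fin 3 → Fin 3 → ℝ}
    (hA : ∀ X ∈ horTangent f p, ∀ Y ∈ horTangent f p, A X Y
      = ∑ i, ∑ j, inner ℝ X (frameE N i p) * inner ℝ Y (frameE N j p) * a i j)
    (hB : ∀ X ∈ horTangent f p, ∀ Y ∈ horTangent f p, B X Y
      = ∑ i, ∑ j, inner ℝ X (frameE N i p) * inner ℝ Y (frameE N j p) * b i j) :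
    inner2 f p A B = ∑ i, ∑ j, a i j * b i j := by
  have key : ∀ (X Y : Hor 2) (c : Fin 3 → Fin 3 → ℝ),
      ∑ i, ∑ j, inner ℝ X (frameE N i p) * inner ℝ Y (frameE N j p) * c i j
      = ∑ j, inner ℝ Y (frameE N j p) * ∑ i, inner ℝ X (frameE N i p) * c i j := fun X Y c => by
    rw [Finset.sum_comm]
    refine Finset.sum_congr rfl fun j _ => ?_
    rw [Finset.mul_sum]
    exact Finset.sum_congr rfl fun i _ => by ring
  unfold inner2
  simp only [hA _ (onb_mem f p _) _ (onb_mem f p _), hB _ (onb_mem f p _) _ (onb_mem f p _), key,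
    sum_onb_mul hf hN h hp]
  rw [Finset.sum_comm]
  simp only [sum_onb_mul hf hN h hp]
  rw [Finset.sum_comm]

end Translation

end

/-! ### The geometric quantities as elements of the ring of functions -/

section

theorem AdaptedFrame.Γ_antisymm {R : Type*} [CommRing R] [Algebra ℝ R]
    (A : AdaptedFrame R) (k i j : Fin 3) :
    A.Γ k i j = -A.Γ k j i := by
  rw [A.Γ_eq, A.Γ_eq, ← Finset.sum_neg_distrib]
  refine Finset.sum_congr rfl fun m _ => ?_
  have : eps i m j = -eps j m i := by fin_cases i <;> fin_cases j <;> fin_cases m <;> rfl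
  rw [this]
  push_cast
  ring

theorem AdaptedFrame.nablaB_eq {R : Type*} [CommRing R] [Algebra ℝ R] (A : AdaptedFrame R)
    (k i j : Fin 3) : A.nablaB k i j
      = A.D k (A.b i j) + ∑ l, A.Γ k l i * A.b l j + ∑ l, A.Γ k l j * A.b i l := by
  have h1 : ∀ i l, A.Γ k i l = -A.Γ k l i := A.Γ_antisymm k
  have h2 : ∀ (i : Fin 3) (g : Fin 3 → R), ∑ l, A.Γ k i l * g l = -∑ l, A.Γ k l i * g l :=
    fun i g => by
      rw [← Finset.sum_neg_distrib]
      exact Finset.sum_congr rfl fun l _ => by rw [h1 i l, neg_mul]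
  rw [AdaptedFrame.nablaB, h2 i, h2 j, sub_neg_eq_add, sub_neg_eq_add]

section Invariants

variable {M : Type*} [TopologicalSpace M] [ChartedSpace (EuclideanSpace ℝ (Fin (2 * 2))) M]
  [IsManifold (𝓡 (2 * 2)) ∞ M]
variable {f : M → Heis 2} {N : M → Hor 2 × ℝ} {U : Set M}
variable (hf : IsImmersion f) (hU : IsOpen U) (hN : IsUnitNormalOn f N U)
  (h : ∀ p ∈ U, (N p).1 ≠ 0)

theorem normSqHs_eq (p : U) : normSqHs f N p = (adaptedFrame hf hU hN h).normSq.1 p := by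
  rw [normSqHs, inner2_eq_sum hf hN h p.2 (fun X hX Y hY => hs_eq_sum hf hU hN h p hX hY)
    (fun X hX Y hY => hs_eq_sum hf hU hN h p hX hY), AdaptedFrame.normSq, coe_sum]
  simp only [coe_sum, Subalgebra.coe_mul, Pi.mul_apply]

theorem ell_eq (p : U) : ell f N p = ((adaptedFrame hf hU hN h).a 0 0).1 p := by
  rw [ell, HeisSimons.h, ← frameE_zero, inner_D_nu hf hU hN h]

theorem norm_sq_nablaJnuNu_eq (p : U) :
    ‖nablaJnuNu f N p‖ ^ 2 = ∑ j, ((adaptedFrame hf hU hN h).a 0 j).1 p ^ 2 := by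
  rw [← real_inner_self_eq_norm_sq, nablaJnuNu, ← frameE_zero, D_nu_frameE hf hU hN h]
  simp only [sum_inner, inner_sum, real_inner_smul_left, inner_smul_right, inner_frameE (h p p.2)]
  simp only [Fin.sum_univ_three]
  simp
  ring

theorem JnuAlpha_eq (p : U) : JnuAlpha f N p
    = ((adaptedFrame hf hU hN h).D 0 (adaptedFrame hf hU hN h).α).1 p := by
  rw [JnuAlpha, ← frameE_zero, adaptedFrame_D_apply hf hU hN h 0 _ (G := alpha N) (fun q => rfl)]

theorem meanCurvature_eq (p : U) : meanCurvature f N p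
    = ((adaptedFrame hf hU hN h).a 0 0 + (adaptedFrame hf hU hN h).a 1 1
      + (adaptedFrame hf hU hN h).a 2 2).1 p := by
  have h1 : ∀ a, HeisSimons.h f N p (onb f p a) (onb f p a)
      = ∑ j, (∑ i, inner ℝ (onb f p a) (frameE N i p)
          * (if i = j then 1 else 0)) * ∑ i, inner ℝ (onb f p a) (frameE N i p)
          * ((adaptedFrame hf hU hN h).a i j).1 p := fun a => by
    have e : (inner ℝ (D f (nu N) p (onb f p a)) (onb f p a) : ℝ)
        = inner ℝ (D f (nu N) p (onb f p a))
          (∑ k, (inner ℝ (onb f p a) (frameE N k p) : ℝ) • frameE N k p) :=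
      congrArg _ (eq_sum_of_mem hf hN h p.2 (onb_mem f p a))
    rw [HeisSimons.h, e, D_eq_sum hf hN h p.2 (nu N) (onb_mem f p a)]
    simp only [inner_sum, sum_inner, real_inner_smul_left, inner_smul_right,
      inner_D_nu hf hU hN h]
    simp only [Fin.sum_univ_three]
    simp
  rw [meanCurvature]
  simp only [h1]
  rw [Finset.sum_comm]
  simp only [sum_onb_mul hf hN h p.2]
  simp [Fin.sum_univ_three]

theorem inner_grad_alpha (p : U) (k : Fin 3) : inner ℝ (grad f (alpha N) p) (frameE N k p)
    = ((adaptedFrame hf hU hN h).D k (adaptedFrame hf hU hN h).α).1 p := by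
  have h1 := sum_onb_mul hf hN h p.2
    (fun i => ((adaptedFrame hf hU hN h).D i (adaptedFrame hf hU hN h).α).1 p)
    (fun j => if j = k then 1 else 0)
  rw [grad, sum_inner]
  simp only [mul_ite, mul_one, mul_zero, Finset.sum_ite_eq', Finset.mem_univ, if_true] at h1
  rw [← h1]
  refine Finset.sum_congr rfl fun a _ => ?_
  rw [real_inner_smul_left, D_eq_sum_adaptedFrame hf hU hN h (adaptedFrame hf hU hN h).α
    (fun q => rfl) p (onb_mem f p a)]

/-- `J` rotates the plane of `e₁, e₂`, and `π` annihilates `J(Jν) = -ν`. So the left side is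
`2(b₁₁b₂₂ - b₁₂²)`, and `b₀₀ = -b₁₁ - b₂₂` identifies it with the right side. -/
theorem inner2_hsJ_eq (hf : IsImmersion f) (hU : IsOpen U) (hN : IsUnitNormalOn f N U)
    (h : ∀ p ∈ U, (N p).1 ≠ 0) (hmin : IsMinimalOn f N U) (p : U) :
    inner2 f p (hs f N p) (hsJ f N p) = 2 * ‖nablaJnuNu f N p‖ ^ 2 - normSqHs f N p := by
  have hJ : ∀ X ∈ horTangent f p, ∀ Y ∈ horTangent f p, hsJ f N p X Y
      = ∑ i, ∑ j, inner ℝ X (frameE N i p) * inner ℝ Y (frameE N j p)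
        * ∑ k, ∑ l, (eps 0 i k : ℝ) * (eps 0 j l : ℝ)
          * ((adaptedFrame hf hU hN h).b k l).1 p := fun X hX Y hY => by
    rw [hsJ, hs_eq_sum hf hU hN h p (proj_mem hf hN h p.2 _) (proj_mem hf hN h p.2 _)]
    simp only [inner_proj_frameE, inner_J_frameE hf hN h p.2 hX, inner_J_frameE hf hN h p.2 hY]
    simp only [Fin.sum_univ_three]
    ring
  have hm := hmin p p.2
  rw [meanCurvature_eq hf hU hN h] at hm
  rw [inner2_eq_sum hf hN h p.2 (fun X hX Y hY => hs_eq_sum hf hU hN h p hX hY) hJ,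
    norm_sq_nablaJnuNu_eq hf hU hN h, normSqHs_eq hf hU hN h]
  have hs12 := congrArg (fun g : smoothFunctions 2 U => g.1 p)
    ((adaptedFrame hf hU hN h).b_symm 1 2)
  have hs01 := congrArg (fun g : smoothFunctions 2 U => g.1 p)
    ((adaptedFrame hf hU hN h).b_symm 0 1)
  have hs02 := congrArg (fun g : smoothFunctions 2 U => g.1 p)
    ((adaptedFrame hf hU hN h).b_symm 0 2)
  simp only [AdaptedFrame.normSq, AdaptedFrame.b, Fin.sum_univ_three, eps] at hs12 hs01 hs02 ⊢
  simp at hs12 hs01 hs02 hm ⊢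
  simp only [← hs12, ← hs01, ← hs02]
  linear_combination (((adaptedFrame hf hU hN h).a 1 1).1 p
    + ((adaptedFrame hf hU hN h).a 2 2).1 p - ((adaptedFrame hf hU hN h).a 0 0).1 p) * hm
    + (((adaptedFrame hf hU hN h).a 1 2).1 p + (adaptedFrame hf hU hN h).α.1 p) * hs12

/-- Expand `π(Z_c)` in the frame: the coefficients are the components of the `eₖ`. Summing over `c`,
orthonormality leaves the pure second derivatives, and differentiating the coefficients produces
`Γ`. -/
theorem modLaplacian_eq (g : smoothFunctions 2 U) {G : M → ℝ} (hG : ∀ p : U, G p = g.1 p) (p : U) :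
    modLaplacian f N G p = (∑ i, (adaptedFrame hf hU hN h).D i ((adaptedFrame hf hU hN h).D i g)
      + ∑ i, ∑ j, (adaptedFrame hf hU hN h).Γ i j i * (adaptedFrame hf hU hN h).D j g
      + 2 * (adaptedFrame hf hU hN h).α * (adaptedFrame hf hU hN h).D 0 g).1 p := by
  set A := adaptedFrame hf hU hN h with hA
  have hsingle : ∀ (c : Fin 2 ⊕ Fin 2) (x : U) k,
      inner ℝ (proj N x (EuclideanSpace.single c 1)) (frameE N k x) = (quat k A.n c).1 x :=
    fun c x k => by
      rw [inner_proj_frameE, hA, adaptedFrame_quat_apply]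
      simp [EuclideanSpace.inner_single_left]
  have h1 : ∀ (c : Fin 2 ⊕ Fin 2) (g : smoothFunctions 2 U) (G : M → ℝ), (∀ x : U, G x = g.1 x) →
      ∀ x : U, Di f N c G x = (∑ k, quat k A.n c * A.D k g).1 x := fun c g G hG x => by
    rw [Di, D_eq_sum_adaptedFrame hf hU hN h g hG x (proj_mem hf hN h x.2 _), coe_sum]
    simp only [hsingle, Subalgebra.coe_mul, Pi.mul_apply, hA]
  have h2 : ∀ c, Di f N c (Di f N c G) p
      = (∑ k, quat k A.n c * A.D k (∑ l, quat l A.n c * A.D l g)).1 p := fun c =>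
    h1 c _ _ (h1 c g G hG) p
  have h3 : (∑ c, ∑ k, quat k A.n c * A.D k (∑ l, quat l A.n c * A.D l g))
      = ∑ i, A.D i (A.D i g) + ∑ i, ∑ j, A.Γ i j i * A.D j g := by
    have h4 : ∀ k l, dot (quat k A.n) (quat l A.n) = if k = l then 1 else 0 := fun k l => by
      rw [dot_quat_quat_self, A.unit]
    have h5 : (∑ c, ∑ k, quat k A.n c * A.D k (∑ l, quat l A.n c * A.D l g))
        = ∑ k, ∑ l, (dot (quat k A.n) (quat l A.n) * A.D k (A.D l g) + A.Γ k l k * A.D l g) := by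
      rw [Finset.sum_comm]
      refine Finset.sum_congr rfl fun k _ => ?_
      simp only [map_sum, Derivation.leibniz, smul_eq_mul, Finset.mul_sum]
      rw [Finset.sum_comm]
      refine Finset.sum_congr rfl fun l _ => ?_
      simp only [AdaptedFrame.Γ, dot, Finset.sum_mul, ← Finset.sum_add_distrib]
      exact Finset.sum_congr rfl fun c _ => by ring
    rw [h5]
    simp only [h4, ite_mul, one_mul, zero_mul, Finset.sum_add_distrib, Finset.sum_ite_eq,
      Finset.mem_univ, if_true]
  have h6 : D f G p (Jnu N p) = (A.D 0 g).1 p := by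
    rw [← frameE_zero, hA, adaptedFrame_D_apply hf hU hN h 0 g hG]
  have h7 : ∀ v : Fin 2 ⊕ Fin 2 → smoothFunctions 2 U, (∑ c, v c).1 p = ∑ c, (v c).1 p :=
    fun v => by simp
  rw [← h3, modLaplacian, h6]
  simp only [h2]
  rw [← h7]
  rfl

/-- Differentiating `⟨Y, ν⟩ν` gives a multiple of `ν`, removed by the projection, and a term with
the factor `⟨Y, ν⟩`, zero at `p`. Hence the correction terms of `covDeriv` vanish for the extensions
used in `nablaTensor`. -/
theorem nablaS_proj_eq_zero {p : M} (hf : IsImmersion f) (hU : IsOpen U)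
    (hN : IsUnitNormalOn f N U) (h : ∀ p ∈ U, (N p).1 ≠ 0) (hp : p ∈ U) (X : Hor 2) {Y : Hor 2}
    (hY : Y ∈ horTangent f p) : nablaS f N (fun x => proj N x Y) p X = 0 := by
  have hν := contMDiffOn_nu hN h
  have hνd : MDifferentiableAt (𝓡 (2 * 2)) 𝓘(ℝ, Hor 2) (nu N) p :=
    (hν.mdifferentiableOn (by simp) p hp).mdifferentiableAt (hU.mem_nhds hp)
  have hg : ContMDiffOn (𝓡 (2 * 2)) 𝓘(ℝ, ℝ) ∞ (fun x => -innerSL ℝ Y (nu N x)) U :=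
    ((innerSL ℝ Y).contDiff.contMDiff.comp_contMDiffOn hν).neg
  have hgd : MDifferentiableAt (𝓡 (2 * 2)) 𝓘(ℝ, ℝ) (fun x => -innerSL ℝ Y (nu N x)) p :=
    (hg.mdifferentiableOn (by simp) p hp).mdifferentiableAt (hU.mem_nhds hp)
  have hgνd : MDifferentiableAt (𝓡 (2 * 2)) 𝓘(ℝ, Hor 2)
      (fun x => (-innerSL ℝ Y (nu N x)) • nu N x) p :=
    ((hg.smul hν).mdifferentiableOn (by simp) p hp).mdifferentiableAt (hU.mem_nhds hp)
  have e : (fun x => proj N x Y) = fun x => Y + (-innerSL ℝ Y (nu N x)) • nu N x := by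
    funext x
    rw [proj, neg_smul, ← sub_eq_add_neg]
    rfl
  have h0 : innerSL ℝ Y (nu N p) = 0 := by
    rw [innerSL_apply_apply, real_inner_comm]
    exact inner_nu_of_mem hf hN h hp hY
  rw [nablaS, e, D_eq_Dv, Dv_fun_add f mdifferentiableAt_const hgνd, Dv_const,
    Dv_fun_smul f hgd hνd, h0, neg_zero, zero_smul, zero_add, zero_add, proj, real_inner_smul_left,
    real_inner_self_eq_norm_sq, norm_nu (h p hp)]
  simp

theorem nablaTensor_eq (p : U) {X Y Z : Hor 2} (hX : X ∈ horTangent f p) (hY : Y ∈ horTangent f p)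
    (hZ : Z ∈ horTangent f p) : nablaTensor f N (hs f N) p X Y Z
      = ∑ k, ∑ i, ∑ j, inner ℝ X (frameE N k p) * inner ℝ Y (frameE N i p)
        * inner ℝ Z (frameE N j p) * ((adaptedFrame hf hU hN h).nablaB k i j).1 p := by
  set A := adaptedFrame hf hU hN h with hA
  -- The frame components of a constant vector `W`, as functions. Their derivatives bring in the
  -- connection coefficients.
  let y : Hor 2 → Fin 3 → smoothFunctions 2 U := fun W i =>
    dot (fun c => algebraMap ℝ _ (W c)) (quat i A.n)
  have hy : ∀ W i (x : U), (y W i).1 x = inner ℝ W (frameE N i x) := fun W i x => by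
    simp only [y, coe_dot, hA, adaptedFrame_quat_apply, inner_eq_dot]
    rfl
  have hDy : ∀ W ∈ horTangent f p, ∀ k i, (A.D k (y W i)).1 p
      = ∑ l, (A.Γ k i l).1 p * inner ℝ W (frameE N l p) := fun W hW k i => by
    have h1 : A.D k (y W i) = dot (fun c => A.D k (quat i A.n c))
        (fun c => algebraMap ℝ _ (W c)) := by
      simp only [y]
      rw [derivation_dot, dot_comm (fun c => algebraMap ℝ (smoothFunctions 2 U) (W c))]
      have : dot (fun c => A.D k (algebraMap ℝ (smoothFunctions 2 U) (W c))) (quat i A.n) = 0 := by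
        simp only [Derivation.map_algebraMap, dot, zero_mul, Finset.sum_const_zero]
      rw [this, zero_add]
    have h2 := eq_sum_of_mem hf hN h p.2 hW
    rw [h1, coe_dot]
    have h3 : (fun c => ((algebraMap ℝ (smoothFunctions 2 U) (W c))).1 p)
        = fun c => ∑ l, inner ℝ W (frameE N l p) * (quat l A.n c).1 p := by
      funext c
      have h4 := congrArg (fun v : Hor 2 => v c) h2
      simp only [WithLp.ofLp_sum, Finset.sum_apply, WithLp.ofLp_smul, Pi.smul_apply,
        smul_eq_mul] at h4
      simp only [hA, adaptedFrame_quat_apply]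
      exact h4
    rw [h3]
    simp only [AdaptedFrame.Γ, coe_dot]
    simp only [dot_eq, Fin.sum_univ_three]
    ring
  have hG : ∀ x : U, hs f N x (proj N x Y) (proj N x Z)
      = (∑ i, ∑ j, y Y i * y Z j * A.b i j).1 x := fun x => by
    rw [hs_eq_sum hf hU hN h x (proj_mem hf hN h x.2 _) (proj_mem hf hN h x.2 _)]
    simp only [coe_sum, Subalgebra.coe_mul, Pi.mul_apply, hy, inner_proj_frameE, hA]
  have hz1 : hs f N p 0 (proj N p Z) = 0 := by
    rw [hs_eq_sum hf hU hN h p (zero_mem _) (proj_mem hf hN h p.2 _)]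
    simp
  have hz2 : hs f N p (proj N p Y) 0 = 0 := by
    rw [hs_eq_sum hf hU hN h p (proj_mem hf hN h p.2 _) (zero_mem _)]
    simp
  rw [nablaTensor, covDeriv, nablaS_proj_eq_zero hf hU hN h p.2 X hY,
    nablaS_proj_eq_zero hf hU hN h p.2 X hZ, hz1, hz2, sub_zero, sub_zero,
    D_eq_sum_adaptedFrame hf hU hN h _ hG p hX]
  refine Finset.sum_congr rfl fun k _ => ?_
  have h5 : (A.D k (∑ i, ∑ j, y Y i * y Z j * A.b i j)).1 p
      = ∑ i, ∑ j, (inner ℝ Y (frameE N i p) * inner ℝ Z (frameE N j p) * (A.D k (A.b i j)).1 p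
        + (A.b i j).1 p * (inner ℝ Y (frameE N i p) * (A.D k (y Z j)).1 p
          + inner ℝ Z (frameE N j p) * (A.D k (y Y i)).1 p)) := by
    simp only [map_sum, Derivation.leibniz, smul_eq_mul, coe_sum, Subalgebra.coe_mul,
      Subalgebra.coe_add, Pi.mul_apply, Pi.add_apply, hy]
  rw [← hA, h5]
  simp only [hDy Y hY, hDy Z hZ]
  have h6 : ∀ i j, (A.nablaB k i j).1 p = (A.D k (A.b i j)).1 p
      + ∑ l, (A.Γ k l i).1 p * (A.b l j).1 p + ∑ l, (A.Γ k l j).1 p * (A.b i l).1 p := fun i j => by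
    rw [A.nablaB_eq]
    simp only [Subalgebra.coe_add, Pi.add_apply, coe_sum, Subalgebra.coe_mul, Pi.mul_apply]
  simp only [h6]
  simp only [Fin.sum_univ_three]
  ring

/-- The change of basis of `sum_onb_mul` is applied to the three slots in turn, the last one first.
-/
theorem normSqNablaHs_eq (p : U) : normSqNablaHs f N p
    = (∑ k, ∑ i, ∑ j, (adaptedFrame hf hU hN h).nablaB k i j ^ 2).1 p := by
  have key : ∀ (X Y Z : Hor 2) (c : Fin 3 → Fin 3 → Fin 3 → ℝ),
      ∑ k, ∑ i, ∑ j, inner ℝ X (frameE N k p) * inner ℝ Y (frameE N i p)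
        * inner ℝ Z (frameE N j p) * c k i j
      = ∑ j, inner ℝ Z (frameE N j p) * ∑ i, inner ℝ Y (frameE N i p)
        * ∑ k, inner ℝ X (frameE N k p) * c k i j := fun X Y Z c => by
    simp only [Fin.sum_univ_three]
    ring
  have key3 : ∀ c : Fin 3 → Fin 3 → Fin 3 → ℝ,
      ∑ a₁, ∑ a₂, ∑ a₃, (∑ j, inner ℝ (onb f p a₃) (frameE N j p)
        * ∑ i, inner ℝ (onb f p a₂) (frameE N i p)
        * ∑ k, inner ℝ (onb f p a₁) (frameE N k p) * c k i j) ^ 2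
      = ∑ j, ∑ i, ∑ k, c k i j * c k i j := fun c => by
    calc _ = ∑ a₁, ∑ a₂, ∑ j, (∑ i, inner ℝ (onb f p a₂) (frameE N i p)
            * ∑ k, inner ℝ (onb f p a₁) (frameE N k p) * c k i j)
          * (∑ i, inner ℝ (onb f p a₂) (frameE N i p)
            * ∑ k, inner ℝ (onb f p a₁) (frameE N k p) * c k i j) := by
          simp only [sq, sum_onb_mul hf hN h p.2]
      _ = ∑ j, ∑ a₁, ∑ a₂, (∑ i, inner ℝ (onb f p a₂) (frameE N i p)
            * ∑ k, inner ℝ (onb f p a₁) (frameE N k p) * c k i j)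
          * (∑ i, inner ℝ (onb f p a₂) (frameE N i p)
            * ∑ k, inner ℝ (onb f p a₁) (frameE N k p) * c k i j) :=
          (Finset.sum_congr rfl fun a _ => Finset.sum_comm).trans Finset.sum_comm
      _ = ∑ j, ∑ i, ∑ a₁, (∑ k, inner ℝ (onb f p a₁) (frameE N k p) * c k i j)
          * ∑ k, inner ℝ (onb f p a₁) (frameE N k p) * c k i j := by
          exact Finset.sum_congr rfl fun j _ => (Finset.sum_congr rfl fun a _ =>
            sum_onb_mul hf hN h p.2 _ _).trans Finset.sum_comm
      _ = _ := by simp only [sum_onb_mul hf hN h p.2]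
  unfold normSqNablaHs
  simp only [nablaTensor_eq hf hU hN h p (onb_mem f p _) (onb_mem f p _) (onb_mem f p _), key, key3]
  simp only [coe_sum, Subalgebra.coe_pow, Pi.pow_apply]
  simp only [Fin.sum_univ_three]
  ring

end Invariants

end

/-! ### The Simons formula and the lower bound for hypersurfaces -/

section

variable {M : Type*} [TopologicalSpace M] [ChartedSpace (EuclideanSpace ℝ (Fin (2 * 2))) M]
  [IsManifold (𝓡 (2 * 2)) ∞ M]
variable {f : M → Heis 2} {N : M → Hor 2 × ℝ} {U : Set M}

theorem D_alpha_eq_zero (hf : IsImmersion f) (hU : IsOpen U) (hN : IsUnitNormalOn f N U)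
    (h : ∀ p ∈ U, (N p).1 ≠ 0) (h2 : P2 f N U) {k : Fin 3} (hk : k ≠ 0) :
    (adaptedFrame hf hU hN h).D k (adaptedFrame hf hU hN h).α = 0 := by
  refine Subtype.ext (funext fun p => ?_)
  rw [← inner_grad_alpha hf hU hN h p k, h2 p p.2, ← frameE_zero, real_inner_smul_left,
    inner_frameE (h p p.2), if_neg hk.symm, mul_zero]
  rfl

/-- The Simons type formula for `|h̃|²` on minimal hypersurfaces of `ℍ²` with (P2). -/
theorem modLaplacian_normSqHs (hf : IsImmersion f) (hU : IsOpen U) (hN : IsUnitNormalOn f N U)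
    (h : ∀ p ∈ U, (N p).1 ≠ 0) (hmin : IsMinimalOn f N U) (h2 : P2 f N U) {p : M} (hp : p ∈ U) :
    1 / 2 * modLaplacian f N (normSqHs f N) p
      = normSqNablaHs f N p - q f N p * normSqHs f N p
        + 4 * alpha N p ^ 2 * normSqHs f N p
        - 8 * alpha N p ^ 2 * ‖nablaJnuNu f N p‖ ^ 2
        + 2 * alpha N p ^ 2 * ell f N p ^ 2
        + 4 * (JnuAlpha f N p + alpha N p ^ 2)
          * (2 * normSqHs f N p - 4 * ‖nablaJnuNu f N p‖ ^ 2 + ell f N p ^ 2)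
        + (8 * JnuAlpha f N p + 6 * alpha N p ^ 2)
          * (‖nablaJnuNu f N p‖ ^ 2 - ell f N p ^ 2) := by
  set A := adaptedFrame hf hU hN h with hA
  have hH : A.a 0 0 + A.a 1 1 + A.a 2 2 = 0 := by
    refine Subtype.ext (funext fun x => ?_)
    rw [hA, ← meanCurvature_eq hf hU hN h x, hmin x x.2]
    rfl
  -- Evaluation at `p` is a ring homomorphism and carries the identity between functions to one
  -- between real numbers.
  let ev : smoothFunctions 2 U →+* ℝ :=
    (Pi.evalRingHom (fun _ : U => ℝ) ⟨p, hp⟩).comp (smoothFunctions 2 U).val.toRingHom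
  have key := congrArg ev
    (A.laplacian_normSq hH (D_alpha_eq_zero hf hU hN h h2 (by decide))
      (D_alpha_eq_zero hf hU hN h h2 (by decide)))
  have e1 := modLaplacian_eq hf hU hN h A.normSq (normSqHs_eq hf hU hN h) ⟨p, hp⟩
  have e2 := normSqNablaHs_eq hf hU hN h ⟨p, hp⟩
  have e3 := normSqHs_eq hf hU hN h ⟨p, hp⟩
  have e4 := norm_sq_nablaJnuNu_eq hf hU hN h ⟨p, hp⟩
  have e5 := ell_eq hf hU hN h ⟨p, hp⟩
  have e6 := JnuAlpha_eq hf hU hN h ⟨p, hp⟩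
  have e7 : alpha N p = A.α.1 ⟨p, hp⟩ := rfl
  rw [← hA] at e1 e2 e3 e4 e5 e6
  rw [q, e1, e2, e3, e4, e5, e6, e7]
  generalize ∑ k, ∑ i, ∑ j, A.nablaB k i j ^ 2 = S at key ⊢
  simp only [map_mul, map_sub, map_add, map_pow, map_ofNat, map_sum ev (fun j => A.a 0 j ^ 2)]
    at key
  have hev : ∀ g : smoothFunctions 2 U, g.1 ⟨p, hp⟩ = ev g := fun _ => rfl
  simp only [hev]
  simp only [map_mul, map_add, map_ofNat]
  push_cast
  linear_combination 1 / 2 * key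

/-- With trace zero, the two other diagonal entries have sum `-ℓ`. So `2|h̃|² - 3ℓ²` is the square
of their difference plus twice the squares of the off-diagonal entries. -/
theorem three_mul_ell_sq_le (hf : IsImmersion f) (hU : IsOpen U) (hN : IsUnitNormalOn f N U)
    (h : ∀ p ∈ U, (N p).1 ≠ 0) (hmin : IsMinimalOn f N U) {p : M} (hp : p ∈ U) :
    3 * ell f N p ^ 2 ≤ 2 * normSqHs f N p := by
  have e3 := normSqHs_eq hf hU hN h ⟨p, hp⟩
  have e5 := ell_eq hf hU hN h ⟨p, hp⟩
  have hm := hmin p hp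
  rw [meanCurvature_eq hf hU hN h ⟨p, hp⟩] at hm
  simp only at e3 e5
  rw [e3, e5, AdaptedFrame.normSq]
  simp only [coe_sum, Subalgebra.coe_mul, Pi.mul_apply, Subalgebra.coe_add, Pi.add_apply] at hm ⊢
  simp only [Fin.sum_univ_three]
  set A := adaptedFrame hf hU hN h with hA
  have b0 : (A.b 0 0).1 ⟨p, hp⟩ = (A.a 0 0).1 ⟨p, hp⟩ := by simp [AdaptedFrame.b, eps]
  have b1 : (A.b 1 1).1 ⟨p, hp⟩ = (A.a 1 1).1 ⟨p, hp⟩ := by simp [AdaptedFrame.b, eps]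
  have b2 : (A.b 2 2).1 ⟨p, hp⟩ = (A.a 2 2).1 ⟨p, hp⟩ := by simp [AdaptedFrame.b, eps]
  rw [b0, b1, b2]
  have : (A.a 0 0).1 ⟨p, hp⟩ = - (A.a 1 1).1 ⟨p, hp⟩ - (A.a 2 2).1 ⟨p, hp⟩ := by linarith
  rw [this]
  nlinarith [mul_self_nonneg ((A.b 0 1).1 ⟨p, hp⟩), mul_self_nonneg ((A.b 0 2).1 ⟨p, hp⟩),
    mul_self_nonneg ((A.b 1 2).1 ⟨p, hp⟩), mul_self_nonneg ((A.b 1 0).1 ⟨p, hp⟩),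
    mul_self_nonneg ((A.b 2 0).1 ⟨p, hp⟩), mul_self_nonneg ((A.b 2 1).1 ⟨p, hp⟩),
    mul_self_nonneg ((A.a 1 1).1 ⟨p, hp⟩ - (A.a 2 2).1 ⟨p, hp⟩)]

/-- (P1) gives `|∇_{Jν} ν|² = ℓ²`, which collects the excess over the lower bound into one product.
Both the inequality and the equality case are read off from it. -/
theorem modLaplacian_normSqHs_of_P1 (hf : IsImmersion f) (hU : IsOpen U)
    (hN : IsUnitNormalOn f N U) (h : ∀ p ∈ U, (N p).1 ≠ 0) (hmin : IsMinimalOn f N U)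
    (h1 : P1 f N U) (h2 : P2 f N U) {p : M} (hp : p ∈ U) :
    1 / 2 * modLaplacian f N (normSqHs f N) p = lowerBound f N p
      + 4 * (JnuAlpha f N p + alpha N p ^ 2) * (2 * normSqHs f N p - 3 * ell f N p ^ 2) := by
  have e : ‖nablaJnuNu f N p‖ ^ 2 = ell f N p ^ 2 := by
    rw [sub_eq_zero.1 (h1 p hp), ← frameE_zero, ← real_inner_self_eq_norm_sq,
      real_inner_smul_left, inner_smul_right, inner_frameE (h p hp)]
    simp [sq]
  rw [modLaplacian_normSqHs hf hU hN h hmin h2 hp, e, lowerBound]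
  ring

end

section

/-! ### The profile curve of the catenoidal hypersurface -/

/-- The radius `(E cosh u)^(1/3)`. -/
noncomputable def rad (E u : ℝ) : ℝ := (E * Real.cosh u) ^ (1 / 3 : ℝ)

/-- The height `∫₀ᵘ E / (3 rad)`. -/
noncomputable def hgt (E u : ℝ) : ℝ := ∫ v in (0 : ℝ)..u, E / (3 * rad E v)

variable {E : ℝ}

theorem E_mul_cosh_pos (hE : 0 < E) (u : ℝ) : 0 < E * Real.cosh u := mul_pos hE (Real.cosh_pos u)

theorem rad_pos (hE : 0 < E) (u : ℝ) : 0 < rad E u := Real.rpow_pos_of_pos (E_mul_cosh_pos hE u) _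

theorem rad_pow_three (hE : 0 < E) (u : ℝ) : rad E u ^ 3 = E * Real.cosh u := by
  rw [rad, ← Real.rpow_natCast, ← Real.rpow_mul (E_mul_cosh_pos hE u).le]
  norm_num

theorem rad_neg (E u : ℝ) : rad E (-u) = rad E u := by rw [rad, rad, Real.cosh_neg]

theorem rad_abs (E u : ℝ) : rad E |u| = rad E u := by rw [rad, rad, Real.cosh_abs]

theorem contDiff_rad (hE : 0 < E) : ContDiff ℝ ∞ (rad E) :=
  (contDiff_const.mul Real.contDiff_cosh).rpow_const_of_ne fun u => (E_mul_cosh_pos hE u).ne'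

theorem hasDerivAt_rad (hE : 0 < E) (u : ℝ) :
    HasDerivAt (rad E) (rad E u * Real.sinh u / (3 * Real.cosh u)) u := by
  have h1 := ((Real.hasDerivAt_cosh u).const_mul E).rpow_const (p := 1 / 3)
    (Or.inl (E_mul_cosh_pos hE u).ne')
  refine h1.congr_deriv ?_
  rw [Real.rpow_sub (E_mul_cosh_pos hE u), Real.rpow_one, ← rad]
  have := (Real.cosh_pos u).ne'
  field_simp

theorem rad_strictMonoOn (hE : 0 < E) : StrictMonoOn (rad E) (Set.Ici 0) := fun a ha b hb hab =>
  Real.rpow_lt_rpow (E_mul_cosh_pos hE a).le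
    (mul_lt_mul_of_pos_left (Real.cosh_strictMonoOn ha hb hab) hE) (by norm_num)

theorem contDiff_hgt_integrand (hE : 0 < E) : ContDiff ℝ ∞ fun v => E / (3 * rad E v) :=
  contDiff_const.div (contDiff_const.mul (contDiff_rad hE))
    fun u => mul_ne_zero three_ne_zero (rad_pos hE u).ne'

theorem hasDerivAt_hgt (hE : 0 < E) (u : ℝ) : HasDerivAt (hgt E) (E / (3 * rad E u)) u :=
  (contDiff_hgt_integrand hE).continuous.integral_hasStrictDerivAt 0 u |>.hasDerivAt

theorem contDiff_hgt (hE : 0 < E) : ContDiff ℝ ∞ (hgt E) := by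
  rw [contDiff_infty_iff_deriv]
  refine ⟨fun u => (hasDerivAt_hgt hE u).differentiableAt, ?_⟩
  rw [funext fun u => (hasDerivAt_hgt hE u).deriv]
  exact contDiff_hgt_integrand hE

theorem hgt_strictMono (hE : 0 < E) : StrictMono (hgt E) :=
  strictMono_of_deriv_pos fun u => by
    rw [(hasDerivAt_hgt hE u).deriv]
    exact div_pos hE (mul_pos three_pos (rad_pos hE u))

theorem hgt_zero (E : ℝ) : hgt E 0 = 0 := intervalIntegral.integral_same

theorem hgt_neg (E u : ℝ) : hgt E (-u) = -hgt E u := by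
  have h := intervalIntegral.integral_comp_neg (a := 0) (b := u) fun v => E / (3 * rad E v)
  simp only [rad_neg, neg_zero] at h
  rw [hgt, hgt, h, intervalIntegral.integral_symm]

theorem hgt_abs (hE : 0 < E) (u : ℝ) : hgt E |u| = |hgt E u| := by
  rcases le_total 0 u with h | h
  · rw [abs_of_nonneg h, abs_of_nonneg]
    exact (hgt_zero E).symm.le.trans ((hgt_strictMono hE).monotone h)
  · rw [abs_of_nonpos h, hgt_neg, abs_of_nonpos]
    exact ((hgt_strictMono hE).monotone h).trans (hgt_zero E).le

theorem rad_zero (E : ℝ) : rad E 0 = E ^ (1 / (2 * ((2 : ℕ) : ℝ) - 1)) := by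
  rw [rad, Real.cosh_zero, mul_one]
  norm_num

theorem exists_rad_eq (hE : 0 < E) {r : ℝ} (hr : rad E 0 ≤ r) : ∃ u, 0 ≤ u ∧ rad E u = r := by
  have hr0 : 0 < r := (rad_pos hE 0).trans_le hr
  have h1 : 1 ≤ r ^ 3 / E := by
    rw [one_le_div hE]
    have h2 := rad_pow_three hE 0
    rw [Real.cosh_zero, mul_one] at h2
    rw [← h2]
    exact pow_le_pow_left₀ (rad_pos hE 0).le hr 3
  refine ⟨Real.arcosh (r ^ 3 / E), Real.arcosh_nonneg h1, ?_⟩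
  rw [rad, Real.cosh_arcosh h1, mul_div_cancel₀ _ hE.ne', ← Real.rpow_natCast,
    ← Real.rpow_mul hr0.le]
  norm_num

/-- Substitute `τ³ = E cosh v`: the root becomes `E sinh v`, cancelled by the derivative of `rad`,
and the singular integrand of the profile becomes smooth. -/
theorem catenoidProfile_rad (hE : 0 < E) {u : ℝ} (hu : 0 ≤ u) :
    catenoidProfile 2 E (rad E u) = hgt E u := by
  have hmono : StrictMonoOn (rad E) (Set.Icc 0 u) :=
    (rad_strictMonoOn hE).mono fun x hx => hx.1
  -- The half-open interval avoids `v = 0`, where the root vanishes.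
  have himg : rad E '' Set.Ioc 0 u = Set.Ioc (rad E 0) (rad E u) := by
    refine Set.Subset.antisymm ?_ fun y hy => ?_
    · rintro _ ⟨x, hx, rfl⟩
      exact ⟨hmono ⟨le_rfl, hu⟩ ⟨hx.1.le, hx.2⟩ hx.1,
        hmono.monotoneOn ⟨hx.1.le, hx.2⟩ ⟨hu, le_rfl⟩ hx.2⟩
    · obtain ⟨x, hx, rfl⟩ := intermediate_value_Icc hu (contDiff_rad hE).continuous.continuousOn
        ⟨hy.1.le, hy.2⟩
      refine ⟨x, ⟨hx.1.lt_of_ne ?_, hx.2⟩, rfl⟩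
      rintro rfl
      exact lt_irrefl _ hy.1
  rw [catenoidProfile, hgt, ← rad_zero,
    intervalIntegral.integral_of_le (hmono.monotoneOn ⟨le_rfl, hu⟩ ⟨hu, le_rfl⟩ hu),
    intervalIntegral.integral_of_le hu, ← himg,
    MeasureTheory.integral_image_eq_integral_abs_deriv_smul measurableSet_Ioc
      (fun x _ => (hasDerivAt_rad hE x).hasDerivWithinAt)
      (hmono.injOn.mono Set.Ioc_subset_Icc_self)]
  refine MeasureTheory.setIntegral_congr_fun measurableSet_Ioc fun v hv => ?_
  have hs : 0 < Real.sinh v := Real.sinh_pos_iff.2 hv.1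
  have hc := Real.cosh_pos v
  have hr := rad_pos hE v
  have h6 : rad E v ^ (4 * 2 - 2) - E ^ 2 = (E * Real.sinh v) ^ 2 := by
    rw [show 4 * 2 - 2 = 3 * 2 from rfl, pow_mul, rad_pow_three hE, mul_pow, Real.cosh_sq]
    ring
  rw [h6, Real.sqrt_sq (mul_pos hE hs).le, abs_of_pos (by positivity), smul_eq_mul]
  have h3 := rad_pow_three hE v
  field_simp
  linear_combination h3

/-- The radius is even and the height odd in `u`, so a signed parameter covers the upper and lower
halves together, smoothly across the neck `u = 0`. -/
theorem mem_catenoid_iff (hE : 0 < E) {p : Heis 2} :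
    p ∈ catenoid 2 E ↔ ∃ u, ‖p.1‖ = rad E u ∧ p.2 = hgt E u := by
  rw [catenoid, Set.mem_ofPred_eq, ← rad_zero]
  constructor
  · rintro ⟨h1, h2⟩
    obtain ⟨u, hu, hru⟩ := exists_rad_eq hE h1
    rw [← hru, catenoidProfile_rad hE hu] at h2
    rcases le_total 0 p.2 with h | h
    · exact ⟨u, hru.symm, by rw [← h2, abs_of_nonneg h]⟩
    · exact ⟨-u, by rw [rad_neg, hru], by rw [hgt_neg, ← h2, abs_of_nonpos h, neg_neg]⟩
  · rintro ⟨u, h1, h2⟩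
    rw [h1, h2, ← rad_abs E u, catenoidProfile_rad hE (abs_nonneg u), hgt_abs hE]
    exact ⟨(rad_strictMonoOn hE).monotoneOn (Set.mem_Ici.2 le_rfl) (abs_nonneg u) (abs_nonneg u),
      rfl⟩

end

section

/-! ### Geometry of the catenoidal hypersurface -/

variable {E : ℝ}

/-- The unit normal of the catenoidal hypersurface at the point `q.1` with parameter `q.2`. -/
noncomputable def catenoidNormal (E : ℝ) (q : Heis 2 × ℝ) : Hor 2 × ℝ :=
  (Real.sqrt ((rad E q.2 * Real.cosh q.2) ^ 2 + Real.sinh q.2 ^ 2))⁻¹ •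
    (q.1.1 + Real.sinh q.2 • JL 2 q.1.1, -Real.sinh q.2)

theorem catenoidNormal_radicand_pos (hE : 0 < E) (u : ℝ) :
    0 < (rad E u * Real.cosh u) ^ 2 + Real.sinh u ^ 2 :=
  add_pos_of_pos_of_nonneg (pow_pos (mul_pos (rad_pos hE u) (Real.cosh_pos u)) 2) (sq_nonneg _)

theorem contDiff_catenoidNormal (hE : 0 < E) : ContDiff ℝ ∞ (catenoidNormal E) := by
  have hs : ContDiff ℝ ∞ fun q : Heis 2 × ℝ => Real.sinh q.2 := Real.contDiff_sinh.comp contDiff_snd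
  have hc : ContDiff ℝ ∞ fun q : Heis 2 × ℝ => Real.cosh q.2 := Real.contDiff_cosh.comp contDiff_snd
  have hr : ContDiff ℝ ∞ fun q : Heis 2 × ℝ => rad E q.2 := (contDiff_rad hE).comp contDiff_snd
  have hz : ContDiff ℝ ∞ fun q : Heis 2 × ℝ => q.1.1 := contDiff_fst.comp contDiff_fst
  refine ContDiff.smul (ContDiff.inv (ContDiff.sqrt (((hr.mul hc).pow 2).add (hs.pow 2))
    fun q => (catenoidNormal_radicand_pos hE q.2).ne')
    fun q => (Real.sqrt_pos.2 (catenoidNormal_radicand_pos hE q.2)).ne') ?_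
  exact (hz.add (hs.smul ((JL 2).contDiff.comp hz))).prodMk hs.neg

theorem inner_add_smul_J (z : Hor 2) (a : ℝ) :
    inner ℝ (z + a • J z) (z + a • J z) = ‖z‖ ^ 2 * (1 + a ^ 2) := by
  have h1 : inner ℝ z (J z) = 0 := by rw [real_inner_comm, inner_J_self]
  simp only [inner_add_left, inner_add_right, real_inner_smul_left, inner_smul_right, inner_J_J,
    inner_J_self, h1]
  rw [real_inner_self_eq_norm_sq]
  ring

theorem norm_add_smul_J {z : Hor 2} {u : ℝ} (hz : ‖z‖ = rad E u) :
    ‖z + Real.sinh u • J z‖ = rad E u * Real.cosh u := by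
  rw [← Real.sqrt_sq (norm_nonneg _), ← real_inner_self_eq_norm_sq, inner_add_smul_J, hz,
    add_comm (1 : ℝ), ← Real.cosh_sq, ← mul_pow, Real.sqrt_sq]
  exact mul_nonneg (hz ▸ norm_nonneg _) (Real.cosh_pos u).le

variable {M : Type*} [TopologicalSpace M] [ChartedSpace (EuclideanSpace ℝ (Fin (2 * 2))) M]
variable {f : M → Heis 2} {u : M → ℝ} {p : M}

theorem nu_catenoidNormal (hE : 0 < E) (hr : ∀ p, ‖(f p).1‖ = rad E (u p)) (p : M) :
    nu (fun x => catenoidNormal E (f x, u x)) p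
      = (rad E (u p) * Real.cosh (u p))⁻¹ • ((f p).1 + Real.sinh (u p) • JL 2 (f p).1) := by
  have hk := Real.sqrt_pos.2 (catenoidNormal_radicand_pos hE (u p))
  rw [nu, catenoidNormal]
  simp only [Prod.smul_fst]
  rw [norm_smul, norm_inv, Real.norm_of_nonneg hk.le, JL_apply, norm_add_smul_J (hr p), smul_smul]
  generalize Real.sqrt _ = k at hk
  have hs := (rad_pos hE (u p)).ne'
  have hc := (Real.cosh_pos (u p)).ne'
  congr 1
  field_simp

theorem alpha_catenoidNormal (hE : 0 < E) (hr : ∀ p, ‖(f p).1‖ = rad E (u p)) (p : M) :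
    alpha (fun x => catenoidNormal E (f x, u x)) p
      = -(Real.sinh (u p) * (rad E (u p) * Real.cosh (u p))⁻¹) := by
  have hk := Real.sqrt_pos.2 (catenoidNormal_radicand_pos hE (u p))
  rw [alpha, catenoidNormal]
  simp only [Prod.smul_fst, Prod.smul_snd]
  rw [norm_smul, norm_inv, Real.norm_of_nonneg hk.le, JL_apply, norm_add_smul_J (hr p), smul_eq_mul]
  generalize Real.sqrt _ = k at hk
  have hs := (rad_pos hE (u p)).ne'
  have hc := (Real.cosh_pos (u p)).ne'
  field_simp

theorem catenoidNormal_fst_ne_zero (hE : 0 < E) (hr : ∀ p, ‖(f p).1‖ = rad E (u p)) (p : M) :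
    (catenoidNormal E (f p, u p)).1 ≠ 0 := by
  have hk := Real.sqrt_pos.2 (catenoidNormal_radicand_pos hE (u p))
  refine smul_ne_zero (inv_ne_zero hk.ne') ?_
  rw [← norm_ne_zero_iff, JL_apply, norm_add_smul_J (hr p)]
  exact (mul_pos (rad_pos hE _) (Real.cosh_pos _)).ne'

theorem Dv_real_comp (f : M → Heis 2) {φ : ℝ → ℝ} {φ' : ℝ} (hφ : HasDerivAt φ φ' (u p))
    (hu : MDifferentiableAt (𝓡 (2 * 2)) 𝓘(ℝ, ℝ) u p) (V : Hor 2 × ℝ) :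
    Dv f (fun x => φ (u x)) p V = φ' * Dv f u p V := by
  rw [Dv_comp f hφ.differentiableAt hu, hφ.hasFDerivAt.fderiv]
  simp [mul_comm]

theorem Dv_fst (hf : IsImmersion f) {V : Hor 2 × ℝ} (hV : V ∈ frameTangent f p) :
    Dv f (fun x => (f x).1) p V = V.1 := by
  have h := Dv_clm (p := p) f (ContinuousLinearMap.fst ℝ (Hor 2) ℝ)
    (hf.1.mdifferentiableAt (by simp)) V
  rw [Dv_self hV, ofFrame_eq] at h
  exact h

/-- Differentiate `t = hgt E u`; the `∂/∂t` component of a vector differs from its `T`-coefficient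
by the contribution of `Xⱼ`, `Yⱼ`. -/
theorem Dv_param (hE : 0 < E) (hf : IsImmersion f) (hu : MDifferentiableAt (𝓡 (2 * 2)) 𝓘(ℝ, ℝ) u p)
    (ht : ∀ p, (f p).2 = hgt E (u p)) {V : Hor 2 × ℝ} (hV : V ∈ frameTangent f p) :
    Dv f u p V = 3 * rad E (u p) / E * (V.2 - inner ℝ (J (f p).1) V.1) := by
  have h1 := Dv_clm (p := p) f (ContinuousLinearMap.snd ℝ (Hor 2) ℝ)
    (hf.1.mdifferentiableAt (by simp)) V
  rw [Dv_self hV, ofFrame_eq] at h1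
  have h2 := Dv_real_comp f (hasDerivAt_hgt hE (u p)) hu V
  have h3 : (fun x => (ContinuousLinearMap.snd ℝ (Hor 2) ℝ) (f x)) = fun x => hgt E (u x) :=
    funext ht
  rw [h3, h2] at h1
  simp only [ContinuousLinearMap.coe_snd'] at h1
  rw [inner_J_left, real_inner_comm] at h1
  have := (rad_pos hE (u p)).ne'
  field_simp at h1 ⊢
  linear_combination h1

/-- Differentiate `|z|² = rad²` and eliminate the derivative of `u` with `Dv_param`. This linear
equation describes the tangent space, and `catenoidNormal` is its normalized coefficient vector. -/
theorem inner_fst (hE : 0 < E) (hf : IsImmersion f) (hu : MDifferentiableAt (𝓡 (2 * 2)) 𝓘(ℝ, ℝ) u p)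
    (hr : ∀ p, ‖(f p).1‖ = rad E (u p)) (ht : ∀ p, (f p).2 = hgt E (u p)) {V : Hor 2 × ℝ}
    (hV : V ∈ frameTangent f p) :
    inner ℝ (f p).1 V.1 = Real.sinh (u p) * (V.2 - inner ℝ (J (f p).1) V.1) := by
  have hz : MDifferentiableAt (𝓡 (2 * 2)) 𝓘(ℝ, Hor 2) (fun x => (f x).1) p :=
    (contDiff_fst.contMDiff.comp hf.1).mdifferentiableAt (n := ∞) (by simp)
  have h1 := Dv_comp f (φ := fun z : Hor 2 => ‖z‖ ^ 2)
    (differentiable_id.norm_sq ℝ _) hz V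
  rw [Dv_fst hf hV] at h1
  have h2 := Dv_real_comp f ((hasDerivAt_rad hE (u p)).pow 2) hu V
  have h3 : (fun x => ‖(f x).1‖ ^ 2) = fun x => (rad E ^ 2) (u x) := by
    funext x
    rw [hr x]
    rfl
  rw [h3, h2, fderiv_norm_sq_apply, Dv_param hE hf hu ht hV] at h1
  simp only [smul_apply, innerSL_apply_apply, nsmul_eq_mul] at h1
  have h4 := rad_pow_three hE (u p)
  have hc := (Real.cosh_pos (u p)).ne'
  generalize inner ℝ (J (f p).1) V.1 = i1 at *
  generalize inner ℝ (f p).1 V.1 = i2 at *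
  field_simp at h1
  refine mul_left_cancel₀ (mul_ne_zero hE.ne' hc) ?_
  linear_combination -h1 + Real.sinh (u p) * (V.2 - i1) * h4

theorem isUnitNormalOn_catenoidNormal (hE : 0 < E) (hf : IsImmersion f)
    (hu : ContMDiff (𝓡 (2 * 2)) 𝓘(ℝ, ℝ) ∞ u)
    (hr : ∀ p, ‖(f p).1‖ = rad E (u p)) (ht : ∀ p, (f p).2 = hgt E (u p)) :
    IsUnitNormalOn f (fun x => catenoidNormal E (f x, u x)) Set.univ where
  smooth := ((contDiff_catenoidNormal hE).contMDiff.comp (hf.1.prodMk_space hu)).contMDiffOn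
  unit p _ := by
    have hk := catenoidNormal_radicand_pos hE (u p)
    rw [metric, catenoidNormal]
    simp only [Prod.smul_fst, Prod.smul_snd, real_inner_smul_left, inner_smul_right, smul_eq_mul,
      real_inner_self_eq_norm_sq, JL_apply, norm_add_smul_J (hr p)]
    have h2 := Real.sq_sqrt hk.le
    have h3 := (Real.sqrt_pos.2 hk).ne'
    generalize Real.sqrt _ = k at h2 h3
    field_simp
    linear_combination -h2
  normal p _ V hV := by
    have h := inner_fst hE hf (hu.mdifferentiableAt (by simp)) hr ht (V := V) hV
    rw [metric, catenoidNormal]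
    simp only [Prod.smul_fst, Prod.smul_snd, real_inner_smul_left, smul_eq_mul, inner_add_left,
      JL_apply, h]
    ring

end

/-! ### Curvature of the catenoidal hypersurface -/

section

theorem hasDerivAt_inv_rad_mul_cosh {E : ℝ} (hE : 0 < E) (u : ℝ) :
    HasDerivAt (fun v => (rad E v * Real.cosh v)⁻¹)
      (-(4 * Real.sinh u) / (3 * rad E u * Real.cosh u ^ 2)) u := by
  have hs := (rad_pos hE u).ne'
  have hc := (Real.cosh_pos u).ne'
  refine (((hasDerivAt_rad hE u).mul (Real.hasDerivAt_cosh u)).inv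
    (mul_ne_zero hs hc)).congr_deriv ?_
  simp only [Pi.mul_apply]
  field_simp
  ring

theorem hasDerivAt_sinh_mul_inv_rad_mul_cosh {E : ℝ} (hE : 0 < E) (u : ℝ) :
    HasDerivAt (fun v => Real.sinh v * (rad E v * Real.cosh v)⁻¹)
      ((3 - Real.sinh u ^ 2) / (3 * rad E u * Real.cosh u ^ 2)) u := by
  have hs := (rad_pos hE u).ne'
  have hc := (Real.cosh_pos u).ne'
  refine ((Real.hasDerivAt_sinh u).mul (hasDerivAt_inv_rad_mul_cosh hE u)).congr_deriv ?_
  field_simp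
  rw [Real.cosh_sq]
  ring

variable {M : Type*} [TopologicalSpace M] [ChartedSpace (EuclideanSpace ℝ (Fin (2 * 2))) M]
  [IsManifold (𝓡 (2 * 2)) ∞ M]

/-- `f` is an immersion into the catenoidal hypersurface, with profile parameter `u`. -/
structure IsCatenoidImmersion {M : Type*} [TopologicalSpace M]
    [ChartedSpace (EuclideanSpace ℝ (Fin (2 * 2))) M] (E : ℝ) (f : M → Heis 2) (u : M → ℝ) :
    Prop where
  pos : 0 < E
  immersion : IsImmersion f
  smooth : ContMDiff (𝓡 (2 * 2)) 𝓘(ℝ, ℝ) ∞ u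
  norm_eq : ∀ p, ‖(f p).1‖ = rad E (u p)
  height_eq : ∀ p, (f p).2 = hgt E (u p)

namespace IsCatenoidImmersion

variable {E : ℝ} {f : M → Heis 2} {u : M → ℝ}

/-- The unit normal field. -/
noncomputable abbrev normal (_ : IsCatenoidImmersion E f u) : M → Hor 2 × ℝ :=
  fun x => catenoidNormal E (f x, u x)

variable (C : IsCatenoidImmersion E f u)

theorem isUnitNormalOn : IsUnitNormalOn f C.normal Set.univ :=
  isUnitNormalOn_catenoidNormal C.pos C.immersion C.smooth C.norm_eq C.height_eq

theorem normal_fst_ne_zero : ∀ p ∈ (Set.univ : Set M), (C.normal p).1 ≠ 0 := fun p _ =>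
  catenoidNormal_fst_ne_zero C.pos C.norm_eq p

theorem not_isCharacteristicAt (C : IsCatenoidImmersion E f u) (p : M) :
    ¬ IsCharacteristicAt f p := fun hc => by
  refine C.normal_fst_ne_zero p trivial (inner_self_eq_zero (𝕜 := ℝ).1 ?_)
  have h1 := C.isUnitNormalOn.normal p trivial ((C.normal p).1, 0)
    (hc.symm.le ⟨(C.normal p).1, rfl⟩)
  simpa [metric] using h1

theorem mem_horTangent (p : M) (i : Fin 3) : frameE C.normal i p ∈ horTangent f p :=
  frameE_mem_horTangent C.immersion C.isUnitNormalOn C.normal_fst_ne_zero trivial i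

theorem smul_nu (p : M) : (rad E (u p) * Real.cosh (u p)) • nu C.normal p
    = (f p).1 + Real.sinh (u p) • J (f p).1 := by
  rw [nu_catenoidNormal C.pos C.norm_eq, JL_apply,
    smul_inv_smul₀ (mul_pos (rad_pos C.pos _) (Real.cosh_pos _)).ne']

theorem smul_Jnu (p : M) : (rad E (u p) * Real.cosh (u p)) • Jnu C.normal p
    = J (f p).1 - Real.sinh (u p) • (f p).1 := by
  have h := congrArg (JL 2) (C.smul_nu p)
  rw [map_smul, map_add, map_smul, JL_apply, JL_apply, JL_apply, J_J, smul_neg,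
    ← sub_eq_add_neg] at h
  exact h

/-- Inverts the relations for `ν` and `Jν` in the plane of `z` and `Jz`; the determinant is `1 +
sinh² = cosh²`. -/
theorem fst_eq (p : M) : (f p).1 = (rad E (u p) / Real.cosh (u p)) •
    (nu C.normal p - Real.sinh (u p) • Jnu C.normal p) := by
  have hc := (Real.cosh_pos (u p)).ne'
  have e : (rad E (u p) / Real.cosh (u p)) = (Real.cosh (u p) ^ 2)⁻¹
      * (rad E (u p) * Real.cosh (u p)) := by field_simp
  rw [e, mul_smul, smul_sub, smul_comm _ (Real.sinh (u p)), C.smul_nu, C.smul_Jnu,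
    eq_inv_smul_iff₀ (pow_ne_zero 2 hc), Real.cosh_sq]
  module

theorem J_fst_eq (p : M) : J (f p).1 = (rad E (u p) / Real.cosh (u p)) •
    (Jnu C.normal p + Real.sinh (u p) • nu C.normal p) := by
  have hc := (Real.cosh_pos (u p)).ne'
  have e : (rad E (u p) / Real.cosh (u p)) = (Real.cosh (u p) ^ 2)⁻¹
      * (rad E (u p) * Real.cosh (u p)) := by field_simp
  rw [e, mul_smul, smul_add, smul_comm _ (Real.sinh (u p)), C.smul_nu, C.smul_Jnu,
    eq_inv_smul_iff₀ (pow_ne_zero 2 hc), Real.cosh_sq]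
  module

theorem inner_fst_frameE (p : M) (i : Fin 3) : inner ℝ (f p).1 (frameE C.normal i p)
    = if 0 = i then -(rad E (u p) * Real.sinh (u p) / Real.cosh (u p)) else 0 := by
  rw [C.fst_eq, real_inner_smul_left, inner_sub_left, real_inner_smul_left, ← frameE_zero,
    inner_nu_frameE, inner_frameE (C.normal_fst_ne_zero p trivial)]
  split_ifs <;> ring

theorem inner_J_fst_frameE (p : M) (i : Fin 3) : inner ℝ (J (f p).1) (frameE C.normal i p)
    = if 0 = i then rad E (u p) / Real.cosh (u p) else 0 := by
  rw [C.J_fst_eq, real_inner_smul_left, inner_add_left, real_inner_smul_left, ← frameE_zero,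
    inner_nu_frameE, inner_frameE (C.normal_fst_ne_zero p trivial)]
  split_ifs <;> ring

/-- Among horizontal tangent directions the parameter varies only along `Jν`. As `α` is a function
of `u`, this is the source of (P2). -/
theorem D_param (p : M) (i : Fin 3) : D f u p (frameE C.normal i p)
    = if 0 = i then -(3 / rad E (u p)) else 0 := by
  rw [D_eq_Dv, Dv_param C.pos C.immersion (C.smooth.mdifferentiableAt (by simp)) C.height_eq
    (mem_horTangent_iff.1 (C.mem_horTangent p i)), C.inner_J_fst_frameE]
  have h1 := rad_pow_three C.pos (u p)
  have h2 := (rad_pos C.pos (u p)).ne'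
  have h3 := (Real.cosh_pos (u p)).ne'
  have h4 := C.pos.ne'
  split_ifs
  · field_simp
    linear_combination -h1
  · simp

theorem D_nu (p : M) (i : Fin 3) : D f (nu C.normal) p (frameE C.normal i p)
    = (rad E (u p) * Real.cosh (u p))⁻¹ • (frameE C.normal i p
        + Real.sinh (u p) • J (frameE C.normal i p))
      + D f u p (frameE C.normal i p) •
        ((-(4 * Real.sinh (u p)) / (3 * rad E (u p) * Real.cosh (u p) ^ 2)) • (f p).1
          + ((3 - Real.sinh (u p) ^ 2) / (3 * rad E (u p) * Real.cosh (u p) ^ 2)) •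
            J (f p).1) := by
  have hu : MDifferentiableAt (𝓡 (2 * 2)) 𝓘(ℝ, ℝ) u p := C.smooth.mdifferentiableAt (by simp)
  have hz : MDifferentiableAt (𝓡 (2 * 2)) 𝓘(ℝ, Hor 2) (fun x => (f x).1) p :=
    (contDiff_fst.contMDiff.comp C.immersion.1).mdifferentiableAt (n := ∞) (by simp)
  have hJz : MDifferentiableAt (𝓡 (2 * 2)) 𝓘(ℝ, Hor 2) (fun x => JL 2 (f x).1) p :=
    (JL 2).differentiableAt.mdifferentiableAt.comp p hz
  have h1 := hasDerivAt_inv_rad_mul_cosh C.pos (u p)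
  have h2 := hasDerivAt_sinh_mul_inv_rad_mul_cosh C.pos (u p)
  have hg1 : MDifferentiableAt (𝓡 (2 * 2)) 𝓘(ℝ, ℝ)
      (fun x => (rad E (u x) * Real.cosh (u x))⁻¹) p :=
    h1.differentiableAt.mdifferentiableAt.comp p hu
  have hg2 : MDifferentiableAt (𝓡 (2 * 2)) 𝓘(ℝ, ℝ)
      (fun x => Real.sinh (u x) * (rad E (u x) * Real.cosh (u x))⁻¹) p :=
    h2.differentiableAt.mdifferentiableAt.comp p hu
  have hV := mem_horTangent_iff.1 (C.mem_horTangent p i)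
  have e : nu C.normal = fun x => (rad E (u x) * Real.cosh (u x))⁻¹ • (f x).1
      + (Real.sinh (u x) * (rad E (u x) * Real.cosh (u x))⁻¹) • JL 2 (f x).1 := by
    funext x
    rw [nu_catenoidNormal C.pos C.norm_eq, smul_add, smul_smul, mul_comm (Real.sinh _)]
  rw [D_eq_Dv, D_eq_Dv, show Dv f (nu C.normal) p (frameE C.normal i p, 0) = _ from
    congrArg (fun g => Dv f g p (frameE C.normal i p, 0)) e]
  have hd1 : MDifferentiableAt (𝓡 (2 * 2)) 𝓘(ℝ, Hor 2)
      (fun x => (rad E (u x) * Real.cosh (u x))⁻¹ • (f x).1) p := hg1.smul hz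
  have hd2 : MDifferentiableAt (𝓡 (2 * 2)) 𝓘(ℝ, Hor 2) (fun x =>
      (Real.sinh (u x) * (rad E (u x) * Real.cosh (u x))⁻¹) • JL 2 (f x).1) p := hg2.smul hJz
  rw [Dv_fun_add f hd1 hd2, Dv_fun_smul f hg1 hz, Dv_fun_smul f hg2 hJz,
    Dv_clm f (JL 2) hz, Dv_fst C.immersion hV, Dv_real_comp f h1 hu, Dv_real_comp f h2 hu]
  simp only [JL_apply]
  module

theorem D_alpha (p : M) (i : Fin 3) : D f (alpha C.normal) p (frameE C.normal i p)
    = if 0 = i then (3 - Real.sinh (u p) ^ 2) / (rad E (u p) * Real.cosh (u p)) ^ 2 else 0 := by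
  have hu : MDifferentiableAt (𝓡 (2 * 2)) 𝓘(ℝ, ℝ) u p := C.smooth.mdifferentiableAt (by simp)
  have h2 := hasDerivAt_sinh_mul_inv_rad_mul_cosh C.pos (u p)
  have e : alpha C.normal = fun x => -(Real.sinh (u x) * (rad E (u x) * Real.cosh (u x))⁻¹) :=
    funext fun x => alpha_catenoidNormal C.pos C.norm_eq x
  have h3 := fun V => Dv_real_comp f (φ := fun v => -(Real.sinh v * (rad E v * Real.cosh v)⁻¹))
    h2.neg hu V
  rw [D_eq_Dv, show Dv f (alpha C.normal) p (frameE C.normal i p, 0) = _ from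
    congrArg (fun g => Dv f g p (frameE C.normal i p, 0)) e, h3, ← D_eq_Dv,
    C.D_param]
  have h2 := (rad_pos C.pos (u p)).ne'
  have h3 := (Real.cosh_pos (u p)).ne'
  split_ifs
  · field_simp
  · simp

/-- The skew part is `-α` times `eps 0 i j`, which the correction in `h̃` cancels; `h̃` is then a
multiple of `diag(-2, 1, 1)`. -/
theorem a_eq (p : (Set.univ : Set M)) (i j : Fin 3) :
    ((adaptedFrame C.immersion isOpen_univ C.isUnitNormalOn C.normal_fst_ne_zero).a i j).1 p
    = (rad E (u p) * Real.cosh (u p))⁻¹ * ((if i = j then (if 0 = i then -2 else 1) else 0)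
      + Real.sinh (u p) * (eps 0 i j : ℝ)) := by
  rw [← inner_D_nu, C.D_nu, C.D_param, inner_add_left, real_inner_smul_left, inner_add_left,
    real_inner_smul_left, real_inner_smul_left, inner_add_left, real_inner_smul_left,
    real_inner_smul_left, C.inner_fst_frameE, C.inner_J_fst_frameE,
    inner_frameE (C.normal_fst_ne_zero p trivial), inner_J_frameE C.immersion C.isUnitNormalOn
      C.normal_fst_ne_zero p.2 (C.mem_horTangent p i)]
  simp only [inner_frameE (C.normal_fst_ne_zero p trivial), ite_mul, one_mul, zero_mul,
    Finset.sum_ite_eq, Finset.mem_univ, if_true]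
  have h1 := Real.cosh_sq (u p)
  have h2 := (rad_pos C.pos (u p)).ne'
  have h3 := (Real.cosh_pos (u p)).ne'
  by_cases hi : 0 = i <;> by_cases hij : i = j
  · subst hi
    subst hij
    simp only [if_true]
    field_simp
    rw [h1]
    ring
  · subst hi
    simp only [if_neg hij, if_true]
    ring
  · subst hij
    simp only [if_neg hi, if_true]
    ring
  · simp only [if_neg hij, if_neg hi]
    ring

end IsCatenoidImmersion

end

/-! ### Minimality, (P1)–(P3) and the equality case on the catenoidal hypersurface -/

section

namespace IsCatenoidImmersion

variable {M : Type*} [TopologicalSpace M] [ChartedSpace (EuclideanSpace ℝ (Fin (2 * 2))) M]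
  [IsManifold (𝓡 (2 * 2)) ∞ M]
variable {E : ℝ} {f : M → Heis 2} {u : M → ℝ}

theorem isMinimalOn (C : IsCatenoidImmersion E f u) : IsMinimalOn f C.normal Set.univ :=
  fun p _ => by
    have h := meanCurvature_eq C.immersion isOpen_univ C.isUnitNormalOn C.normal_fst_ne_zero
      ⟨p, trivial⟩
    simp only [Subalgebra.coe_add, Pi.add_apply, C.a_eq, eps] at h
    rw [h]
    simp
    ring

theorem ell_eq (C : IsCatenoidImmersion E f u) (p : M) :
    ell f C.normal p = (rad E (u p) * Real.cosh (u p))⁻¹ * -2 := by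
  have h := HeisSimons.ell_eq C.immersion isOpen_univ C.isUnitNormalOn C.normal_fst_ne_zero
    ⟨p, trivial⟩
  rw [C.a_eq] at h
  rw [h]
  simp [eps]

theorem P1 (C : IsCatenoidImmersion E f u) : P1 f C.normal Set.univ := fun p _ => by
  have h := D_nu_frameE C.immersion isOpen_univ C.isUnitNormalOn C.normal_fst_ne_zero 0
    ⟨p, trivial⟩
  simp only [C.a_eq, Fin.sum_univ_three, eps, frameE_zero] at h
  rw [nablaJnuNu, h, C.ell_eq]
  simp

theorem JnuAlpha_eq (C : IsCatenoidImmersion E f u) (p : M) : JnuAlpha f C.normal p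
    = (3 - Real.sinh (u p) ^ 2) / (rad E (u p) * Real.cosh (u p)) ^ 2 := by
  rw [JnuAlpha, ← frameE_zero, C.D_alpha, if_pos rfl]

theorem P2 (C : IsCatenoidImmersion E f u) : P2 f C.normal Set.univ := fun p _ => by
  have hmem : grad f (alpha C.normal) p ∈ horTangent f p :=
    Submodule.sum_mem _ fun i _ => Submodule.smul_mem _ _ (onb_mem f p i)
  have h := fun k => (inner_grad_alpha C.immersion isOpen_univ C.isUnitNormalOn
    C.normal_fst_ne_zero ⟨p, trivial⟩ k).trans (adaptedFrame_D_apply C.immersion isOpen_univ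
      C.isUnitNormalOn C.normal_fst_ne_zero k _ (G := alpha C.normal) (fun _ => rfl) ⟨p, trivial⟩)
  simp only [C.D_alpha] at h
  rw [eq_sum_of_mem C.immersion C.isUnitNormalOn C.normal_fst_ne_zero (p := p) trivial hmem,
    Fin.sum_univ_three, h, h, h, C.JnuAlpha_eq, frameE_zero]
  simp

theorem P3 (C : IsCatenoidImmersion E f u) : P3 f C.normal Set.univ := fun p _ => by
  rw [C.JnuAlpha_eq, alpha_catenoidNormal C.pos C.norm_eq]
  have h : (3 - Real.sinh (u p) ^ 2) / (rad E (u p) * Real.cosh (u p)) ^ 2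
      + (-(Real.sinh (u p) * (rad E (u p) * Real.cosh (u p))⁻¹)) ^ 2
      = 3 / (rad E (u p) * Real.cosh (u p)) ^ 2 := by
    generalize rad E (u p) * Real.cosh (u p) = k
    ring
  rw [h]
  positivity

/-- Equality in `three_mul_ell_sq_le`: no off-diagonal entries, and equal entries in the directions
`e₁`, `e₂`. -/
theorem two_mul_normSqHs (C : IsCatenoidImmersion E f u) (p : M) :
    2 * normSqHs f C.normal p = 3 * ell f C.normal p ^ 2 := by
  have h := normSqHs_eq C.immersion isOpen_univ C.isUnitNormalOn C.normal_fst_ne_zero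
    ⟨p, trivial⟩
  have hα : (adaptedFrame C.immersion isOpen_univ C.isUnitNormalOn
      C.normal_fst_ne_zero).α.1 ⟨p, trivial⟩
      = -(Real.sinh (u p) * (rad E (u p) * Real.cosh (u p))⁻¹) :=
    alpha_catenoidNormal C.pos C.norm_eq p
  have hb : ∀ i j, ((adaptedFrame C.immersion isOpen_univ C.isUnitNormalOn
      C.normal_fst_ne_zero).b i j).1 ⟨p, trivial⟩ = (rad E (u p) * Real.cosh (u p))⁻¹
        * (if i = j then (if 0 = i then -2 else 1) else 0) := fun i j => by
    have hc : ((eps 0 i j : smoothFunctions 2 (Set.univ : Set M))).1 ⟨p, trivial⟩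
        = (eps 0 i j : ℝ) := by simp
    rw [AdaptedFrame.b, Subalgebra.coe_add, Subalgebra.coe_mul, Pi.add_apply, Pi.mul_apply, hα,
      C.a_eq, hc]
    ring
  simp only [AdaptedFrame.normSq, coe_sum, Subalgebra.coe_mul, Pi.mul_apply, hb] at h
  rw [h, C.ell_eq]
  simp [Fin.sum_univ_three]
  ring

theorem modLaplacian_normSqHs (C : IsCatenoidImmersion E f u) (p : M) :
    1 / 2 * modLaplacian f C.normal (normSqHs f C.normal) p = lowerBound f C.normal p := by
  rw [modLaplacian_normSqHs_of_P1 C.immersion isOpen_univ C.isUnitNormalOn C.normal_fst_ne_zero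
    C.isMinimalOn C.P1 C.P2 trivial, C.two_mul_normSqHs, sub_self, mul_zero, add_zero]

end IsCatenoidImmersion

end

section

/-! ### The catenoidal hypersurface as a manifold -/

/-- `Hor 2` as a copy of `ℝ⁴`. -/
noncomputable def horEquiv : Hor 2 ≃ₗᵢ[ℝ] EuclideanSpace ℝ (Fin (2 * 2)) :=
  LinearIsometryEquiv.piLpCongrLeft 2 ℝ ℝ (finSumFinEquiv.trans (finCongr rfl))

variable {E : ℝ}

/-- The parameter `u` of a point of the catenoidal hypersurface. -/
noncomputable def catenoidParam (E : ℝ) (p : catenoid 2 E) : ℝ :=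
  Function.invFun (hgt E) p.1.2

theorem hgt_catenoidParam (hE : 0 < E) (p : catenoid 2 E) :
    p.1.2 = hgt E (catenoidParam E p) := by
  obtain ⟨u, -, hu⟩ := (mem_catenoid_iff hE).1 p.2
  exact (Function.invFun_eq ⟨u, hu.symm⟩).symm

theorem norm_eq_rad_catenoidParam (hE : 0 < E) (p : catenoid 2 E) :
    ‖p.1.1‖ = rad E (catenoidParam E p) := by
  obtain ⟨u, h1, hu⟩ := (mem_catenoid_iff hE).1 p.2
  rw [h1, (hgt_strictMono hE).injective (hu.symm.trans (hgt_catenoidParam hE p))]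

/-- The height is bounded, so `hgt E` is not onto `ℝ`; strict monotonicity still makes it an
embedding onto an interval, and continuity can be tested after composing with it. -/
theorem continuous_catenoidParam (hE : 0 < E) : Continuous (catenoidParam E) := by
  have h : Topology.IsEmbedding (hgt E) := (hgt_strictMono hE).isEmbedding_of_ordConnected
    (isPreconnected_range (contDiff_hgt hE).continuous).ordConnected
  rw [h.continuous_iff]
  have : hgt E ∘ catenoidParam E = fun p => p.1.2 :=
    funext fun p => (hgt_catenoidParam hE p).symm
  rw [this]
  fun_prop

/-- The chart of the catenoidal hypersurface as a function of the point and its parameter. -/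
noncomputable def catenoidChart (E : ℝ) (q : Heis 2 × ℝ) : EuclideanSpace ℝ (Fin (2 * 2)) :=
  horEquiv ((Real.exp q.2 / rad E q.2) • q.1.1)

theorem contDiff_catenoidChart (hE : 0 < E) : ContDiff ℝ ∞ (catenoidChart E) :=
  horEquiv.contDiff.comp ((((Real.contDiff_exp.div (contDiff_rad hE)
    fun u => (rad_pos hE u).ne').comp contDiff_snd)).smul (contDiff_fst.comp contDiff_fst))

theorem norm_catenoidChart (hE : 0 < E) (p : catenoid 2 E) :
    ‖catenoidChart E (p.1, catenoidParam E p)‖ = Real.exp (catenoidParam E p) := by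
  have h := rad_pos hE (catenoidParam E p)
  rw [catenoidChart, LinearIsometryEquiv.norm_map, norm_smul, norm_eq_rad_catenoidParam hE,
    Real.norm_of_nonneg (div_pos (Real.exp_pos _) h).le, div_mul_cancel₀ _ h.ne']

/-- The parametrization of the catenoidal hypersurface by `ℝ⁴ ∖ {0}`. -/
noncomputable def catenoidMap (E : ℝ) (w : EuclideanSpace ℝ (Fin (2 * 2))) : Heis 2 :=
  ((rad E (Real.log ‖w‖) / ‖w‖) • horEquiv.symm w, hgt E (Real.log ‖w‖))

theorem contDiffOn_catenoidMap (hE : 0 < E) : ContDiffOn ℝ ∞ (catenoidMap E) {0}ᶜ := fun w hw => by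
  have hn : ContDiffAt ℝ ∞ (fun w : EuclideanSpace ℝ (Fin (2 * 2)) => ‖w‖) w :=
    contDiffAt_norm ℝ hw
  have hl := hn.log (norm_ne_zero_iff.2 hw)
  exact (ContDiffAt.prodMk ((((contDiff_rad hE).contDiffAt.comp w hl).div hn
    (norm_ne_zero_iff.2 hw)).smul horEquiv.symm.contDiff.contDiffAt)
    ((contDiff_hgt hE).contDiffAt.comp w hl)).contDiffWithinAt

theorem catenoidMap_mem (hE : 0 < E) {w : EuclideanSpace ℝ (Fin (2 * 2))} (hw : w ≠ 0) :
    catenoidMap E w ∈ catenoid 2 E := by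
  refine (mem_catenoid_iff hE).2 ⟨Real.log ‖w‖, ?_, rfl⟩
  have h := norm_pos_iff.2 hw
  rw [catenoidMap, norm_smul, LinearIsometryEquiv.norm_map,
    Real.norm_of_nonneg (div_pos (rad_pos hE _) h).le, div_mul_cancel₀ _ h.ne']

theorem catenoidMap_catenoidChart (hE : 0 < E) (p : catenoid 2 E) :
    catenoidMap E (catenoidChart E (p.1, catenoidParam E p)) = p.1 := by
  have h := (rad_pos hE (catenoidParam E p)).ne'
  have h' := (Real.exp_pos (catenoidParam E p)).ne'
  refine Prod.ext ?_ ?_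
  · rw [catenoidMap, norm_catenoidChart hE, Real.log_exp, catenoidChart,
      LinearIsometryEquiv.symm_apply_apply, smul_smul]
    have : rad E (catenoidParam E p) / Real.exp (catenoidParam E p)
      * (Real.exp (catenoidParam E p) / rad E (catenoidParam E p)) = 1 := by field_simp
    simp only [this, one_smul]
  · rw [catenoidMap, norm_catenoidChart hE, Real.log_exp, hgt_catenoidParam hE]

theorem catenoidParam_catenoidMap (hE : 0 < E) {w : EuclideanSpace ℝ (Fin (2 * 2))} (hw : w ≠ 0) :
    catenoidParam E ⟨catenoidMap E w, catenoidMap_mem hE hw⟩ = Real.log ‖w‖ :=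
  (hgt_strictMono hE).injective (hgt_catenoidParam hE ⟨_, catenoidMap_mem hE hw⟩).symm

theorem catenoidChart_catenoidMap (hE : 0 < E) {w : EuclideanSpace ℝ (Fin (2 * 2))} (hw : w ≠ 0) :
    catenoidChart E (catenoidMap E w, Real.log ‖w‖) = w := by
  have h := (rad_pos hE (Real.log ‖w‖)).ne'
  have h' := norm_ne_zero_iff.2 hw
  rw [catenoidChart, catenoidMap, Real.exp_log (norm_pos_iff.2 hw), smul_smul]
  have : ‖w‖ / rad E (Real.log ‖w‖) * (rad E (Real.log ‖w‖) / ‖w‖) = 1 := by field_simp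
  rw [this, one_smul, LinearIsometryEquiv.apply_symm_apply]

/-- The catenoidal hypersurface is homeomorphic to `ℝ⁴ ∖ {0}`. -/
noncomputable def catenoidHomeomorph (hE : 0 < E) :
    catenoid 2 E ≃ₜ ({0}ᶜ : Set (EuclideanSpace ℝ (Fin (2 * 2)))) where
  toFun p := ⟨catenoidChart E (p.1, catenoidParam E p), fun h => by
    have h1 := norm_catenoidChart hE p
    rw [Set.mem_singleton_iff.1 h, norm_zero] at h1
    exact (Real.exp_pos _).ne h1⟩
  invFun w := ⟨catenoidMap E w, catenoidMap_mem hE w.2⟩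
  left_inv p := Subtype.ext (catenoidMap_catenoidChart hE p)
  right_inv w := Subtype.ext (by
    rw [Subtype.coe_mk, catenoidParam_catenoidMap hE w.2]
    exact catenoidChart_catenoidMap hE w.2)
  continuous_toFun := ((contDiff_catenoidChart hE).continuous.comp
    (continuous_subtype_val.prodMk (continuous_catenoidParam hE))).subtype_mk _
  continuous_invFun := ((continuousOn_iff_continuous_domRestrict.1
    (contDiffOn_catenoidMap hE).continuousOn)).subtype_mk _

theorem isOpenEmbedding_catenoidChart (hE : 0 < E) : Topology.IsOpenEmbedding
    fun p : catenoid 2 E => catenoidChart E (p.1, catenoidParam E p) :=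
  isOpen_compl_singleton.isOpenEmbedding_subtypeVal.comp (catenoidHomeomorph hE).isOpenEmbedding

theorem catenoid_nonempty (hE : 0 < E) : (catenoid 2 E).Nonempty :=
  ⟨_, catenoidMap_mem hE (w := EuclideanSpace.single 0 1) (by simp)⟩

theorem diff_comp {n : ℕ} {M F G : Type*} [TopologicalSpace M]
    [ChartedSpace (EuclideanSpace ℝ (Fin (2 * n))) M] [NormedAddCommGroup F] [NormedSpace ℝ F]
    [NormedAddCommGroup G] [NormedSpace ℝ G] {g : M → F} {φ : F → G} {p : M}
    (hφ : DifferentiableAt ℝ φ (g p)) (hg : MDifferentiableAt (𝓡 (2 * n)) 𝓘(ℝ, F) g p)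
    (v : EuclideanSpace ℝ (Fin (2 * n))) :
    diff n (fun x => φ (g x)) p v = fderiv ℝ φ (g p) (diff n g p v) := by
  unfold diff
  have h := mfderiv_comp p hφ.mdifferentiableAt hg
  rw [mfderiv_eq_fderiv] at h
  exact congrArg (fun L => L v) h

/-- One chart suffices, with image `ℝ⁴ ∖ {0}`: the direction of `z` with length `e^u`. It is a
homeomorphism for the subspace topology, so the inclusion, once an immersion, is an embedding. -/
theorem exists_manifold_catenoid (hE : 0 < E) :
    ∃ (_ : ChartedSpace (EuclideanSpace ℝ (Fin (2 * 2))) (catenoid 2 E))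
      (_ : IsManifold (𝓡 (2 * 2)) ∞ (catenoid 2 E)),
      IsCatenoidImmersion E (Subtype.val : catenoid 2 E → Heis 2) (catenoidParam E) := by
  have ho := isOpenEmbedding_catenoidChart hE
  have : Nonempty (catenoid 2 E) := (catenoid_nonempty hE).to_subtype
  let _ := ho.singletonChartedSpace
  have hM : ∀ n, IsManifold (𝓡 (2 * 2)) n (catenoid 2 E) := fun n =>
    ho.isManifold_singleton (I := 𝓡 (2 * 2))
  have hM' := hM ∞
  have hchart : ContMDiff (𝓡 (2 * 2)) (𝓡 (2 * 2)) ∞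
      (fun p : catenoid 2 E => catenoidChart E (p.1, catenoidParam E p)) :=
    contMDiff_isOpenEmbedding ho
  have hne : ∀ p : catenoid 2 E, catenoidChart E (p.1, catenoidParam E p) ≠ 0 := fun p h => by
    have h1 := norm_catenoidChart hE p
    rw [h, norm_zero] at h1
    exact (Real.exp_pos _).ne h1
  have hval : ContMDiff (𝓡 (2 * 2)) 𝓘(ℝ, Heis 2) ∞ (Subtype.val : catenoid 2 E → Heis 2) :=
    ((contDiffOn_catenoidMap hE).contMDiffOn.comp_contMDiff hchart hne).congr fun p =>
      (catenoidMap_catenoidChart hE p).symm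
  have hparam : ContMDiff (𝓡 (2 * 2)) 𝓘(ℝ, ℝ) ∞ (catenoidParam E) := by
    have hl : ContDiffOn ℝ ∞ (fun w : EuclideanSpace ℝ (Fin (2 * 2)) => Real.log ‖w‖) {0}ᶜ :=
      fun w hw => ((contDiffAt_norm ℝ hw).log (norm_ne_zero_iff.2 hw)).contDiffWithinAt
    refine (hl.contMDiffOn.comp_contMDiff hchart hne).congr fun p => ?_
    simp only [Function.comp_apply, norm_catenoidChart hE, Real.log_exp]
  refine ⟨inferInstance, hM', hE, ⟨hval, fun p => ?_⟩, hparam, norm_eq_rad_catenoidParam hE,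
    hgt_catenoidParam hE⟩
  -- The chart is a smooth function of the point and its parameter. A vector killed by the inclusion
  -- does not change the height, nor therefore the parameter, so the differential of the chart kills
  -- it as well.
  have hinj : Function.Injective
      (diff 2 (fun p : catenoid 2 E => catenoidChart E (p.1, catenoidParam E p)) p) :=
    LinearMap.injective_iff_surjective (f := (diff 2 (fun p : catenoid 2 E =>
      catenoidChart E (p.1, catenoidParam E p)) p).toLinearMap).2
      (diff_extChartAt_surjective (n := 2) (mem_extChartAt_source p))
  rw [injective_iff_map_eq_zero]
  intro v hv
  refine (injective_iff_map_eq_zero _).1 hinj v ?_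
  have hvd := hval.mdifferentiableAt (x := p) (by simp)
  have hpd := hparam.mdifferentiableAt (x := p) (by simp)
  have hu : diff 2 (catenoidParam E) p v = 0 := by
    have h1 := diff_comp (n := 2) (hasDerivAt_hgt hE (catenoidParam E p)).differentiableAt hpd v
    have h2 := diff_comp (n := 2) (φ := Prod.snd) (g := (Subtype.val : catenoid 2 E → Heis 2))
      differentiableAt_snd hvd v
    rw [hv, map_zero, funext (hgt_catenoidParam hE), h1,
      (hasDerivAt_hgt hE _).hasFDerivAt.fderiv] at h2
    have h3 := (div_pos hE (mul_pos three_pos (rad_pos hE (catenoidParam E p)))).ne'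
    simpa [hE.ne', (rad_pos hE (catenoidParam E p)).ne'] using h2
  have h4 := diff_comp (n := 2) (g := fun x : catenoid 2 E => (x.1, catenoidParam E x))
    ((contDiff_catenoidChart hE).differentiable (by simp)).differentiableAt
    (hvd.prodMk_space hpd) v
  have h5 : diff 2 (fun x : catenoid 2 E => (x.1, catenoidParam E x)) p v
      = (diff 2 (Subtype.val : catenoid 2 E → Heis 2) p v, diff 2 (catenoidParam E) p v) :=
    Prod.ext
      ((diff_comp (n := 2) (φ := Prod.fst) (g := fun x : catenoid 2 E => (x.1, catenoidParam E x))
        differentiableAt_fst (hvd.prodMk_space hpd) v).trans (by rw [fderiv_fst]; rfl)).symm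
      ((diff_comp (n := 2) (φ := Prod.snd) (g := fun x : catenoid 2 E => (x.1, catenoidParam E x))
        differentiableAt_snd (hvd.prodMk_space hpd) v).trans (by rw [fderiv_snd]; rfl)).symm
  rw [h4, h5, hv, hu]
  exact map_zero _

end

end HeisSimons

theorem mainTheorem4 :
    (∀ (M : Type*) [TopologicalSpace M] [ChartedSpace (EuclideanSpace ℝ (Fin 4)) M]
        [IsManifold (𝓡 4) ∞ M] (f : M → Heis 2) (U : Set M) (N : M → Hor 2 × ℝ),
      IsImmersion f → IsOpen U → IsUnitNormalOn f N U → (∀ p ∈ U, ¬ IsCharacteristicAt f p) →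
      IsMinimalOn f N U →
        (∀ p ∈ U, inner2 f p (hs f N p) (hsJ f N p)
          = 2 * ‖nablaJnuNu f N p‖ ^ 2 - normSqHs f N p) ∧
        (P2 f N U →
          (∀ p ∈ U, 1 / 2 * modLaplacian f N (normSqHs f N) p
            = normSqNablaHs f N p - q f N p * normSqHs f N p
              + 4 * alpha N p ^ 2 * normSqHs f N p
              - 8 * alpha N p ^ 2 * ‖nablaJnuNu f N p‖ ^ 2
              + 2 * alpha N p ^ 2 * ell f N p ^ 2
              + 4 * (JnuAlpha f N p + alpha N p ^ 2)
                * (2 * normSqHs f N p - 4 * ‖nablaJnuNu f N p‖ ^ 2 + ell f N p ^ 2)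
              + (8 * JnuAlpha f N p + 6 * alpha N p ^ 2)
                * (‖nablaJnuNu f N p‖ ^ 2 - ell f N p ^ 2)) ∧
          (P1 f N U → P3 f N U →
            ∀ p ∈ U, lowerBound f N p ≤ 1 / 2 * modLaplacian f N (normSqHs f N) p))) ∧
    (∀ E : ℝ, 0 < E → (catenoid 2 E).Nonempty ∧
      ∃ (_ : ChartedSpace (EuclideanSpace ℝ (Fin 4)) (catenoid 2 E))
        (_ : IsManifold (𝓡 4) ∞ (catenoid 2 E)) (N : catenoid 2 E → Hor 2 × ℝ),
        IsImmersion (Subtype.val : catenoid 2 E → Heis 2) ∧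
        IsUnitNormalOn (Subtype.val : catenoid 2 E → Heis 2) N Set.univ ∧
        (∀ p : catenoid 2 E, ¬ IsCharacteristicAt (Subtype.val : catenoid 2 E → Heis 2) p) ∧
        IsMinimalOn (Subtype.val : catenoid 2 E → Heis 2) N Set.univ ∧
        P1 (Subtype.val : catenoid 2 E → Heis 2) N Set.univ ∧
        P2 (Subtype.val : catenoid 2 E → Heis 2) N Set.univ ∧
        P3 (Subtype.val : catenoid 2 E → Heis 2) N Set.univ ∧
        ∀ p : catenoid 2 E,
          1 / 2 * modLaplacian (Subtype.val : catenoid 2 E → Heis 2) N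
            (normSqHs (Subtype.val : catenoid 2 E → Heis 2) N) p
          = lowerBound (Subtype.val : catenoid 2 E → Heis 2) N p) := by
  refine ⟨fun M _ _ _ f U N hf hU hN hc hmin => ?_, fun E hE => ?_⟩
  · have h : ∀ p ∈ U, (N p).1 ≠ 0 := fun p hp => horizontalPart_ne_zero (hf.2 p) hN hp (hc p hp)
    refine ⟨fun p hp => inner2_hsJ_eq hf hU hN h hmin ⟨p, hp⟩, fun h2 =>
      ⟨fun p hp => modLaplacian_normSqHs hf hU hN h hmin h2 hp, fun h1 h3 p hp => ?_⟩⟩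
    -- The excess over the bound is a product of the quantity in (P3) and the trace inequality, both
    -- nonnegative.
    rw [modLaplacian_normSqHs_of_P1 hf hU hN h hmin h1 h2 hp]
    have h4 := three_mul_ell_sq_le hf hU hN h hmin hp
    have h5 := mul_nonneg (h3 p hp) (sub_nonneg.2 h4)
    linarith
  · obtain ⟨_, _, C⟩ := exists_manifold_catenoid hE
    exact ⟨catenoid_nonempty hE, _, ‹_›, C.normal, C.immersion, C.isUnitNormalOn,
      C.not_isCharacteristicAt, C.isMinimalOn, C.P1, C.P2, C.P3, C.modLaplacian_normSqHs⟩
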